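/- Let $n\ge 3$. Let $R^n_1$ be $\mathbb R^n$ with the form $g(x,y)=x_1y_1+\dots+x_{n-1}y_{n-1}-x_ny_n$, and let $C^n_1=R^n_1\cup C_\infty$ be its conformal compactification, where the cone at infinity $C_\infty$ consists of the classes $[v:t]\in P(\mathbb R^n\times\mathbb R)$ with $g(v,v)=0$; its charts are the inclusion of $R^n_1$ and the inversions $x\mapsto (x-a)/g(x-a,x-a)$, $a\in R^n_1$, extended continuously to $C_\infty$, and its conformal structure is that of $g$. Let $\langle X,Y\rangle=x^0y^0+g(x,y)-x^{n+1}y^{n+1}$ on $\mathbb R^{n+2}$, let $Q^n_1\subset P^{n+1}$ be the quadric $\langle X,X\rangle=0$, and let $\varphi:C^n_1\to Q^n_1$ be the Darboux mapping, $\varphi(x)=[\tfrac{1-g(x,x)}2:x:\tfrac{1+g(x,x)}2]$, $\varphi([v:t])=[-t:v:t]$. The isotropic lines of $C^n_1$ are the isotropic straight lines of $R^n_1$, each completed by its ideal point, and the generators of $C_\infty$. Let $V=V^{n-1}$ be a smooth (immersed) hypersurface of $C^n_1$, parametrized by an $(n-1)$-dimensional manifold $M$, which is lightlike: $g$ is degenerate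 on every tangent space of $V$. Let $U=\varphi(V)$. Then: 1. $U$ is an $(n-1)$-dimensional smooth (immersed) submanifold of $P^{n+1}$ contained in $Q^n_1$, embedded if $V$ is embedded. 2. $U$ is ruled: for each $u\in M$ there is a unique straight line $\ell_u\subset P^{n+1}$ of which an open segment around the point of $U$ with parameter $u$ lies on $U$ (as the image of a smooth curve of $M$ through $u$). The line $\ell_u$ is contained in $Q^n_1$, and $\ell_u=\varphi(L_u)$, where $L_u$ is the unique isotropic line of $C^n_1$ into which some smooth curve of $V$ through $u$ with nonzero velocity at $u$ is mapped. 3. $U$ is tangentially degenerate of rank $n-2$: the Gauss map $u\mapsto T_uU$ (the projective tangent $(n-1)$-plane) has rank $n-2$ at every point. For each $u$, both $T_{u'}U$ and $\ell_{u'}$ are constant for $u'$ in the connected component of $u$ in the set of parameters of points of $U$ lying on $\ell_u$. At every nonsingular point of the whole line $\ell_u$ the tangent plane of the variety swept out by the rulings is $T_uU$. Here the tangent plane of that variety at a point $P\in\ell_u$ is spanned by the differentials at $u$ of all smooth moving points $S(u')\in\ell_{u'}$ with $S(u)=P$ (in homogeneous coordinates), and $P$ is called singular if its dimension is less than $n-1$.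 Singular points of $V$ on $L_u$ are defined in the same way in $C^n_1$, by means of the family of lines $L_{u'}$. 4. Near each $u$ there is a smooth moving frame $A_0,\dots,A_{n+1}$ of $\mathbb R^{n+2}$ along $M$ such that $A_0$ is the varying point of $U$, $A_1,\dots,A_{n-1}$ lie in the tangent plane of $U$, and all scalar products of frame vectors vanish except $\langle A_0,A_{n+1}\rangle=\langle A_1,A_n\rangle=-1$ and $g_{ij}=\langle A_i,A_j\rangle$, $2\le i,j\le n-1$. For every such frame $\ell_u$ is the line $A_0A_1$, $(g_{ij})$ is positive definite, and there is a unique matrix $(\lambda^i_j)_{2\le i,j\le n-1}$ with $dA_0=\omega_0^0A_0+\omega_0^1A_1+\omega_0^iA_i$, $dA_1=\omega_1^0A_0+\omega_1^1A_1+\omega_1^iA_i$ and $\omega_1^i=\lambda^i_j\omega_0^j$ at $u$. It is symmetric with respect to $g_{ij}$, that is, $g_{ik}\lambda^k_j=g_{jk}\lambda^k_i$. The singular points of $\ell_u$ are exactly the points $A_1+xA_0$ with $x$ real and $\det(\lambda^i_j+x\delta^i_j)=0$, and this equation has $n-2$ real roots counted with multiplicity; so each ruling carries $n-2$ real singular points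 counted with multiplicity. 5. The singular points of $\ell_u$ are the images under $\varphi$ of the singular points of $V$ on $L_u$. -/

import Mathlib

open scoped Manifold ContDiff Topology LinearAlgebra.Projectivization

noncomputable section

namespace LightlikeDarboux

/-! ## Minkowski space and its conformal compactification -/

/-- The vector space underlying the pseudo-Euclidean space `R^n_1`. -/
abbrev Mink (n : ℕ) : Type := EuclideanSpace ℝ (Fin n)

/-- The Lorentzian scalar product `x₁y₁ + ⋯ + x_{n-1}y_{n-1} - x_n y_n` of `R^n_1`. -/
def minkForm (n : ℕ) : LinearMap.BilinForm ℝ (Mink n) :=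
  LinearMap.mk₂ ℝ (fun x y => ∑ i : Fin n, (if (i : ℕ) + 1 = n then (-1 : ℝ) else 1) * x i * y i)
    (fun x x' y => by simp [mul_add, add_mul, Finset.sum_add_distrib])
    (fun c x y => by
      simp only [PiLp.smul_apply, smul_eq_mul, Finset.mul_sum]
      exact Finset.sum_congr rfl fun i _ => by ring)
    (fun x y y' => by simp [mul_add, Finset.sum_add_distrib])
    (fun c x y => by
      simp only [PiLp.smul_apply, smul_eq_mul, Finset.mul_sum]
      exact Finset.sum_congr rfl fun i _ => by ring)

theorem minkForm_apply {n : ℕ} (x y : Mink n) :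
    minkForm n x y = ∑ i : Fin n, (if (i : ℕ) + 1 = n then (-1 : ℝ) else 1) * x i * y i := rfl

theorem minkForm_comm {n : ℕ} (x y : Mink n) : minkForm n x y = minkForm n y x := by
  simp only [minkForm_apply]
  exact Finset.sum_congr rfl fun i _ => by ring

theorem contDiff_minkForm {n : ℕ} {k : WithTop ℕ∞} {f h : Mink n → Mink n}
    (hf : ContDiff ℝ k f) (hh : ContDiff ℝ k h) :
    ContDiff ℝ k fun y => minkForm n (f y) (h y) := by
  simp only [minkForm_apply]
  fun_prop

theorem exists_minkForm_ne_zero {n : ℕ} {v : Mink n} (hv : v ≠ 0) : ∃ a, minkForm n a v ≠ 0 := by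
  obtain ⟨i, hi⟩ : ∃ i, v i ≠ 0 := by
    by_contra hcon
    push Not at hcon
    exact hv (by ext i; simpa using hcon i)
  refine ⟨EuclideanSpace.single i 1, ?_⟩
  rw [minkForm_apply, Finset.sum_eq_single i]
  · split_ifs <;> simpa using hi
  · intro j _ hj
    simp [hj]
  · simp

/-- The light cone `C_y` at infinity. Its points are the classes `[v : t]` with `v` isotropic.
`[0 : 1]` is the vertex `y = ∞`; for `v ≠ 0` the class `[v : t]` is the common ideal end of the
isotropic lines of direction `v` that lie in the isotropic hyperplane `g(v, x) = t`. -/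
@[ext]
structure ConeAtInfinity (n : ℕ) : Type where
  /-- The class `[v : t]`. -/
  pt : ℙ ℝ (Mink n × ℝ)
  isotropic : minkForm n pt.rep.1 pt.rep.1 = 0

/-- The pseudoconformal space `C^n_1 = R^n_1 ∪ C_y`. -/
inductive ConformalSpace (n : ℕ) : Type
  | point (x : Mink n) : ConformalSpace n
  | ideal (q : ConeAtInfinity n) : ConformalSpace n

namespace ConformalSpace

variable {n : ℕ}

/-- The ideal point `[v : t]`. -/
def idealAt (v : Mink n) (t : ℝ) (hv : minkForm n v v = 0) (h : (v, t) ≠ 0) :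
    ConformalSpace n :=
  ideal ⟨Projectivization.mk ℝ (v, t) h, by
    obtain ⟨a, ha⟩ := Projectivization.exists_smul_eq_mk_rep ℝ (v, t) h
    rw [← ha]
    simp [Units.smul_def, hv]⟩

/-- The affine chart `R^n_1 ⊆ C^n_1`. -/
def stdChart : PartialEquiv (ConformalSpace n) (Mink n) where
  toFun p := match p with
    | point x => x
    | ideal _ => 0
  invFun := point
  source := Set.range point
  target := Set.univ
  map_source' _ _ := Set.mem_univ _
  map_target' y _ := ⟨y, rfl⟩
  left_inv' := by rintro _ ⟨x, rfl⟩; rfl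
  right_inv' _ _ := rfl

/-- Inversion `x ↦ (x - a) / g(x - a, x - a)` in the light cone of `a`, extended by continuity
to the ideal points `[v : t]`. -/
def inversion (a : Mink n) : ConformalSpace n → Mink n
  | point x => (minkForm n (x - a) (x - a))⁻¹ • (x - a)
  | ideal q => (2 * (q.pt.rep.2 - minkForm n a q.pt.rep.1))⁻¹ • q.pt.rep.1

/-- The points of `C^n_1` outside the isotropic cone with vertex `a`. -/
def offCone (a : Mink n) : ConformalSpace n → Prop
  | point x => minkForm n (x - a) (x - a) ≠ 0
  | ideal q => q.pt.rep.2 ≠ minkForm n a q.pt.rep.1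

theorem invChart_aux_ne (a y : Mink n) : (y, 1 / 2 + minkForm n a y) ≠ (0 : Mink n × ℝ) := by
  intro h
  have h1 : y = 0 := congrArg Prod.fst h
  have h2 : 1 / 2 + minkForm n a y = 0 := congrArg Prod.snd h
  rw [h1] at h2
  norm_num at h2

open Classical in
/-- The inverse of `inversion a`. -/
def inversionSymm (a y : Mink n) : ConformalSpace n :=
  if h : minkForm n y y = 0 then idealAt y (1 / 2 + minkForm n a y) h (invChart_aux_ne a y)
  else point (a + (minkForm n y y)⁻¹ • y)

theorem inversionSymm_of_eq {a y : Mink n} (h : minkForm n y y = 0) :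
    inversionSymm a y = idealAt y (1 / 2 + minkForm n a y) h (invChart_aux_ne a y) := dif_pos h

theorem inversionSymm_of_ne {a y : Mink n} (h : minkForm n y y ≠ 0) :
    inversionSymm a y = point (a + (minkForm n y y)⁻¹ • y) := dif_neg h

theorem ideal_eq_idealAt (q : ConeAtInfinity n) (v : Mink n) (t : ℝ) (hv : minkForm n v v = 0)
    (h : (v, t) ≠ 0) (c : ℝ) (hc : c • q.pt.rep = (v, t)) : idealAt v t hv h = ideal q := by
  unfold idealAt
  congr 1
  apply ConeAtInfinity.ext
  change Projectivization.mk ℝ (v, t) h = q.pt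
  rw [← Projectivization.mk_rep q.pt, Projectivization.mk_eq_mk_iff']
  exact ⟨c, hc⟩

theorem inversion_idealAt (a v : Mink n) (t : ℝ) (hv : minkForm n v v = 0) (h : (v, t) ≠ 0) :
    inversion a (idealAt v t hv h) = (2 * (t - minkForm n a v))⁻¹ • v := by
  obtain ⟨c, hc⟩ := Projectivization.exists_smul_eq_mk_rep ℝ (v, t) h
  have hc0 : (c : ℝ) ≠ 0 := c.ne_zero
  simp only [inversion, idealAt]
  rw [← hc]
  simp only [Units.smul_def, Prod.smul_fst, Prod.smul_snd, map_smul, smul_eq_mul, smul_smul]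
  congr 1
  rw [← mul_sub, mul_left_comm, mul_inv, mul_right_comm, inv_mul_cancel₀ hc0, one_mul]

theorem offCone_idealAt (a v : Mink n) (t : ℝ) (hv : minkForm n v v = 0) (h : (v, t) ≠ 0) :
    offCone a (idealAt v t hv h) ↔ t ≠ minkForm n a v := by
  obtain ⟨c, hc⟩ := Projectivization.exists_smul_eq_mk_rep ℝ (v, t) h
  have hc0 : (c : ℝ) ≠ 0 := c.ne_zero
  simp only [offCone, idealAt]
  rw [← hc]
  simp [Units.smul_def, hc0]

theorem minkForm_inv_smul (y : Mink n) :
    minkForm n ((minkForm n y y)⁻¹ • y) ((minkForm n y y)⁻¹ • y) = (minkForm n y y)⁻¹ := by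
  by_cases h : minkForm n y y = 0
  · simp [h]
  · simp only [map_smul, LinearMap.smul_apply, smul_eq_mul]
    field_simp

/-- The chart `inversion a`, defined off the isotropic cone with vertex `a`; it is onto `R^n`. -/
def invChart (a : Mink n) : PartialEquiv (ConformalSpace n) (Mink n) where
  toFun := inversion a
  invFun := inversionSymm a
  source := {p | offCone a p}
  target := Set.univ
  map_source' _ _ := Set.mem_univ _
  map_target' y _ := by
    unfold inversionSymm
    split_ifs with h
    · exact (offCone_idealAt _ _ _ h _).2 (by simp)
    · simp only [Set.mem_ofPred_eq, offCone, add_sub_cancel_left]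
      rw [minkForm_inv_smul]
      exact inv_ne_zero h
  left_inv' p hp := by
    cases p with
    | point x =>
      have hx : minkForm n (x - a) (x - a) ≠ 0 := hp
      change inversionSymm a ((minkForm n (x - a) (x - a))⁻¹ • (x - a)) = point x
      rw [inversionSymm_of_ne (by rw [minkForm_inv_smul]; exact inv_ne_zero hx),
        minkForm_inv_smul, smul_smul, inv_inv, mul_inv_cancel₀ hx, one_smul, add_sub_cancel]
    | ideal q =>
      have hq : q.pt.rep.2 ≠ minkForm n a q.pt.rep.1 := hp
      have hq' := sub_ne_zero.2 hq
      change inversionSymm a ((2 * (q.pt.rep.2 - minkForm n a q.pt.rep.1))⁻¹ • q.pt.rep.1) =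
        ideal q
      rw [inversionSymm_of_eq (by simp [q.isotropic])]
      apply ideal_eq_idealAt _ _ _ _ _ ((2 * (q.pt.rep.2 - minkForm n a q.pt.rep.1))⁻¹)
      refine Prod.ext rfl ?_
      simp only [Prod.smul_snd, smul_eq_mul, map_smul]
      field_simp
      ring
  right_inv' y _ := by
    unfold inversionSymm
    split_ifs with h
    · rw [inversion_idealAt]
      simp
    · simp only [inversion, add_sub_cancel_left]
      rw [minkForm_inv_smul, smul_smul, inv_inv, mul_inv_cancel₀ h, one_smul]

/-- The atlas: the affine chart (`none`) and the inversions (`some a`). -/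
def chartOf : Option (Mink n) → PartialEquiv (ConformalSpace n) (Mink n)
  | none => stdChart
  | some a => invChart a

theorem exists_offCone (q : ConeAtInfinity n) : ∃ a : Mink n, offCone a (ideal q) := by
  by_cases hv : q.pt.rep.1 = 0
  · refine ⟨0, fun h => q.pt.rep_nonzero (Prod.ext hv ?_)⟩
    simpa using h
  · by_cases ht : q.pt.rep.2 = 0
    · obtain ⟨a, ha⟩ := exists_minkForm_ne_zero hv
      exact ⟨a, by simpa only [offCone, ht] using ha.symm⟩
    · exact ⟨0, by simpa [offCone] using ht⟩

/-- The preferred chart at a point. -/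
def chartIndex : ConformalSpace n → Option (Mink n)
  | point _ => none
  | ideal q => some (exists_offCone q).choose

theorem mem_chartIndex_source (p : ConformalSpace n) : p ∈ (chartOf (chartIndex p)).source := by
  cases p with
  | point x => exact ⟨x, rfl⟩
  | ideal q => exact (exists_offCone q).choose_spec

theorem continuous_minkForm {f h : Mink n → Mink n} (hf : ContDiff ℝ ∞ f) (hh : ContDiff ℝ ∞ h) :
    Continuous fun y => minkForm n (f y) (h y) := (contDiff_minkForm hf hh).continuous

theorem offCone_inversionSymm (a b y : Mink n) :
    offCone b (inversionSymm a y) ↔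
      minkForm n (a - b) (a - b) * minkForm n y y + 2 * minkForm n (a - b) y + 1 ≠ 0 := by
  unfold inversionSymm
  split_ifs with h
  · rw [offCone_idealAt, h]
    simp only [map_sub, LinearMap.sub_apply]
    rw [not_iff_not]
    constructor <;> intro h' <;> linarith
  · have h1 : a + (minkForm n y y)⁻¹ • y - b = (a - b) + (minkForm n y y)⁻¹ • y := by abel
    simp only [offCone, h1]
    generalize a - b = c
    have h2 : minkForm n (c + (minkForm n y y)⁻¹ • y) (c + (minkForm n y y)⁻¹ • y) =
        (minkForm n y y)⁻¹ * (minkForm n c c * minkForm n y y + 2 * minkForm n c y + 1) := by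
      simp only [map_add, map_smul, LinearMap.add_apply, LinearMap.smul_apply, smul_eq_mul,
        minkForm_comm y c]
      field_simp
      ring
    rw [h2]
    simp [h]

theorem inversion_inversionSymm (a b y : Mink n) :
    inversion b (inversionSymm a y) =
      (minkForm n (a - b) (a - b) * minkForm n y y + 2 * minkForm n (a - b) y + 1)⁻¹ •
        (minkForm n y y • (a - b) + y) := by
  unfold inversionSymm
  split_ifs with h
  · rw [inversion_idealAt, h]
    simp only [map_sub, LinearMap.sub_apply, zero_smul, zero_add]
    congr 2
    ring
  · have h1 : a + (minkForm n y y)⁻¹ • y - b = (a - b) + (minkForm n y y)⁻¹ • y := by abel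
    simp only [inversion, h1]
    generalize a - b = c
    have h2 : minkForm n (c + (minkForm n y y)⁻¹ • y) (c + (minkForm n y y)⁻¹ • y) =
        (minkForm n y y)⁻¹ * (minkForm n c c * minkForm n y y + 2 * minkForm n c y + 1) := by
      simp only [map_add, map_smul, LinearMap.add_apply, LinearMap.smul_apply, smul_eq_mul,
        minkForm_comm y c]
      field_simp
      ring
    have h3 : c + (minkForm n y y)⁻¹ • y = (minkForm n y y)⁻¹ • (minkForm n y y • c + y) := by
      rw [smul_add, smul_smul, inv_mul_cancel₀ h, one_smul]
    rw [h2, h3, smul_smul, mul_inv, inv_inv]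
    congr 1
    rw [mul_right_comm, mul_inv_cancel₀ h, one_mul]

/-- The changes of charts are smooth with open domain. -/
theorem chart_transition (c d : Option (Mink n)) :
    IsOpen ((chartOf c).symm.trans (chartOf d)).source ∧
      ContDiffOn ℝ ∞ ((chartOf c).symm.trans (chartOf d))
        ((chartOf c).symm.trans (chartOf d)).source := by
  match c, d with
  | none, none =>
    have hs : ((chartOf (n := n) none).symm.trans (chartOf none)).source = Set.univ := by
      ext y
      simp only [PartialEquiv.trans_source, Set.mem_univ, iff_true]
      exact ⟨trivial, y, rfl⟩
    rw [hs]
    exact ⟨isOpen_univ, contDiff_id.contDiffOn⟩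
  | none, some a =>
    have hg : ContDiff ℝ ∞ fun y : Mink n => minkForm n (y - a) (y - a) :=
      contDiff_minkForm (by fun_prop) (by fun_prop)
    have hs : ((chartOf (n := n) none).symm.trans (chartOf (some a))).source =
        {y | minkForm n (y - a) (y - a) ≠ 0} := by
      ext y
      exact ⟨fun h => h.2, fun h => ⟨trivial, h⟩⟩
    rw [hs]
    refine ⟨isOpen_ne_fun hg.continuous continuous_const, ?_⟩
    have : ContDiffOn ℝ ∞ (fun y : Mink n => (minkForm n (y - a) (y - a))⁻¹ • (y - a))
        {y | minkForm n (y - a) (y - a) ≠ 0} :=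
      (hg.contDiffOn.inv fun y hy => hy).smul (by fun_prop)
    exact this
  | some a, none =>
    have hg : ContDiff ℝ ∞ fun y : Mink n => minkForm n y y :=
      contDiff_minkForm (by fun_prop) (by fun_prop)
    have hs : ((chartOf (n := n) (some a)).symm.trans (chartOf none)).source =
        {y | minkForm n y y ≠ 0} := by
      ext y
      by_cases h : minkForm n y y = 0 <;>
        simp [chartOf, stdChart, invChart, inversionSymm, h, idealAt]
    rw [hs]
    refine ⟨isOpen_ne_fun hg.continuous continuous_const, ?_⟩
    have : ContDiffOn ℝ ∞ (fun y : Mink n => a + (minkForm n y y)⁻¹ • y)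
        {y | minkForm n y y ≠ 0} :=
      contDiffOn_const.add ((hg.contDiffOn.inv fun y hy => hy).smul (by fun_prop))
    refine this.congr fun y hy => ?_
    have hy' : minkForm n y y ≠ 0 := hy
    simp [chartOf, stdChart, invChart, inversionSymm, hy']
  | some a, some b =>
    have hg : ContDiff ℝ ∞ fun y : Mink n => minkForm n y y :=
      contDiff_minkForm (by fun_prop) (by fun_prop)
    have hl : ContDiff ℝ ∞ fun y : Mink n => minkForm n (a - b) y :=
      contDiff_minkForm (by fun_prop) (by fun_prop)
    have hD : ContDiff ℝ ∞ fun y : Mink n =>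
        minkForm n (a - b) (a - b) * minkForm n y y + 2 * minkForm n (a - b) y + 1 := by
      fun_prop
    have hs : ((chartOf (n := n) (some a)).symm.trans (chartOf (some b))).source =
        {y | minkForm n (a - b) (a - b) * minkForm n y y + 2 * minkForm n (a - b) y + 1 ≠ 0} := by
      ext y
      rw [Set.mem_ofPred_eq, ← offCone_inversionSymm]
      simp [chartOf, invChart]
    rw [hs]
    refine ⟨isOpen_ne_fun hD.continuous continuous_const, ?_⟩
    have : ContDiffOn ℝ ∞ (fun y : Mink n =>
        (minkForm n (a - b) (a - b) * minkForm n y y + 2 * minkForm n (a - b) y + 1)⁻¹ •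
          (minkForm n y y • (a - b) + y))
        {y | minkForm n (a - b) (a - b) * minkForm n y y + 2 * minkForm n (a - b) y + 1 ≠ 0} :=
      (hD.contDiffOn.inv fun y hy => hy).smul (by fun_prop)
    exact this.congr fun y _ => inversion_inversionSymm a b y

/-- The atlas of `C^n_1`. -/
def chartedSpaceCore (n : ℕ) : ChartedSpaceCore (Mink n) (ConformalSpace n) where
  atlas := Set.range chartOf
  chartAt p := chartOf (chartIndex p)
  mem_chart_source := mem_chartIndex_source
  chart_mem_atlas p := ⟨_, rfl⟩
  open_source := by
    rintro _ _ ⟨c, rfl⟩ ⟨d, rfl⟩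
    exact (chart_transition c d).1
  continuousOn_toFun := by
    rintro _ _ ⟨c, rfl⟩ ⟨d, rfl⟩
    exact (chart_transition c d).2.continuousOn

instance : TopologicalSpace (ConformalSpace n) := (chartedSpaceCore n).toTopologicalSpace

instance : ChartedSpace (Mink n) (ConformalSpace n) := (chartedSpaceCore n).toChartedSpace

instance : IsManifold 𝓘(ℝ, Mink n) ∞ (ConformalSpace n) := by
  apply isManifold_of_contDiffOn
  rintro e e' he he'
  simp only [atlas, Set.mem_iUnion, Set.mem_singleton_iff,
    ChartedSpace.atlas] at he he'
  obtain ⟨_, ⟨c, rfl⟩, rfl⟩ := he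
  obtain ⟨_, ⟨d, rfl⟩, rfl⟩ := he'
  have h := (chart_transition c d).2
  refine ContDiffOn.mono (s := ((chartOf c).symm.trans (chartOf d)).source) h ?_
  exact fun y hy => hy.1

end ConformalSpace

open ConformalSpace

/-! ## The Darboux mapping -/

/-- Vectors `(x⁰, (x¹, …, xⁿ), xⁿ⁺¹)` of polyspherical coordinates. -/
abbrev PolyVec (n : ℕ) : Type := ℝ × Mink n × ℝ

/-- The scalar product `x⁰y⁰ + x¹y¹ + ⋯ + xⁿ⁻¹yⁿ⁻¹ - xⁿyⁿ - xⁿ⁺¹yⁿ⁺¹`. -/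
def polyForm (n : ℕ) : LinearMap.BilinForm ℝ (PolyVec n) :=
  LinearMap.mk₂ ℝ (fun X Y => X.1 * Y.1 + minkForm n X.2.1 Y.2.1 - X.2.2 * Y.2.2)
    (fun X X' Y => by simp; ring)
    (fun c X Y => by simp; ring)
    (fun X Y Y' => by simp; ring)
    (fun c X Y => by simp; ring)

/-- The projective space `P^{n+1}`. -/
abbrev ProjSpace (n : ℕ) : Type := ℙ ℝ (PolyVec n)

/-- The quotient topology of `P^{n+1}`. -/
instance (n : ℕ) : TopologicalSpace (ProjSpace n) :=
  inferInstanceAs (TopologicalSpace (Quotient (projectivizationSetoid ℝ (PolyVec n))))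

/-- The Darboux hyperquadric `Q^n_1`. -/
def darbouxQuadric (n : ℕ) : Set (ProjSpace n) := {P | polyForm n P.rep P.rep = 0}

/-- The Darboux mapping `C^n_1 → P^{n+1}`. -/
def darboux {n : ℕ} : ConformalSpace n → ProjSpace n
  | point x => Projectivization.mk ℝ
      ((1 - minkForm n x x) / 2, x, (1 + minkForm n x x) / 2) (by
        intro h
        have h1 : (1 - minkForm n x x) / 2 = 0 := congrArg Prod.fst h
        have h2 : (1 + minkForm n x x) / 2 = 0 := congrArg (fun X => X.2.2) h
        linarith)
  | ideal q => Projectivization.mk ℝ (-q.pt.rep.2, q.pt.rep.1, q.pt.rep.2) (by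
        intro h
        have h1 : q.pt.rep.1 = 0 := congrArg (fun X => X.2.1) h
        have h2 : q.pt.rep.2 = 0 := congrArg (fun X => X.2.2) h
        exact q.pt.rep_nonzero (Prod.ext h1 h2))

/-- The isotropic lines (lines of light propagation) of `C^n_1`: an isotropic straight line of
`R^n_1` completed by its ideal point, or a generator of the cone at infinity. -/
def IsIsotropicLine {n : ℕ} (L : Set (ConformalSpace n)) : Prop :=
  (∃ (x v : Mink n) (hv : v ≠ 0) (hg : minkForm n v v = 0),
    L = Set.range (fun s : ℝ => point (x + s • v)) ∪
      {idealAt v (minkForm n v x) hg (fun h => hv (congrArg Prod.fst h))}) ∨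
  (∃ v : Mink n, v ≠ 0 ∧ minkForm n v v = 0 ∧
    L = {p | ∃ (s t : ℝ) (hg : minkForm n (s • v) (s • v) = 0) (h : (s • v, t) ≠ 0),
      p = idealAt (s • v) t hg h})

section Submanifolds

variable {n : ℕ} {M : Type*} [TopologicalSpace M]
  [ChartedSpace (EuclideanSpace ℝ (Fin (n - 1))) M]

/-! ## Hypersurfaces of the pseudoconformal space -/

/-- A smooth immersed hypersurface `f : M → C^n_1` at each point of which the tangent space is
tangent to the isotropic cone, i.e. the form `g` degenerates on it. The tangent space of `C^n_1`
at a point is identified with `R^n` by one of the charts; these are related by conformal maps,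
so that the condition does not depend on the chart. -/
structure IsLightlikeHypersurface (f : M → ConformalSpace n) : Prop where
  smooth : ContMDiff (𝓡 (n - 1)) 𝓘(ℝ, Mink n) ∞ f
  immersion : ∀ u, Function.Injective (mfderiv (𝓡 (n - 1)) 𝓘(ℝ, Mink n) f u)
  lightlike : ∀ u, ∃ ξ : TangentSpace (𝓡 (n - 1)) u, ξ ≠ 0 ∧ ∀ η : TangentSpace (𝓡 (n - 1)) u,
    minkForm n (mfderiv (𝓡 (n - 1)) 𝓘(ℝ, Mink n) f u ξ) (mfderiv (𝓡 (n - 1)) 𝓘(ℝ, Mink n) f u η) = 0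

/-- `L` is an isotropic line through `f u` along which the submanifold `f` extends from `f u`:
some curve through `u` with nonzero velocity is mapped into `L`. -/
def IsIsotropicGenerator (f : M → ConformalSpace n) (u : M) (L : Set (ConformalSpace n)) : Prop :=
  IsIsotropicLine L ∧ ∃ (γ : ℝ → M) (ε : ℝ), 0 < ε ∧ γ 0 = u ∧
    ContMDiffOn 𝓘(ℝ, ℝ) (𝓡 (n - 1)) ∞ γ (Set.Ioo (-ε) ε) ∧
    mfderiv 𝓘(ℝ, ℝ) (𝓡 (n - 1)) γ 0 ≠ 0 ∧ ∀ t ∈ Set.Ioo (-ε) ε, f (γ t) ∈ L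

/-- The tangent space at `X ∈ L u` of the variety swept out by a family of curves `L` of `C^n_1`:
the span of the differentials at `u` of all smooth maps `S` with `S u = X` and `S u' ∈ L u'`
for `u'` near `u`. -/
def sweptTangent (L : M → Set (ConformalSpace n)) (u : M) (X : ConformalSpace n) :
    Submodule ℝ (Mink n) :=
  ⨆ S ∈ {S : M → ConformalSpace n | S u = X ∧ ContMDiffAt (𝓡 (n - 1)) 𝓘(ℝ, Mink n) ∞ S u ∧
      ∀ᶠ u' in 𝓝 u, S u' ∈ L u'},
    Submodule.span ℝ (Set.range fun ξ : TangentSpace (𝓡 (n - 1)) u =>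
      (mfderiv (𝓡 (n - 1)) 𝓘(ℝ, Mink n) S u ξ : Mink n))

/-- `X ∈ L u` is singular if the tangent space there of the `(n-1)`-dimensional variety swept out by
the lines of the family `L` has dimension less than `n - 1`. -/
def IsSingularPoint (L : M → Set (ConformalSpace n)) (u : M) (X : ConformalSpace n) : Prop :=
  X ∈ L u ∧ Module.finrank ℝ (sweptTangent L u X) < n - 1

/-! ## Submanifolds of the projective space

A projective subspace of dimension `k` is given by a `(k+1)`-dimensional subspace of `PolyVec n`. -/

/-- `S` is, near `u`, a smooth vector field along `M` with values in the subspaces `Λ u'`. -/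
def IsLocalSection (Λ : M → Submodule ℝ (PolyVec n)) (u : M) (S : M → PolyVec n) : Prop :=
  ContMDiffAt (𝓡 (n - 1)) 𝓘(ℝ, PolyVec n) ∞ S u ∧ ∀ᶠ u' in 𝓝 u, S u' ∈ Λ u'

/-- The tangent subspace at the point `P` of the subspace `Λ u` to the variety swept out by the
family `Λ` of projective subspaces: the span of the differentials `dS` of all smooth moving points
`S` of `Λ` that represent `P` at `u` (rescaling `S` and moving it within `Λ u` is allowed, so the
span contains `P`). -/
def projSweptTangent (Λ : M → Submodule ℝ (PolyVec n)) (u : M) (P : ProjSpace n) :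
    Submodule ℝ (PolyVec n) :=
  ⨆ S ∈ {S : M → PolyVec n | IsLocalSection Λ u S ∧ S u ≠ 0 ∧ S u ∈ P.submodule},
    Submodule.span ℝ (Set.range fun ξ : TangentSpace (𝓡 (n - 1)) u =>
      (mfderiv (𝓡 (n - 1)) 𝓘(ℝ, PolyVec n) S u ξ : PolyVec n))

/-- The tangent subspace of `ψ : M → P^{n+1}` at `u`. -/
def tangentPlane (ψ : M → ProjSpace n) (u : M) : Submodule ℝ (PolyVec n) :=
  projSweptTangent (fun u' => (ψ u').submodule) u (ψ u)

/-- `ψ` is a smooth immersion: it has smooth homogeneous coordinates near each point, and its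
tangent subspaces are `(n-1)`-dimensional. -/
def IsProjImmersion (ψ : M → ProjSpace n) : Prop :=
  ∀ u, (∃ S : M → PolyVec n, IsLocalSection (fun u' => (ψ u').submodule) u S ∧ S u ≠ 0) ∧
    Module.finrank ℝ (tangentPlane ψ u) = n

/-- `ℓ` is a straight line of which an open segment around `ψ u` is contained in `ψ`. -/
def IsRuling (ψ : M → ProjSpace n) (u : M) (ℓ : Submodule ℝ (PolyVec n)) : Prop :=
  Module.finrank ℝ ℓ = 2 ∧ ∃ (a w : PolyVec n) (γ : ℝ → M) (ε : ℝ),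
    ℓ = Submodule.span ℝ {a, w} ∧ 0 < ε ∧ γ 0 = u ∧
    ContMDiffOn 𝓘(ℝ, ℝ) (𝓡 (n - 1)) ∞ γ (Set.Ioo (-ε) ε) ∧
    ∀ t ∈ Set.Ioo (-ε) ε, (ψ (γ t)).submodule = Submodule.span ℝ {a + t • w}

/-- The kernel at `u` of the differential of a map `T` into a Grassmannian. The differential sends
a tangent vector `ξ` to the homomorphism `T u → PolyVec n / T u` induced by `s ↦ ds(ξ)` on the
local sections `s` of `T`. -/
def grassmannKer (T : M → Submodule ℝ (PolyVec n)) (u : M) :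
    Submodule ℝ (TangentSpace (𝓡 (n - 1)) u) where
  carrier := {ξ | ∀ s : M → PolyVec n, IsLocalSection T u s →
    (mfderiv (𝓡 (n - 1)) 𝓘(ℝ, PolyVec n) s u ξ : PolyVec n) ∈ T u}
  add_mem' := fun {ξ η} hξ hη s hs => by
    rw [map_add]
    exact (T u).add_mem (hξ s hs) (hη s hs)
  zero_mem' := fun s _ => by
    rw [map_zero]
    exact (T u).zero_mem
  smul_mem' := fun c ξ hξ s hs => by
    rw [map_smul]
    exact (T u).smul_mem c (hξ s hs)

/-- The rank at `u` of a map `T` into a Grassmannian. -/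
def grassmannRank (T : M → Submodule ℝ (PolyVec n)) (u : M) : ℕ :=
  Module.finrank ℝ (TangentSpace (𝓡 (n - 1)) u ⧸ grassmannKer T u)

/-- The point `P` of the line `ℓ u` is singular if the tangent subspace there of the
`(n-1)`-dimensional variety swept out by the lines of the family `ℓ` has projective dimension less
than `n - 1`. -/
def IsProjSingularPoint (ℓ : M → Submodule ℝ (PolyVec n)) (u : M) (P : ProjSpace n) : Prop :=
  P.submodule ≤ ℓ u ∧ Module.finrank ℝ (projSweptTangent ℓ u P) < n

/-- An adapted moving frame `A₀, A₁, e₂, …, e_{n-1}, Aₙ, Aₙ₊₁` of `ψ` near `u`: `A₀` is the varying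
point of `ψ`, the points `A₁, e₂, …, e_{n-1}` lie in its tangent subspace, and the nonzero scalar
products are `(A₀, Aₙ₊₁) = (A₁, Aₙ) = -1` and `(eᵢ, eⱼ)`. -/
structure IsAdaptedFrame (ψ : M → ProjSpace n) (u : M) (A₀ A₁ : M → PolyVec n)
    (e : Fin (n - 2) → M → PolyVec n) (Aₙ Aₙ₁ : M → PolyVec n) : Prop where
  smooth_zero : ContMDiffAt (𝓡 (n - 1)) 𝓘(ℝ, PolyVec n) ∞ A₀ u
  smooth_one : ContMDiffAt (𝓡 (n - 1)) 𝓘(ℝ, PolyVec n) ∞ A₁ u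
  smooth_mid : ∀ i, ContMDiffAt (𝓡 (n - 1)) 𝓘(ℝ, PolyVec n) ∞ (e i) u
  smooth_n : ContMDiffAt (𝓡 (n - 1)) 𝓘(ℝ, PolyVec n) ∞ Aₙ u
  smooth_n_one : ContMDiffAt (𝓡 (n - 1)) 𝓘(ℝ, PolyVec n) ∞ Aₙ₁ u
  point_eq : ∀ᶠ v in 𝓝 u, (ψ v).submodule = Submodule.span ℝ {A₀ v}
  one_mem : ∀ᶠ v in 𝓝 u, A₁ v ∈ tangentPlane ψ v
  mid_mem : ∀ᶠ v in 𝓝 u, ∀ i, e i v ∈ tangentPlane ψ v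
  mid_indep : ∀ᶠ v in 𝓝 u, LinearIndependent ℝ fun i => e i v
  gram_isotropic : ∀ᶠ v in 𝓝 u, polyForm n (A₀ v) (A₀ v) = 0 ∧ polyForm n (A₁ v) (A₁ v) = 0 ∧
    polyForm n (Aₙ v) (Aₙ v) = 0 ∧ polyForm n (Aₙ₁ v) (Aₙ₁ v) = 0
  gram_normal : ∀ᶠ v in 𝓝 u, polyForm n (A₀ v) (Aₙ₁ v) = -1 ∧ polyForm n (A₁ v) (Aₙ v) = -1
  gram_orthogonal : ∀ᶠ v in 𝓝 u, polyForm n (A₀ v) (A₁ v) = 0 ∧ polyForm n (A₀ v) (Aₙ v) = 0 ∧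
    polyForm n (A₁ v) (Aₙ₁ v) = 0 ∧ polyForm n (Aₙ v) (Aₙ₁ v) = 0
  gram_mid : ∀ᶠ v in 𝓝 u, ∀ i, polyForm n (A₀ v) (e i v) = 0 ∧ polyForm n (A₁ v) (e i v) = 0 ∧
    polyForm n (Aₙ v) (e i v) = 0 ∧ polyForm n (Aₙ₁ v) (e i v) = 0

/-- `Λ = (λⁱⱼ)` is the affinor at `u` of an adapted frame:
`dA₀ = ω₀⁰ A₀ + ω₀¹ A₁ + ω₀ⁱ eᵢ` and `dA₁ = ω₁⁰ A₀ + ω₁¹ A₁ + ω₁ⁱ eᵢ` with `ω₁ⁱ = λⁱⱼ ω₀ʲ`. -/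
def IsAffinor (u : M) (A₀ A₁ : M → PolyVec n) (e : Fin (n - 2) → M → PolyVec n)
    (Λ : Matrix (Fin (n - 2)) (Fin (n - 2)) ℝ) : Prop :=
  ∀ ξ : TangentSpace (𝓡 (n - 1)) u, ∃ (p₀ p₁ q₀ q₁ : ℝ) (θ : Fin (n - 2) → ℝ),
    (mfderiv (𝓡 (n - 1)) 𝓘(ℝ, PolyVec n) A₀ u ξ : PolyVec n) =
      p₀ • A₀ u + p₁ • A₁ u + ∑ i, θ i • e i u ∧
    (mfderiv (𝓡 (n - 1)) 𝓘(ℝ, PolyVec n) A₁ u ξ : PolyVec n) =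
      q₀ • A₀ u + q₁ • A₁ u + ∑ i, (Λ.mulVec θ) i • e i u

/-- The matrix `gᵢⱼ = (eᵢ, eⱼ)`. -/
def frameMetric (e : Fin (n - 2) → M → PolyVec n) (u : M) :
    Matrix (Fin (n - 2)) (Fin (n - 2)) ℝ :=
  Matrix.of fun i j => polyForm n (e i u) (e j u)

end Submanifolds

/-- The polynomial `det(λⁱⱼ + x δⁱⱼ)` in `x`. -/
def singularPolynomial {k : ℕ} (Λ : Matrix (Fin k) (Fin k) ℝ) : Polynomial ℝ :=
  (Λ.map Polynomial.C + (Polynomial.X : Polynomial ℝ) • (1 : Matrix (Fin k) (Fin k) _)).det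

end LightlikeDarboux

end

namespace LightlikeDarboux

open ConformalSpace

/-! ## Linear algebra of the polyspherical form -/

section LinearAlgebra

variable {n : ℕ}

/-! Everything rests on the signature `(n, 2)` of the polyspherical form. A totally isotropic plane
`ℓ` contains no nonzero vector whose two negative coordinates vanish, so these coordinates map `ℓ`
isomorphically onto `ℝ × ℝ`. Subtracting from a vector of `ℓ^⊥` the vector of `ℓ` with the same
negative coordinates shows that the form is positive semidefinite on `ℓ^⊥`, with null vectors
exactly `ℓ`. In particular `ℓ` is the only isotropic plane contained in `ℓ^⊥`.

In each chart the Darboux mapping has a lift that is isometric up to first order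
(`polyForm_fderiv_lift`). Let `G` be such a lift of the hypersurface and let `osc G` be the span of
`G` and `dG`, of dimension `n`. If `ξ` is a degenerate direction, then `G` and `dG(ξ)` are isotropic
and orthogonal to all of `osc G`. A dimension count gives `osc G = ℓ^⊥` with `ℓ = span {G, dG(ξ)}`
(`IsLightlikeLift.perp_osc`). The ruling is therefore the orthogonal complement of the tangent
subspace, and uniqueness of both the ruling and the isotropic line comes from uniqueness of `ℓ` in
`ℓ^⊥`.

Two facts about a smooth section `A` of the moving plane `ℓ` carry the differential geometry. First,
`dA` takes values in `ℓ^⊥`, because scalar products of sections of `ℓ` vanish identically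
(`IsLightlikeLift.fderiv_section_mem`). Second, `⟨dA(ξ), dG(η)⟩` is symmetric in `ξ` and `η`,
because differentiating `⟨A, dG(η)⟩ = 0` turns it into minus the product of `A` with a second
derivative of `G`. Hence if `dG(ξ)` lies in `ℓ`, then `⟨dA(ξ), dG(η)⟩ = ⟨dA(η), dG(ξ)⟩ = 0` for all
`η`, so `dA(ξ)` lies in `ℓ` too. The plane `ℓ` is thus stationary in these directions. After fixing
the negative coordinates of a section `N` and rescaling `G`, integral curves become open segments of
straight lines, with constant tangent subspace. The same directions form the kernel of the
differential of the Gauss map, which has codimension `n - 2`.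

For the singular points, let `A₀, A₁` span `ℓ`. Modulo `ℓ` the differential of `A₁` is `Λ` applied
to that of `A₀`; the symmetry above makes `Λ` self-adjoint for the positive definite form on
`ℓ^⊥/ℓ`, so its eigenvalues are real. The tangent subspace of the swept variety at `α A₀ + β A₁` is
`ℓ` plus the range of `α dA₀ + β dA₁`, hence it is all of `ℓ^⊥` exactly when `α + β Λ` is
invertible. Singular points correspond under the Darboux mapping because passing to homogeneous
coordinates adds exactly the point itself to the tangent space. -/

theorem polyForm_apply (X Y : PolyVec n) :
    polyForm n X Y = X.1 * Y.1 + minkForm n X.2.1 Y.2.1 - X.2.2 * Y.2.2 := rfl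

theorem polyForm_comm (X Y : PolyVec n) : polyForm n X Y = polyForm n Y X := by
  simp only [polyForm_apply, minkForm_comm X.2.1 Y.2.1]
  ring

theorem polyForm_isRefl : (polyForm n).IsRefl := fun X Y h => by rw [polyForm_comm]; exact h

/-- The last coordinate of a vector of `R^n_1`. -/
noncomputable def lastCoord (n : ℕ) : Mink n →ₗ[ℝ] ℝ where
  toFun x := ∑ i : Fin n, (if (i : ℕ) + 1 = n then (1 : ℝ) else 0) * x i
  map_add' x y := by simp [mul_add, Finset.sum_add_distrib]
  map_smul' c x := by
    simp only [PiLp.smul_apply, smul_eq_mul, Finset.mul_sum, RingHom.id_apply]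
    exact Finset.sum_congr rfl fun i _ => by ring

theorem lastCoord_apply (hn : 3 ≤ n) (x : Mink n) : lastCoord n x = x ⟨n - 1, by omega⟩ := by
  change ∑ i : Fin n, (if (i : ℕ) + 1 = n then (1 : ℝ) else 0) * x i = _
  rw [Finset.sum_eq_single ⟨n - 1, by omega⟩]
  · rw [if_pos (by simp; omega), one_mul]
  · intro j _ hj
    rw [if_neg, zero_mul]
    intro h
    exact hj (Fin.ext (by simp; omega))
  · simp

theorem minkForm_eq_inner (hn : 3 ≤ n) (x y : Mink n) :
    minkForm n x y = inner ℝ x y - 2 * (lastCoord n x * lastCoord n y) := by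
  have h : ∀ i : Fin n, (if (i : ℕ) + 1 = n then (-1 : ℝ) else 1) * x i * y i =
      x i * y i - 2 * ((if (i : ℕ) + 1 = n then (1 : ℝ) else 0) * x i * y i) := fun i => by
    split_ifs <;> ring
  rw [minkForm_apply, PiLp.inner_apply]
  simp_rw [h]
  rw [Finset.sum_sub_distrib, ← Finset.mul_sum, lastCoord_apply hn, lastCoord_apply hn]
  congr 1
  · exact Finset.sum_congr rfl fun i _ => by simp [mul_comm]
  · congr 1
    rw [Finset.sum_eq_single ⟨n - 1, by omega⟩]
    · rw [if_pos (by simp; omega), one_mul]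
    · intro j _ hj
      rw [if_neg, zero_mul, zero_mul]
      intro h
      exact hj (Fin.ext (by simp; omega))
    · simp

/-- The two negative coordinates `(xⁿ, xⁿ⁺¹)`. -/
noncomputable def negPart (n : ℕ) : PolyVec n →ₗ[ℝ] ℝ × ℝ where
  toFun X := (lastCoord n X.2.1, X.2.2)
  map_add' X Y := by simp
  map_smul' c X := by simp

theorem negPart_apply (X : PolyVec n) : negPart n X = (lastCoord n X.2.1, X.2.2) := rfl

/-- The form differs from a Euclidean scalar product only through the two negative coordinates, so
positivity arguments become Euclidean once these are controlled. -/
theorem polyForm_eq_inner (hn : 3 ≤ n) (X Y : PolyVec n) :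
    polyForm n X Y = X.1 * Y.1 + inner ℝ X.2.1 Y.2.1 + X.2.2 * Y.2.2 -
      2 * ((negPart n X).1 * (negPart n Y).1 + (negPart n X).2 * (negPart n Y).2) := by
  rw [polyForm_apply, minkForm_eq_inner hn, negPart_apply, negPart_apply]
  ring

theorem polyForm_self_nonneg (hn : 3 ≤ n) {X : PolyVec n} (hX : negPart n X = 0) :
    0 ≤ polyForm n X X := by
  rw [polyForm_eq_inner hn, hX, real_inner_self_eq_norm_sq]
  simp only [Prod.fst_zero, Prod.snd_zero]
  nlinarith [sq_nonneg X.1, sq_nonneg X.2.2, sq_nonneg ‖X.2.1‖]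

theorem eq_zero_of_polyForm_self (hn : 3 ≤ n) {X : PolyVec n} (hX : negPart n X = 0)
    (h : polyForm n X X = 0) : X = 0 := by
  rw [polyForm_eq_inner hn, hX, real_inner_self_eq_norm_sq] at h
  simp only [Prod.fst_zero, Prod.snd_zero] at h
  have h1 : X.1 = 0 := by nlinarith [sq_nonneg X.1, sq_nonneg X.2.2, sq_nonneg ‖X.2.1‖]
  have h2 : X.2.2 = 0 := by nlinarith [sq_nonneg X.1, sq_nonneg X.2.2, sq_nonneg ‖X.2.1‖]
  have h3 : ‖X.2.1‖ = 0 := by nlinarith [sq_nonneg X.1, sq_nonneg X.2.2, sq_nonneg ‖X.2.1‖]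
  exact Prod.ext h1 (Prod.ext (norm_eq_zero.1 h3) h2)

/-- The reflection that changes the sign of the negative coordinates. -/
noncomputable def negReflect (hn : 3 ≤ n) : PolyVec n →ₗ[ℝ] PolyVec n :=
  LinearMap.id.prodMap ((LinearMap.id - (2 : ℝ) • (lastCoord n).smulRight
    (EuclideanSpace.single (⟨n - 1, by omega⟩ : Fin n) (1 : ℝ))).prodMap (-LinearMap.id))

theorem negReflect_apply (hn : 3 ≤ n) (X : PolyVec n) :
    negReflect hn X = (X.1, X.2.1 -
      (2 : ℝ) • lastCoord n X.2.1 • EuclideanSpace.single ⟨n - 1, by omega⟩ (1 : ℝ), -X.2.2) := rfl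

theorem lastCoord_single (hn : 3 ≤ n) :
    lastCoord n (EuclideanSpace.single ⟨n - 1, by omega⟩ (1 : ℝ)) = 1 := by
  rw [lastCoord_apply hn]
  simp

/-- Reflecting one argument cancels both minus signs and leaves a Euclidean scalar product. The
reflected vector thus pairs nontrivially with any nonzero vector, and reflections of an isotropic
plane serve as its dual plane in the construction of frames. -/
theorem polyForm_negReflect (hn : 3 ≤ n) (X Y : PolyVec n) :
    polyForm n (negReflect hn X) Y = X.1 * Y.1 + inner ℝ X.2.1 Y.2.1 + X.2.2 * Y.2.2 := by
  have h : ∀ y : Mink n, inner ℝ (EuclideanSpace.single (⟨n - 1, by omega⟩ : Fin n) (1 : ℝ)) y =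
      lastCoord n y := fun y => by
    rw [lastCoord_apply hn, EuclideanSpace.inner_single_left]
    simp
  rw [polyForm_apply, minkForm_eq_inner hn]
  simp only [negReflect_apply, inner_sub_left, inner_smul_left, h,
    map_sub, map_smul, lastCoord_single hn, smul_eq_mul, RCLike.conj_to_real]
  ring

theorem polyForm_negReflect_negReflect (hn : 3 ≤ n) (X Y : PolyVec n) :
    polyForm n (negReflect hn X) (negReflect hn Y) = polyForm n X Y := by
  have h : ∀ y : Mink n, inner ℝ y (EuclideanSpace.single (⟨n - 1, by omega⟩ : Fin n) (1 : ℝ)) =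
      lastCoord n y := fun y => by
    rw [lastCoord_apply hn, EuclideanSpace.inner_single_right]
    simp
  rw [polyForm_negReflect, polyForm_eq_inner hn]
  simp only [negReflect_apply, inner_sub_right, inner_smul_right, h,
    negPart_apply]
  ring

theorem exists_polyForm_ne_zero (hn : 3 ≤ n) {X : PolyVec n} (hX : X ≠ 0) :
    polyForm n (negReflect hn X) X ≠ 0 := by
  rw [polyForm_negReflect, real_inner_self_eq_norm_sq]
  intro h
  have h1 : X.1 = 0 := by nlinarith [sq_nonneg X.1, sq_nonneg X.2.2, sq_nonneg ‖X.2.1‖]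
  have h2 : X.2.2 = 0 := by nlinarith [sq_nonneg X.1, sq_nonneg X.2.2, sq_nonneg ‖X.2.1‖]
  have h3 : ‖X.2.1‖ = 0 := by nlinarith [sq_nonneg X.1, sq_nonneg X.2.2, sq_nonneg ‖X.2.1‖]
  exact hX (Prod.ext h1 (Prod.ext (norm_eq_zero.1 h3) h2))

theorem polyForm_nondegenerate (hn : 3 ≤ n) : (polyForm n).Nondegenerate := by
  refine (LinearMap.IsRefl.nondegenerate_iff_separatingLeft polyForm_isRefl).2 ?_
  intro X hX
  by_contra h
  exact exists_polyForm_ne_zero hn h (by rw [polyForm_comm]; exact hX _)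

theorem finrank_polyVec : Module.finrank ℝ (PolyVec n) = n + 2 := by
  simp [PolyVec, Mink]
  ring

/-- The orthogonal complement with respect to the polyspherical form. -/
noncomputable def perp (W : Submodule ℝ (PolyVec n)) : Submodule ℝ (PolyVec n) :=
  (polyForm n).orthogonal W

theorem mem_perp {W : Submodule ℝ (PolyVec n)} {X : PolyVec n} :
    X ∈ perp W ↔ ∀ Y ∈ W, polyForm n X Y = 0 := by
  constructor
  · intro h Y hY
    rw [polyForm_comm]
    exact h Y hY
  · intro h Y hY
    change polyForm n Y X = 0
    rw [polyForm_comm]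
    exact h Y hY

theorem perp_perp (hn : 3 ≤ n) (W : Submodule ℝ (PolyVec n)) : perp (perp W) = W :=
  LinearMap.BilinForm.orthogonal_orthogonal (polyForm_nondegenerate hn) polyForm_isRefl W

theorem finrank_perp (hn : 3 ≤ n) (W : Submodule ℝ (PolyVec n)) :
    Module.finrank ℝ (perp W) = n + 2 - Module.finrank ℝ W := by
  unfold perp
  rw [LinearMap.BilinForm.finrank_orthogonal (polyForm_nondegenerate hn), finrank_polyVec]

/-- A two-dimensional totally isotropic subspace, i.e. a straight line of the quadric. -/
structure IsIsotropicPlane (ℓ : Submodule ℝ (PolyVec n)) : Prop where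
  finrank_eq : Module.finrank ℝ ℓ = 2
  isotropic : ∀ X ∈ ℓ, ∀ Y ∈ ℓ, polyForm n X Y = 0

theorem IsIsotropicPlane.eq_zero_of_negPart (hn : 3 ≤ n) {ℓ : Submodule ℝ (PolyVec n)}
    (hℓ : IsIsotropicPlane ℓ) {X : PolyVec n} (hX : X ∈ ℓ) (h : negPart n X = 0) : X = 0 :=
  eq_zero_of_polyForm_self hn h (hℓ.isotropic X hX X hX)

/-- Injectivity of the negative coordinates on `ℓ` becomes bijectivity because source and target
both have dimension 2. The negative coordinates are thus canonical linear coordinates on every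
isotropic plane, comparable between different planes. -/
theorem IsIsotropicPlane.exists_negPart_eq (hn : 3 ≤ n) {ℓ : Submodule ℝ (PolyVec n)}
    (hℓ : IsIsotropicPlane ℓ) (c : ℝ × ℝ) : ∃ X ∈ ℓ, negPart n X = c := by
  have hinj : Function.Injective ((negPart n).domRestrict ℓ) := by
    rw [injective_iff_map_eq_zero]
    rintro ⟨X, hX⟩ h
    exact Subtype.ext (hℓ.eq_zero_of_negPart hn hX h)
  have hsurj := (LinearMap.injective_iff_surjective_of_finrank_eq_finrank
    (by rw [hℓ.finrank_eq]; simp)).1 hinj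
  obtain ⟨X, hX⟩ := hsurj c
  exact ⟨X, X.2, hX⟩

theorem IsIsotropicPlane.eq_of_negPart_eq (hn : 3 ≤ n) {ℓ : Submodule ℝ (PolyVec n)}
    (hℓ : IsIsotropicPlane ℓ) {X Y : PolyVec n} (hX : X ∈ ℓ) (hY : Y ∈ ℓ)
    (h : negPart n X = negPart n Y) : X = Y :=
  sub_eq_zero.1 (hℓ.eq_zero_of_negPart hn (ℓ.sub_mem hX hY) (by rw [map_sub, h, sub_self]))

theorem IsIsotropicPlane.le_perp {ℓ : Submodule ℝ (PolyVec n)}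
    (hℓ : IsIsotropicPlane ℓ) : ℓ ≤ perp ℓ := fun X hX => mem_perp.2 (hℓ.isotropic X hX)

/-- Choose `Y` in `ℓ` with the negative coordinates of `X`. Since `Y` is isotropic and orthogonal to
`X`, the vector `X - Y` has the same square as `X`, and that square is Euclidean. -/
theorem IsIsotropicPlane.polyForm_nonneg (hn : 3 ≤ n) {ℓ : Submodule ℝ (PolyVec n)}
    (hℓ : IsIsotropicPlane ℓ) {X : PolyVec n} (hX : X ∈ perp ℓ) : 0 ≤ polyForm n X X := by
  obtain ⟨Y, hY, h⟩ := hℓ.exists_negPart_eq hn (negPart n X)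
  have h1 := polyForm_self_nonneg hn (X := X - Y) (by rw [map_sub, h, sub_self])
  have h2 := mem_perp.1 hX Y hY
  have h3 := hℓ.isotropic Y hY Y hY
  simp only [map_sub, LinearMap.sub_apply, h2, h3, polyForm_comm Y X] at h1
  linarith

/-- With the same `Y` as for nonnegativity, a null `X` gives `X - Y` Euclidean square zero, hence `X
= Y`. -/
theorem IsIsotropicPlane.mem_of_polyForm_self (hn : 3 ≤ n) {ℓ : Submodule ℝ (PolyVec n)}
    (hℓ : IsIsotropicPlane ℓ) {X : PolyVec n} (hX : X ∈ perp ℓ) (h0 : polyForm n X X = 0) :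
    X ∈ ℓ := by
  obtain ⟨Y, hY, h⟩ := hℓ.exists_negPart_eq hn (negPart n X)
  have h2 := mem_perp.1 hX Y hY
  have h3 := hℓ.isotropic Y hY Y hY
  have h1 := eq_zero_of_polyForm_self hn (X := X - Y) (by rw [map_sub, h, sub_self]) (by
    simp only [map_sub, LinearMap.sub_apply, h0, h2, h3, polyForm_comm Y X]
    simp)
  rwa [sub_eq_zero.1 h1]

theorem IsIsotropicPlane.finrank_perp (hn : 3 ≤ n) {ℓ : Submodule ℝ (PolyVec n)}
    (hℓ : IsIsotropicPlane ℓ) : Module.finrank ℝ (perp ℓ) = n := by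
  rw [LightlikeDarboux.finrank_perp hn, hℓ.finrank_eq]
  omega

theorem finrank_span_pair {V : Type*} [AddCommGroup V] [Module ℝ V] {a b : V}
    (h : LinearIndependent ℝ ![a, b]) : Module.finrank ℝ (Submodule.span ℝ {a, b}) = 2 := by
  have := finrank_span_eq_card h
  rwa [Matrix.range_cons_cons_empty, Fintype.card_fin] at this

theorem isIsotropicPlane_span {a b : PolyVec n} (h : LinearIndependent ℝ ![a, b])
    (haa : polyForm n a a = 0) (hab : polyForm n a b = 0) (hbb : polyForm n b b = 0) :
    IsIsotropicPlane (Submodule.span ℝ {a, b}) := by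
  refine ⟨finrank_span_pair h, fun X hX Y hY => ?_⟩
  obtain ⟨p, q, rfl⟩ := Submodule.mem_span_pair.1 hX
  obtain ⟨r, s, rfl⟩ := Submodule.mem_span_pair.1 hY
  simp [haa, hab, hbb, polyForm_comm b a]

theorem IsIsotropicPlane.eq_of_le {ℓ ℓ' : Submodule ℝ (PolyVec n)} (hℓ : IsIsotropicPlane ℓ)
    (hℓ' : Module.finrank ℝ ℓ' = 2) (h : ℓ' ≤ ℓ) : ℓ' = ℓ :=
  Submodule.eq_of_le_of_finrank_eq h (by rw [hℓ', hℓ.finrank_eq])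

/-- An isotropic line contained in the orthogonal complement of another one coincides with it. -/
theorem IsIsotropicPlane.eq_of_le_perp (hn : 3 ≤ n) {ℓ ℓ' : Submodule ℝ (PolyVec n)}
    (hℓ : IsIsotropicPlane ℓ) (hℓ' : IsIsotropicPlane ℓ') (h : ℓ' ≤ perp ℓ) : ℓ' = ℓ :=
  hℓ.eq_of_le hℓ'.finrank_eq fun X hX =>
    hℓ.mem_of_polyForm_self hn (h hX) (hℓ'.isotropic X hX X hX)

theorem IsIsotropicPlane.eq_span {ℓ : Submodule ℝ (PolyVec n)} (hℓ : IsIsotropicPlane ℓ)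
    {a b : PolyVec n} (h : LinearIndependent ℝ ![a, b]) (ha : a ∈ ℓ) (hb : b ∈ ℓ) :
    ℓ = Submodule.span ℝ {a, b} :=
  (hℓ.eq_of_le (finrank_span_pair h) (Submodule.span_le.2 (by
    rintro x (rfl | rfl) <;> assumption))).symm

end LinearAlgebra

end LightlikeDarboux

namespace LightlikeDarboux

open ConformalSpace

/-! ## The Darboux mapping in the charts -/

section Charts

variable {n : ℕ}

/-- The homogeneous coordinate that does not vanish on the domain of a chart. -/
noncomputable def chartWeight : Option (Mink n) → PolyVec n →ₗ[ℝ] ℝ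
  | none => LinearMap.fst ℝ ℝ (Mink n × ℝ) +
      LinearMap.snd ℝ (Mink n) ℝ ∘ₗ LinearMap.snd ℝ ℝ (Mink n × ℝ)
  | some a => LinearMap.snd ℝ (Mink n) ℝ ∘ₗ LinearMap.snd ℝ ℝ (Mink n × ℝ) -
      LinearMap.fst ℝ ℝ (Mink n × ℝ) -
      (2 : ℝ) • (minkForm n a ∘ₗ LinearMap.fst ℝ (Mink n) ℝ ∘ₗ LinearMap.snd ℝ ℝ (Mink n × ℝ)) +
      minkForm n a a • (LinearMap.fst ℝ ℝ (Mink n × ℝ) +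
        LinearMap.snd ℝ (Mink n) ℝ ∘ₗ LinearMap.snd ℝ ℝ (Mink n × ℝ))

/-- The vectorial homogeneous coordinate of a chart. -/
noncomputable def chartVec : Option (Mink n) → PolyVec n →ₗ[ℝ] Mink n
  | none => LinearMap.fst ℝ (Mink n) ℝ ∘ₗ LinearMap.snd ℝ ℝ (Mink n × ℝ)
  | some a => LinearMap.fst ℝ (Mink n) ℝ ∘ₗ LinearMap.snd ℝ ℝ (Mink n × ℝ) -
      (LinearMap.fst ℝ ℝ (Mink n × ℝ) +
        LinearMap.snd ℝ (Mink n) ℝ ∘ₗ LinearMap.snd ℝ ℝ (Mink n × ℝ)).smulRight a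

/-- The homogeneous coordinate dual to `chartWeight`. -/
noncomputable def chartCoweight : Option (Mink n) → PolyVec n →ₗ[ℝ] ℝ
  | none => LinearMap.snd ℝ (Mink n) ℝ ∘ₗ LinearMap.snd ℝ ℝ (Mink n × ℝ) -
      LinearMap.fst ℝ ℝ (Mink n × ℝ)
  | some _ => LinearMap.fst ℝ ℝ (Mink n × ℝ) +
      LinearMap.snd ℝ (Mink n) ℝ ∘ₗ LinearMap.snd ℝ ℝ (Mink n × ℝ)

theorem chartWeight_none (X : PolyVec n) : chartWeight none X = X.1 + X.2.2 := rfl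

theorem chartWeight_some (a : Mink n) (X : PolyVec n) : chartWeight (some a) X =
    X.2.2 - X.1 - 2 * minkForm n a X.2.1 + minkForm n a a * (X.1 + X.2.2) := rfl

theorem chartVec_none (X : PolyVec n) : chartVec none X = X.2.1 := rfl

theorem chartVec_some (a : Mink n) (X : PolyVec n) :
    chartVec (some a) X = X.2.1 - (X.1 + X.2.2) • a := rfl

theorem chartCoweight_none (X : PolyVec n) : chartCoweight none X = X.2.2 - X.1 := rfl

theorem chartCoweight_some (a : Mink n) (X : PolyVec n) :
    chartCoweight (some a) X = X.1 + X.2.2 := rfl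

/-- The coordinates (weight, vector, coweight) put the form into the same shape for the affine chart
and for all inversions, so that later computations need no case distinction between charts. -/
theorem polyForm_eq_chart (c : Option (Mink n)) (X Y : PolyVec n) :
    polyForm n X Y = minkForm n (chartVec c X) (chartVec c Y) -
      (chartWeight c X * chartCoweight c Y + chartCoweight c X * chartWeight c Y) / 2 := by
  cases c with
  | none =>
    simp only [polyForm_apply, chartWeight_none, chartVec_none, chartCoweight_none]
    ring
  | some a =>
    simp only [polyForm_apply, chartWeight_some, chartVec_some, chartCoweight_some, map_sub,
      map_smul, LinearMap.sub_apply, LinearMap.smul_apply, smul_eq_mul, minkForm_comm X.2.1 a]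
    ring

theorem ext_chart (c : Option (Mink n)) {X Y : PolyVec n} (hw : chartWeight c X = chartWeight c Y)
    (hv : chartVec c X = chartVec c Y) (hc : chartCoweight c X = chartCoweight c Y) : X = Y := by
  cases c with
  | none =>
    simp only [chartWeight_none, chartVec_none, chartCoweight_none] at hw hv hc
    exact Prod.ext (by linarith) (Prod.ext hv (by linarith))
  | some a =>
    simp only [chartWeight_some, chartVec_some, chartCoweight_some] at hw hv hc
    rw [hc, sub_left_inj] at hv
    rw [hv, hc] at hw
    exact Prod.ext (by linarith) (Prod.ext hv (by linarith))

/-- Homogeneous coordinates of the point with coordinates `y` in a chart. -/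
noncomputable def chartLift : Option (Mink n) → Mink n → PolyVec n
  | none, y => ((1 - minkForm n y y) / 2, y, (1 + minkForm n y y) / 2)
  | some a, y => ((minkForm n y y - (1 + 2 * minkForm n a y + minkForm n y y * minkForm n a a)) / 2,
      y + minkForm n y y • a,
      (minkForm n y y + (1 + 2 * minkForm n a y + minkForm n y y * minkForm n a a)) / 2)

theorem chartWeight_lift (c : Option (Mink n)) (y : Mink n) :
    chartWeight c (chartLift c y) = 1 := by
  cases c with
  | none => simp only [chartWeight_none, chartLift]; ring
  | some a =>
    simp only [chartWeight_some, chartLift, map_add, map_smul, smul_eq_mul]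
    ring

theorem chartVec_lift (c : Option (Mink n)) (y : Mink n) : chartVec c (chartLift c y) = y := by
  cases c with
  | none => rfl
  | some a =>
    simp only [chartVec_some, chartLift]
    rw [← add_div, sub_add_add_cancel, add_self_div_two, add_sub_cancel_right]

theorem chartCoweight_lift (c : Option (Mink n)) (y : Mink n) :
    chartCoweight c (chartLift c y) = minkForm n y y := by
  cases c with
  | none => simp only [chartCoweight_none, chartLift]; ring
  | some a => simp only [chartCoweight_some, chartLift]; ring

theorem chartLift_ne_zero (c : Option (Mink n)) (y : Mink n) : chartLift c y ≠ 0 := fun h => by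
  have := chartWeight_lift c y
  rw [h, map_zero] at this
  exact zero_ne_one this

theorem polyForm_chartLift (c : Option (Mink n)) (y : Mink n) :
    polyForm n (chartLift c y) (chartLift c y) = 0 := by
  rw [polyForm_eq_chart c, chartWeight_lift, chartVec_lift, chartCoweight_lift]
  ring

theorem contDiff_chartLift (c : Option (Mink n)) : ContDiff ℝ ∞ (chartLift c) := by
  have hg : ContDiff ℝ ∞ fun y : Mink n => minkForm n y y :=
    contDiff_minkForm contDiff_id contDiff_id
  cases c with
  | none =>
    have : ContDiff ℝ ∞ fun y : Mink n =>
        ((1 - minkForm n y y) / 2, y, (1 + minkForm n y y) / 2) := by fun_prop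
    exact this
  | some a =>
    have ha : ContDiff ℝ ∞ fun y : Mink n => minkForm n a y :=
      contDiff_minkForm contDiff_const contDiff_id
    have : ContDiff ℝ ∞ fun y : Mink n =>
        ((minkForm n y y - (1 + 2 * minkForm n a y + minkForm n y y * minkForm n a a)) / 2,
      y + minkForm n y y • a,
      (minkForm n y y + (1 + 2 * minkForm n a y + minkForm n y y * minkForm n a a)) / 2) := by
      fun_prop
    exact this

theorem chartWeight_fderiv_lift (c : Option (Mink n)) (y η : Mink n) :
    chartWeight c (fderiv ℝ (chartLift c) y η) = 0 := by
  have h := ((chartWeight c).toContinuousLinearMap.hasFDerivAt.comp y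
    ((contDiff_chartLift c).differentiable (by simp) y).hasFDerivAt)
  have h2 : HasFDerivAt ((chartWeight c).toContinuousLinearMap ∘ chartLift c)
      (0 : Mink n →L[ℝ] ℝ) y := by
    have : ⇑(chartWeight c).toContinuousLinearMap ∘ chartLift c = fun _ => (1 : ℝ) :=
      funext fun z => chartWeight_lift c z
    rw [this]
    exact hasFDerivAt_const _ _
  exact congrArg (fun A : Mink n →L[ℝ] ℝ => A η) (h.unique h2)

theorem chartVec_fderiv_lift (c : Option (Mink n)) (y η : Mink n) :
    chartVec c (fderiv ℝ (chartLift c) y η) = η := by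
  have h := ((chartVec c).toContinuousLinearMap.hasFDerivAt.comp y
    ((contDiff_chartLift c).differentiable (by simp) y).hasFDerivAt)
  have h2 : HasFDerivAt ((chartVec c).toContinuousLinearMap ∘ chartLift c)
      (ContinuousLinearMap.id ℝ (Mink n)) y := by
    have : ⇑(chartVec c).toContinuousLinearMap ∘ chartLift c = id :=
      funext fun z => chartVec_lift c z
    rw [this]
    exact hasFDerivAt_id _
  exact congrArg (fun A : Mink n →L[ℝ] Mink n => A η) (h.unique h2)

/-- In the charts the Darboux mapping has isometric lifts. -/
theorem polyForm_fderiv_lift (c : Option (Mink n)) (y η ζ : Mink n) :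
    polyForm n (fderiv ℝ (chartLift c) y η) (fderiv ℝ (chartLift c) y ζ) = minkForm n η ζ := by
  rw [polyForm_eq_chart c, chartWeight_fderiv_lift, chartWeight_fderiv_lift, chartVec_fderiv_lift,
    chartVec_fderiv_lift]
  ring

/-- For an isotropic vector the coweight is determined by the weight and the vector part. After
division by the weight all three coordinates therefore agree with those of a lift. -/
theorem chartLift_inv_smul {c : Option (Mink n)} {X : PolyVec n} (hX : polyForm n X X = 0)
    (hw : chartWeight c X ≠ 0) :
    chartLift c ((chartWeight c X)⁻¹ • chartVec c X) = (chartWeight c X)⁻¹ • X := by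
  apply ext_chart c
  · rw [chartWeight_lift, map_smul, smul_eq_mul, inv_mul_cancel₀ hw]
  · rw [chartVec_lift, map_smul]
  · rw [chartCoweight_lift]
    rw [polyForm_eq_chart c] at hX
    simp only [map_smul, LinearMap.smul_apply, smul_eq_mul]
    have : minkForm n (chartVec c X) (chartVec c X) = chartWeight c X * chartCoweight c X := by
      linarith
    rw [this]
    field_simp

theorem darboux_point (x : Mink n) :
    darboux (point x) = Projectivization.mk ℝ (chartLift none x) (chartLift_ne_zero none x) := rfl

theorem ideal_lift_ne {v : Mink n} {t : ℝ} (h : (v, t) ≠ 0) : ((-t, v, t) : PolyVec n) ≠ 0 := by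
  intro h'
  exact h (Prod.ext (congrArg (fun X : PolyVec n => X.2.1) h')
    (congrArg (fun X : PolyVec n => X.2.2) h'))

theorem darboux_idealAt (v : Mink n) (t : ℝ) (hv : minkForm n v v = 0) (h : (v, t) ≠ 0) :
    darboux (idealAt v t hv h) = Projectivization.mk ℝ ((-t, v, t) : PolyVec n)
      (ideal_lift_ne h) := by
  obtain ⟨c, hc⟩ := Projectivization.exists_smul_eq_mk_rep ℝ (v, t) h
  simp only [darboux, idealAt]
  rw [Projectivization.mk_eq_mk_iff']
  refine ⟨c, ?_⟩
  rw [← hc]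
  simp [Units.smul_def]

theorem exists_eq_idealAt (q : ConeAtInfinity n) :
    ∃ (v : Mink n) (t : ℝ) (hv : minkForm n v v = 0) (h : (v, t) ≠ 0),
      ideal q = idealAt v t hv h :=
  ⟨q.pt.rep.1, q.pt.rep.2, q.isotropic, q.pt.rep_nonzero,
    (ideal_eq_idealAt q _ _ _ _ 1 (one_smul _ _)).symm⟩

theorem darboux_chart_symm (c : Option (Mink n)) (y : Mink n) :
    darboux ((chartOf c).symm y) =
      Projectivization.mk ℝ (chartLift c y) (chartLift_ne_zero c y) := by
  cases c with
  | none => rfl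
  | some a =>
    change darboux (inversionSymm a y) = _
    by_cases h : minkForm n y y = 0
    · rw [inversionSymm_of_eq h, darboux_idealAt]
      congr 1
      simp only [chartLift, h]
      refine Prod.ext ?_ (Prod.ext ?_ ?_)
      · simp only; ring
      · simp
      · simp only; ring
    · rw [inversionSymm_of_ne h, darboux_point, Projectivization.mk_eq_mk_iff']
      refine ⟨(minkForm n y y)⁻¹, ?_⟩
      apply ext_chart none
      · rw [chartWeight_lift, map_smul, chartWeight_none]
        simp only [chartLift, smul_eq_mul]
        field_simp
        ring
      · rw [chartVec_lift, map_smul, chartVec_none]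
        simp only [chartLift, smul_add, smul_smul]
        rw [inv_mul_cancel₀ h, one_smul, add_comm]
      · rw [chartCoweight_lift, map_smul, chartCoweight_none]
        simp only [chartLift, map_add, map_smul, LinearMap.add_apply, LinearMap.smul_apply,
          smul_eq_mul, minkForm_comm y a]
        field_simp
        ring

/-- Up to the scale of `X`, the weight of the inversion at `a` is `g(x - a, x - a)` at a finite
point and `2 (t - g(a, v))` at `[v : t]`: exactly the denominators of the inversion. Each chart
domain is thus cut out of the quadric by removing a hyperplane section. -/
theorem chartWeight_ne_zero_iff (c : Option (Mink n)) (p : ConformalSpace n) {X : PolyVec n}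
    (hX : X ≠ 0) (hp : X ∈ (darboux p).submodule) :
    chartWeight c X ≠ 0 ↔ p ∈ (chartOf c).source := by
  cases p with
  | point x =>
    rw [darboux_point, Projectivization.submodule_mk, Submodule.mem_span_singleton] at hp
    obtain ⟨r, rfl⟩ := hp
    have hr : r ≠ 0 := fun h => hX (by rw [h, zero_smul])
    rw [map_smul, smul_eq_mul, mul_ne_zero_iff]
    cases c with
    | none =>
      rw [chartWeight_lift]
      exact ⟨fun _ => ⟨x, rfl⟩, fun _ => ⟨hr, one_ne_zero⟩⟩
    | some a =>
      have : chartWeight (some a) (chartLift none x) = minkForm n (x - a) (x - a) := by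
        simp only [chartWeight_some, chartLift, map_sub, LinearMap.sub_apply, minkForm_comm x a]
        ring
      rw [this]
      exact ⟨fun h => h.2, fun h => ⟨hr, h⟩⟩
  | ideal q =>
    have hd : darboux (ideal q) = Projectivization.mk ℝ
      ((-q.pt.rep.2, q.pt.rep.1, q.pt.rep.2) : PolyVec n) (ideal_lift_ne q.pt.rep_nonzero) := rfl
    rw [hd, Projectivization.submodule_mk, Submodule.mem_span_singleton] at hp
    obtain ⟨r, rfl⟩ := hp
    have hr : r ≠ 0 := fun h => hX (by rw [h, zero_smul])
    rw [map_smul, smul_eq_mul, mul_ne_zero_iff]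
    cases c with
    | none =>
      rw [chartWeight_none]
      constructor
      · intro h
        simp at h
      · rintro ⟨x, hx⟩
        cases hx
    | some a =>
      have : chartWeight (some a) ((-q.pt.rep.2, q.pt.rep.1, q.pt.rep.2) : PolyVec n) =
          2 * (q.pt.rep.2 - minkForm n a q.pt.rep.1) := by
        simp only [chartWeight_some]
        ring
      rw [this]
      change _ ↔ q.pt.rep.2 ≠ minkForm n a q.pt.rep.1
      rw [← sub_ne_zero (a := q.pt.rep.2)]
      simp [hr]

theorem submodule_darboux {c : Option (Mink n)} {p : ConformalSpace n}
    (hp : p ∈ (chartOf c).source) :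
    (darboux p).submodule = Submodule.span ℝ {chartLift c (chartOf c p)} := by
  conv_lhs => rw [← (chartOf c).left_inv hp]
  rw [darboux_chart_symm, Projectivization.submodule_mk]

theorem exists_chartWeight_ne_zero {X : PolyVec n} (hX : X ≠ 0) : ∃ c, chartWeight c X ≠ 0 := by
  by_contra! h
  have h0 := h none
  rw [chartWeight_none] at h0
  have h1 : ∀ a, X.2.2 - X.1 - 2 * minkForm n a X.2.1 = 0 := fun a => by
    have := h (some a)
    rwa [chartWeight_some, h0, mul_zero, add_zero] at this
  have h2 := h1 0
  simp only [map_zero, LinearMap.zero_apply, mul_zero, sub_zero] at h2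
  have h3 : X.2.1 = 0 := by
    by_contra hv
    obtain ⟨a, ha⟩ := exists_minkForm_ne_zero hv
    exact ha (by linarith [h1 a])
  exact hX (Prod.ext (by simp; linarith) (Prod.ext h3 (by simp; linarith)))

theorem submodule_darboux_chart_symm {c : Option (Mink n)} {X : PolyVec n}
    (hX : polyForm n X X = 0) (hw : chartWeight c X ≠ 0) :
    (darboux ((chartOf c).symm ((chartWeight c X)⁻¹ • chartVec c X))).submodule =
      Submodule.span ℝ {X} := by
  rw [darboux_chart_symm, Projectivization.submodule_mk, chartLift_inv_smul hX hw]
  exact Submodule.span_singleton_smul_eq (IsUnit.mk0 _ (inv_ne_zero hw)) X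

/-- The image point alone decides membership in a chart domain, so both points lie in the chart of
`p`. The lifts in that chart both have weight one, hence are equal and not only proportional, and
the vector coordinate recovers the point. -/
theorem darboux_injective : Function.Injective (darboux (n := n)) := by
  intro p p' h
  have hp := mem_chartIndex_source p
  set c := chartIndex p
  have hX := chartLift_ne_zero c (chartOf c p)
  have hmem : chartLift c (chartOf c p) ∈ (darboux p).submodule := by
    rw [submodule_darboux hp]
    exact Submodule.mem_span_singleton_self _
  have hp' : p' ∈ (chartOf c).source :=
    (chartWeight_ne_zero_iff c p' hX (h ▸ hmem)).1 (by rw [chartWeight_lift]; exact one_ne_zero)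
  rw [h, submodule_darboux hp', Submodule.mem_span_singleton] at hmem
  obtain ⟨r, hr⟩ := hmem
  have h1 := congrArg (chartWeight c) hr
  rw [map_smul, chartWeight_lift, chartWeight_lift, smul_eq_mul, mul_one] at h1
  rw [h1, one_smul] at hr
  have h2 := congrArg (chartVec c) hr
  rw [chartVec_lift, chartVec_lift] at h2
  exact ((chartOf c).injOn hp' hp h2).symm

theorem exists_darboux_submodule_eq {X : PolyVec n} (h0 : X ≠ 0) (hX : polyForm n X X = 0) :
    ∃ p : ConformalSpace n, (darboux p).submodule = Submodule.span ℝ {X} := by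
  obtain ⟨c, hc⟩ := exists_chartWeight_ne_zero h0
  exact ⟨_, submodule_darboux_chart_symm hX hc⟩

theorem polyForm_of_mem_darboux (p : ConformalSpace n) {X Y : PolyVec n}
    (hX : X ∈ (darboux p).submodule) (hY : Y ∈ (darboux p).submodule) : polyForm n X Y = 0 := by
  rw [submodule_darboux (mem_chartIndex_source p), Submodule.mem_span_singleton] at hX hY
  obtain ⟨r, rfl⟩ := hX
  obtain ⟨s, rfl⟩ := hY
  simp [polyForm_chartLift]

theorem rep_mem_submodule (P : ProjSpace n) : P.rep ∈ P.submodule := by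
  rw [Projectivization.submodule_eq]
  exact Submodule.mem_span_singleton_self _

theorem darboux_mem_quadric (p : ConformalSpace n) : darboux p ∈ darbouxQuadric n :=
  polyForm_of_mem_darboux p (rep_mem_submodule _) (rep_mem_submodule _)

/-! ### Isotropic lines -/

/-- The points of `C^n_1` represented in a subspace. -/
def darbouxPreimage (ℓ : Submodule ℝ (PolyVec n)) : Set (ConformalSpace n) :=
  {p | (darboux p).submodule ≤ ℓ}

/-- Only surjectivity onto the quadric is at stake: each nonzero isotropic vector has nonzero weight
in some chart, and its chart coordinates define a preimage. -/
theorem image_darbouxPreimage {ℓ : Submodule ℝ (PolyVec n)} (hℓ : ∀ X ∈ ℓ, polyForm n X X = 0) :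
    darboux '' darbouxPreimage ℓ = {P | P.submodule ≤ ℓ} := by
  ext P
  constructor
  · rintro ⟨p, hp, rfl⟩
    exact hp
  · intro hP
    obtain ⟨p, hp⟩ := exists_darboux_submodule_eq P.rep_nonzero (hℓ _ (hP (rep_mem_submodule P)))
    rw [← Projectivization.submodule_eq] at hp
    have := Projectivization.submodule_injective hp
    refine ⟨p, ?_, this⟩
    change (darboux p).submodule ≤ ℓ
    rwa [this]

theorem point_mem_darbouxPreimage {ℓ : Submodule ℝ (PolyVec n)} {x : Mink n} :
    point x ∈ darbouxPreimage ℓ ↔ chartLift none x ∈ ℓ := by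
  change (darboux (point x)).submodule ≤ ℓ ↔ _
  rw [darboux_point, Projectivization.submodule_mk, Submodule.span_singleton_le_iff_mem]

theorem idealAt_mem_darbouxPreimage {ℓ : Submodule ℝ (PolyVec n)} {v : Mink n} {t : ℝ}
    {hv : minkForm n v v = 0} {h : (v, t) ≠ 0} :
    idealAt v t hv h ∈ darbouxPreimage ℓ ↔ ((-t, v, t) : PolyVec n) ∈ ℓ := by
  change (darboux (idealAt v t hv h)).submodule ≤ ℓ ↔ _
  rw [darboux_idealAt, Projectivization.submodule_mk, Submodule.span_singleton_le_iff_mem]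

theorem idealAt_congr {v v' : Mink n} {t t' : ℝ} {hv : minkForm n v v = 0} {h : (v, t) ≠ 0}
    {hv' : minkForm n v' v' = 0} {h' : (v', t') ≠ 0} {c : ℝ} (hc : c • (v', t') = (v, t)) :
    idealAt v t hv h = idealAt v' t' hv' h' := by
  apply darboux_injective
  rw [darboux_idealAt, darboux_idealAt, Projectivization.mk_eq_mk_iff']
  refine ⟨c, ?_⟩
  have h1 : c • v' = v := congrArg Prod.fst hc
  have h2 : c * t' = t := congrArg Prod.snd hc
  rw [← h1, ← h2]
  simp

/-- Because `v` is isotropic the quadratic term in `s` disappears. This is why isotropic lines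
become straight lines, with the ideal point as the direction vector. -/
theorem chartLift_add_smul (x v : Mink n) (hg : minkForm n v v = 0) (s : ℝ) :
    chartLift none (x + s • v) =
      chartLift none x + s • ((-minkForm n v x, v, minkForm n v x) : PolyVec n) := by
  apply ext_chart none
  · rw [chartWeight_lift, map_add, chartWeight_lift, map_smul, chartWeight_none]
    simp
  · rw [chartVec_lift, map_add, chartVec_lift, map_smul, chartVec_none]
  · rw [map_add (chartCoweight none), chartCoweight_lift, chartCoweight_lift, map_smul,
      chartCoweight_none]
    simp only [map_add, map_smul, LinearMap.add_apply, LinearMap.smul_apply, smul_eq_mul, hg,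
      minkForm_comm x v]
    ring

theorem darbouxPreimage_finite_line (x v : Mink n) (hv : v ≠ 0) (hg : minkForm n v v = 0) :
    darbouxPreimage (Submodule.span ℝ
      {chartLift none x, ((-minkForm n v x, v, minkForm n v x) : PolyVec n)}) =
      Set.range (fun s : ℝ => point (x + s • v)) ∪
      {idealAt v (minkForm n v x) hg (fun h => hv (congrArg Prod.fst h))} := by
  ext p
  constructor
  · intro hp
    cases p with
    | point y =>
      rw [point_mem_darbouxPreimage, Submodule.mem_span_pair] at hp
      obtain ⟨α, β, h⟩ := hp
      have h1 := congrArg (chartWeight none) h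
      have h2 := congrArg (chartVec none) h
      rw [map_add, map_smul, map_smul, chartWeight_lift, chartWeight_lift, chartWeight_none] at h1
      simp only [smul_eq_mul, mul_one, neg_add_cancel, mul_zero, add_zero] at h1
      rw [map_add, map_smul, map_smul, chartVec_lift, chartVec_lift, chartVec_none, h1,
        one_smul] at h2
      exact Or.inl ⟨β, by rw [← h2]⟩
    | ideal q =>
      obtain ⟨v', t', hv', h', hq⟩ := exists_eq_idealAt q
      rw [hq, idealAt_mem_darbouxPreimage, Submodule.mem_span_pair] at hp
      obtain ⟨α, β, h⟩ := hp
      have h1 := congrArg (chartWeight none) h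
      rw [map_add, map_smul, map_smul, chartWeight_lift, chartWeight_none, chartWeight_none] at h1
      simp only [smul_eq_mul, mul_one, neg_add_cancel, mul_zero, add_zero] at h1
      rw [h1, zero_smul, zero_add] at h
      refine Or.inr ?_
      rw [hq]
      refine idealAt_congr (c := β) ?_
      exact Prod.ext (congrArg (fun X : PolyVec n => X.2.1) h)
        (congrArg (fun X : PolyVec n => X.2.2) h)
  · rintro (⟨s, rfl⟩ | rfl)
    · rw [point_mem_darbouxPreimage, chartLift_add_smul x v hg]
      exact Submodule.mem_span_pair.2 ⟨1, s, by rw [one_smul]⟩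
    · rw [idealAt_mem_darbouxPreimage]
      exact Submodule.subset_span (Or.inr rfl)

theorem darbouxPreimage_ideal_line (v : Mink n) :
    darbouxPreimage (Submodule.span ℝ {((0, v, 0) : PolyVec n), ((-1, 0, 1) : PolyVec n)}) =
      {p | ∃ (s t : ℝ) (hg : minkForm n (s • v) (s • v) = 0) (h : (s • v, t) ≠ 0),
      p = idealAt (s • v) t hg h} := by
  ext p
  constructor
  · intro hp
    cases p with
    | point y =>
      rw [point_mem_darbouxPreimage, Submodule.mem_span_pair] at hp
      obtain ⟨α, β, h⟩ := hp
      have h1 := congrArg (chartWeight none) h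
      rw [map_add, map_smul, map_smul, chartWeight_lift, chartWeight_none, chartWeight_none] at h1
      simp at h1
    | ideal q =>
      obtain ⟨v', t', hv', h', hq⟩ := exists_eq_idealAt q
      rw [hq, idealAt_mem_darbouxPreimage, Submodule.mem_span_pair] at hp
      obtain ⟨α, β, h⟩ := hp
      have h1 : α • v = v' := by
        have := congrArg (fun X : PolyVec n => X.2.1) h
        simpa using this
      subst h1
      exact ⟨α, t', hv', h', hq⟩
  · rintro ⟨s, t, hg, h, rfl⟩
    rw [idealAt_mem_darbouxPreimage, Submodule.mem_span_pair]
    exact ⟨s, t, by simp⟩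

theorem exists_linearIndependent_pair {ℓ : Submodule ℝ (PolyVec n)}
    (hℓ : Module.finrank ℝ ℓ = 2) {X : PolyVec n} (hX : X ≠ 0) :
    ∃ Y ∈ ℓ, LinearIndependent ℝ ![X, Y] := by
  by_contra! h
  have : ℓ ≤ Submodule.span ℝ {X} := fun Y hY => by
    have := h Y hY
    rw [LinearIndependent.pair_iff' hX] at this
    push Not at this
    exact Submodule.mem_span_singleton.2 this
  have h1 := Submodule.finrank_mono this
  rw [hℓ, finrank_span_singleton hX] at h1
  omega

/-- The two types of isotropic lines correspond to whether or not the plane leaves the hyperplane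
`chartWeight none = 0`, which is the tangent hyperplane of the quadric at the image of the vertex of
the cone at infinity. -/
theorem IsIsotropicPlane.isIsotropicLine (hn : 3 ≤ n) {ℓ : Submodule ℝ (PolyVec n)}
    (hℓ : IsIsotropicPlane ℓ) : IsIsotropicLine (darbouxPreimage ℓ) := by
  by_cases hw : ∃ X ∈ ℓ, chartWeight none X ≠ 0
  · obtain ⟨X', hX', hw⟩ := hw
    have hX := chartLift_inv_smul (hℓ.isotropic _ hX' _ hX') hw
    set x := (chartWeight none X')⁻¹ • chartVec none X'
    have hXℓ : chartLift none x ∈ ℓ := hX ▸ ℓ.smul_mem _ hX'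
    obtain ⟨Y', hY', hind⟩ := exists_linearIndependent_pair hℓ.finrank_eq (chartLift_ne_zero none x)
    -- Removing the weight makes `Y` the ideal point of the line. Isotropy of `Y` says that its
    -- vector part is isotropic, and orthogonality to the lift of `x` fixes its remaining coordinate
    -- as `g(v, x)`.
    set Y := Y' - chartWeight none Y' • chartLift none x with hYdef
    have hYℓ : Y ∈ ℓ := ℓ.sub_mem hY' (ℓ.smul_mem _ hXℓ)
    have hYw : chartWeight none Y = 0 := by
      rw [hYdef, map_sub, map_smul, chartWeight_lift, smul_eq_mul, mul_one, sub_self]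
    have hind' : LinearIndependent ℝ ![chartLift none x, Y] := by
      rw [LinearIndependent.pair_iff' (chartLift_ne_zero none x)] at hind ⊢
      intro a ha
      apply hind (a + chartWeight none Y')
      rw [add_smul, ha, hYdef]
      abel
    have hYY := hℓ.isotropic Y hYℓ Y hYℓ
    rw [polyForm_eq_chart none, hYw, chartVec_none] at hYY
    have hg : minkForm n Y.2.1 Y.2.1 = 0 := by linarith
    have hXY := hℓ.isotropic Y hYℓ _ hXℓ
    rw [polyForm_eq_chart none, hYw, chartVec_none, chartVec_lift, chartWeight_lift,
      chartCoweight_none Y] at hXY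
    rw [chartWeight_none] at hYw
    have hYe : Y = (-minkForm n Y.2.1 x, Y.2.1, minkForm n Y.2.1 x) :=
      Prod.ext (by simp only; linarith) (Prod.ext rfl (by simp only; linarith))
    have hv : Y.2.1 ≠ 0 := by
      intro h
      rw [LinearIndependent.pair_iff' (chartLift_ne_zero none x)] at hind'
      refine hind' 0 ?_
      rw [hYe, h, zero_smul, map_zero, LinearMap.zero_apply, neg_zero]
      rfl
    left
    refine ⟨x, Y.2.1, hv, hg, ?_⟩
    rw [← darbouxPreimage_finite_line x Y.2.1 hv hg, ← hYe, ← hℓ.eq_span hind' hXℓ hYℓ]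
  · push Not at hw
    -- With all weights zero, isotropy forces the vector with negative coordinates `(0, 1)` to be
    -- the vertex `(-1, 0, 1)`. The one with `(1, 0)` then has the form `(0, v, 0)` with `v`
    -- isotropic, and gives the direction of the generator.
    obtain ⟨Y, hYℓ, hY⟩ := hℓ.exists_negPart_eq hn (0, 1)
    obtain ⟨Z, hZℓ, hZ⟩ := hℓ.exists_negPart_eq hn (1, 0)
    have hY1 := hw Y hYℓ
    have hZ1 := hw Z hZℓ
    rw [chartWeight_none] at hY1 hZ1
    rw [negPart_apply] at hY hZ
    have hY2 : Y.2.2 = 1 := congrArg Prod.snd hY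
    have hY3 : lastCoord n Y.2.1 = 0 := congrArg Prod.fst hY
    have hZ2 : Z.2.2 = 0 := congrArg Prod.snd hZ
    have hZ3 : lastCoord n Z.2.1 = 1 := congrArg Prod.fst hZ
    have hYY := hℓ.isotropic Y hYℓ Y hYℓ
    rw [polyForm_apply, minkForm_eq_inner hn, hY3, hY2, real_inner_self_eq_norm_sq] at hYY
    have hY4 : Y.2.1 = 0 := by
      have : Y.1 = -1 := by linarith
      rw [this] at hYY
      have : ‖Y.2.1‖ ^ 2 = 0 := by linarith
      exact norm_eq_zero.1 (pow_eq_zero_iff (two_ne_zero) |>.1 this)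
    have hYe : Y = (-1, 0, 1) := Prod.ext (by simp only; linarith) (Prod.ext hY4 hY2)
    have hZe : Z = (0, Z.2.1, 0) := Prod.ext (by simp only; linarith) (Prod.ext rfl hZ2)
    have hZv : Z.2.1 ≠ 0 := fun h => by
      rw [h, map_zero] at hZ3
      exact zero_ne_one hZ3
    have hZZ := hℓ.isotropic Z hZℓ Z hZℓ
    rw [hZe] at hZZ
    simp only [polyForm_apply, mul_zero, zero_add, sub_zero] at hZZ
    right
    refine ⟨Z.2.1, hZv, hZZ, ?_⟩
    rw [← darbouxPreimage_ideal_line, ← hYe, ← hZe]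
    congr 1
    refine hℓ.eq_span ?_ hZℓ hYℓ
    rw [LinearIndependent.pair_iff' (fun h => hZv (by rw [h]; rfl))]
    intro a ha
    have := congrArg (fun X : PolyVec n => X.2.2) ha
    simp only [Prod.smul_snd, hZ2, hY2] at this
    simp at this

theorem IsIsotropicLine.exists_plane {L : Set (ConformalSpace n)} (hL : IsIsotropicLine L) :
    ∃ ℓ : Submodule ℝ (PolyVec n), IsIsotropicPlane ℓ ∧ L = darbouxPreimage ℓ := by
  rcases hL with ⟨x, v, hv, hg, rfl⟩ | ⟨v, hv, hg, rfl⟩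
  · refine ⟨_, isIsotropicPlane_span ?_ (polyForm_chartLift none x) ?_ ?_,
      (darbouxPreimage_finite_line x v hv hg).symm⟩
    · rw [LinearIndependent.pair_iff' (chartLift_ne_zero none x)]
      intro a ha
      have h1 := congrArg (chartWeight none) ha
      rw [map_smul, chartWeight_lift, chartWeight_none] at h1
      simp only [smul_eq_mul, mul_one, neg_add_cancel] at h1
      rw [h1, zero_smul] at ha
      exact hv (congrArg (fun X : PolyVec n => X.2.1) ha).symm
    · rw [polyForm_eq_chart none, chartWeight_lift, chartVec_lift, chartCoweight_lift,
        chartWeight_none, chartVec_none, chartCoweight_none]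
      simp only [minkForm_comm x v]
      ring
    · rw [polyForm_apply]
      simp only [hg]
      ring
  · refine ⟨_, isIsotropicPlane_span ?_ ?_ ?_ ?_, (darbouxPreimage_ideal_line v).symm⟩
    · rw [LinearIndependent.pair_iff' (fun h => hv (congrArg (fun X : PolyVec n => X.2.1) h))]
      intro a ha
      have := congrArg (fun X : PolyVec n => X.2.2) ha
      simp at this
    · simp [polyForm_apply, hg]
    · simp [polyForm_apply]
    · simp [polyForm_apply]

end Charts

end LightlikeDarboux

namespace LightlikeDarboux

open ConformalSpace

/-! ## The Darboux mapping is an embedding -/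

section Embedding

variable {n : ℕ}

theorem coe_chartAt (p : ConformalSpace n) :
    (chartAt (Mink n) p : ConformalSpace n → Mink n) = chartOf (chartIndex p) := rfl

theorem chartAt_target (p : ConformalSpace n) : (chartAt (Mink n) p).target = Set.univ := by
  change (chartOf (chartIndex p)).target = _
  cases chartIndex p <;> rfl

theorem continuous_darboux : Continuous (darboux (n := n)) := by
  rw [continuous_iff_continuousAt]
  intro p
  set c := chartIndex p with hc
  have hq : Continuous fun y : Mink n =>
      (Projectivization.mk ℝ (chartLift c y) (chartLift_ne_zero c y) : ProjSpace n) := by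
    have h1 : Continuous fun y : Mink n =>
        (⟨chartLift c y, chartLift_ne_zero c y⟩ : {v : PolyVec n // v ≠ 0}) :=
      (contDiff_chartLift c).continuous.subtype_mk _
    exact continuous_quotient_mk'.comp h1
  have h2 : ContinuousAt (fun p' => (Projectivization.mk ℝ (chartLift c (chartAt (Mink n) p p'))
      (chartLift_ne_zero c _) : ProjSpace n)) p :=
    hq.continuousAt.comp ((chartAt (Mink n) p).continuousAt (mem_chart_source _ p))
  refine h2.congr ?_
  filter_upwards [(chartAt (Mink n) p).open_source.mem_nhds (mem_chart_source _ p)] with p' hp'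
  rw [← darboux_chart_symm, coe_chartAt, (chartOf c).left_inv hp']

/-- The chart coordinates of a point of the quadric. -/
noncomputable def projCoord (c : Option (Mink n)) (P : ProjSpace n) : Mink n :=
  (chartWeight c P.rep)⁻¹ • chartVec c P.rep

theorem projCoord_mk (c : Option (Mink n)) {X : PolyVec n} (hX : X ≠ 0) :
    projCoord c (Projectivization.mk ℝ X hX) = (chartWeight c X)⁻¹ • chartVec c X := by
  obtain ⟨a, ha⟩ := Projectivization.exists_smul_eq_mk_rep ℝ X hX
  have ha0 : (a : ℝ) ≠ 0 := a.ne_zero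
  rw [projCoord, ← ha, Units.smul_def, map_smul, map_smul, smul_smul, smul_eq_mul, mul_inv,
    mul_right_comm, inv_mul_cancel₀ ha0, one_mul]

theorem isQuotientMap_projMk :
    Topology.IsQuotientMap fun v : {v : PolyVec n // v ≠ 0} =>
      (Projectivization.mk ℝ v.1 v.2 : ProjSpace n) :=
  isQuotientMap_quotient_mk'

theorem isOpen_chartWeight_rep (c : Option (Mink n)) :
    IsOpen {P : ProjSpace n | chartWeight c P.rep ≠ 0} := by
  rw [← isQuotientMap_projMk.isOpen_preimage]
  have : (fun v : {v : PolyVec n // v ≠ 0} => (Projectivization.mk ℝ v.1 v.2 : ProjSpace n)) ⁻¹'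
      {P : ProjSpace n | chartWeight c P.rep ≠ 0} =
      {v : {v : PolyVec n // v ≠ 0} | chartWeight c v.1 ≠ 0} := by
    ext v
    obtain ⟨a, ha⟩ := Projectivization.exists_smul_eq_mk_rep ℝ v.1 v.2
    simp only [Set.mem_preimage, Set.mem_ofPred_eq]
    rw [← ha, Units.smul_def, map_smul]
    simp
  rw [this]
  exact isOpen_ne_fun ((chartWeight c).continuous_of_finiteDimensional.comp continuous_subtype_val)
    continuous_const

theorem continuousOn_projCoord (c : Option (Mink n)) :
    ContinuousOn (projCoord c) {P : ProjSpace n | chartWeight c P.rep ≠ 0} := by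
  rw [isQuotientMap_projMk.continuousOn_isOpen_iff (isOpen_chartWeight_rep c)]
  have : projCoord c ∘ (fun v : {v : PolyVec n // v ≠ 0} =>
      (Projectivization.mk ℝ v.1 v.2 : ProjSpace n)) =
      fun v => (chartWeight c v.1)⁻¹ • chartVec c v.1 := funext fun v => projCoord_mk c v.2
  rw [this]
  have h1 : Continuous fun v : {v : PolyVec n // v ≠ 0} => chartWeight c v.1 :=
    (chartWeight c).continuous_of_finiteDimensional.comp continuous_subtype_val
  have h2 : Continuous fun v : {v : PolyVec n // v ≠ 0} => chartVec c v.1 :=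
    (chartVec c).continuous_of_finiteDimensional.comp continuous_subtype_val
  refine (h1.continuousOn.inv₀ fun v hv => ?_).smul h2.continuousOn
  obtain ⟨a, ha⟩ := Projectivization.exists_smul_eq_mk_rep ℝ v.1 v.2
  simp only [Set.mem_preimage, Set.mem_ofPred_eq] at hv
  rw [← ha, Units.smul_def, map_smul] at hv
  exact fun h => hv (by rw [h, smul_zero])

theorem chartWeight_rep_darboux (c : Option (Mink n)) (p : ConformalSpace n) :
    chartWeight c (darboux p).rep ≠ 0 ↔ p ∈ (chartOf c).source :=
  chartWeight_ne_zero_iff c p (darboux p).rep_nonzero (rep_mem_submodule _)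

theorem projCoord_darboux {c : Option (Mink n)} {p : ConformalSpace n}
    (hp : p ∈ (chartOf c).source) : projCoord c (darboux p) = chartOf c p := by
  conv_lhs => rw [← (chartOf c).left_inv hp]
  rw [darboux_chart_symm, projCoord_mk, chartWeight_lift, chartVec_lift, inv_one, one_smul]

/-- On the open set of nonzero weight, `projCoord` is continuous and recovers the chart coordinates
from the image point. It therefore inverts the Darboux mapping continuously near each point of the
image. -/
theorem isEmbedding_darboux : Topology.IsEmbedding (darboux (n := n)) := by
  refine ⟨?_, darboux_injective⟩
  rw [Topology.isInducing_iff_nhds]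
  intro p
  apply le_antisymm
  · exact (continuous_darboux.tendsto p).le_comap
  · set c := chartIndex p
    have hp := mem_chartIndex_source p
    have hO : {P : ProjSpace n | chartWeight c P.rep ≠ 0} ∈ 𝓝 (darboux p) :=
      (isOpen_chartWeight_rep c).mem_nhds ((chartWeight_rep_darboux c p).2 hp)
    rw [(chartAt (Mink n) p).nhds_eq_comap_inf_principal (mem_chart_source _ p)]
    have hs : (chartAt (Mink n) p).source ∈ Filter.comap darboux (𝓝 (darboux p)) :=
      ⟨_, hO, fun p' hp' => (chartWeight_rep_darboux c p').1 hp'⟩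
    refine le_inf ?_ (Filter.le_principal_iff.2 hs)
    rw [← Filter.tendsto_iff_comap]
    have h1 : Filter.Tendsto (fun p' => projCoord c (darboux p'))
        (Filter.comap darboux (𝓝 (darboux p))) (𝓝 (projCoord c (darboux p))) :=
      Filter.Tendsto.comp (g := projCoord c) ((continuousOn_projCoord c).continuousAt hO)
        Filter.tendsto_comap
    rw [projCoord_darboux hp] at h1
    refine h1.congr' ?_
    filter_upwards [hs] with p' hp'
    exact projCoord_darboux hp'

end Embedding

end LightlikeDarboux

namespace LightlikeDarboux

open ConformalSpace Filter

/-! ## Lightlike lifts in local coordinates -/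

section Calculus

variable {n : ℕ}

/-- The coordinate space of an `(n-1)`-dimensional manifold. -/
abbrev Param (n : ℕ) : Type := EuclideanSpace ℝ (Fin (n - 1))

/-- The polyspherical form as a continuous bilinear map. -/
noncomputable def polyFormL (n : ℕ) : PolyVec n →L[ℝ] PolyVec n →L[ℝ] ℝ :=
  (polyForm n).toContinuousBilinearMap

theorem ContDiffAt.polyForm {E : Type*} [NormedAddCommGroup E] [NormedSpace ℝ E]
    {k : WithTop ℕ∞} {S T : E → PolyVec n} {x : E}
    (hS : ContDiffAt ℝ k S x) (hT : ContDiffAt ℝ k T x) :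
    ContDiffAt ℝ k (fun y => polyForm n (S y) (T y)) x :=
  ((polyFormL n).contDiff.contDiffAt.comp x hS).clm_apply hT

theorem hasFDerivAt_polyForm {E : Type*} [NormedAddCommGroup E] [NormedSpace ℝ E]
    {S T : E → PolyVec n} {x : E} (hS : DifferentiableAt ℝ S x) (hT : DifferentiableAt ℝ T x) :
    HasFDerivAt (fun y => polyForm n (S y) (T y))
      ((polyFormL n).precompR E (S x) (fderiv ℝ T x) +
        (polyFormL n).precompL E (fderiv ℝ S x) (T x)) x :=
  (polyFormL n).hasFDerivAt_of_bilinear hS.hasFDerivAt hT.hasFDerivAt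

theorem polyForm_fderiv_add {E : Type*} [NormedAddCommGroup E] [NormedSpace ℝ E]
    {S T : E → PolyVec n} {x : E} (hS : DifferentiableAt ℝ S x) (hT : DifferentiableAt ℝ T x)
    {k : ℝ} (h : ∀ᶠ y in 𝓝 x, polyForm n (S y) (T y) = k) (ξ : E) :
    polyForm n (fderiv ℝ S x ξ) (T x) + polyForm n (S x) (fderiv ℝ T x ξ) = 0 := by
  have h1 := hasFDerivAt_polyForm hS hT
  have h2 : HasFDerivAt (fun y => polyForm n (S y) (T y)) (0 : E →L[ℝ] ℝ) x :=
    (hasFDerivAt_const k x).congr_of_eventuallyEq h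
  have h3 := congrArg (fun A : E →L[ℝ] ℝ => A ξ) (h1.unique h2)
  change polyForm n (S x) (fderiv ℝ T x ξ) + polyForm n (fderiv ℝ S x ξ) (T x) = 0 at h3
  linarith

/-- The conditions at a point on homogeneous coordinates of a lightlike hypersurface. -/
structure IsLightlikeAt (G : Param n → PolyVec n) (x : Param n) : Prop where
  smooth : ContDiffAt ℝ ∞ G x
  ne_zero : G x ≠ 0
  isotropic : polyForm n (G x) (G x) = 0
  immersive : ∀ ξ (c : ℝ), fderiv ℝ G x ξ = c • G x → ξ = 0
  lightlike : ∃ ξ, ξ ≠ 0 ∧ ∀ η, polyForm n (fderiv ℝ G x ξ) (fderiv ℝ G x η) = 0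

/-- `G` gives homogeneous coordinates near `x₀` of the image of a lightlike hypersurface. -/
def IsLightlikeLift (G : Param n → PolyVec n) (x₀ : Param n) : Prop :=
  ∀ᶠ x in 𝓝 x₀, IsLightlikeAt G x

/-- The tangent subspace spanned by homogeneous coordinates and their differential. -/
noncomputable def osc (G : Param n → PolyVec n) (x : Param n) : Submodule ℝ (PolyVec n) :=
  Submodule.span ℝ {G x} ⊔ LinearMap.range (fderiv ℝ G x : Param n →ₗ[ℝ] PolyVec n)

theorem mem_osc {G : Param n → PolyVec n} {x : Param n} {X : PolyVec n} :
    X ∈ osc G x ↔ ∃ (c : ℝ) (ξ : Param n), X = c • G x + fderiv ℝ G x ξ := by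
  simp only [osc, Submodule.mem_sup, Submodule.mem_span_singleton, LinearMap.mem_range]
  constructor
  · rintro ⟨_, ⟨c, rfl⟩, _, ⟨ξ, rfl⟩, rfl⟩
    exact ⟨c, ξ, rfl⟩
  · rintro ⟨c, ξ, rfl⟩
    exact ⟨_, ⟨c, rfl⟩, _, ⟨ξ, rfl⟩, rfl⟩

theorem self_mem_osc (G : Param n → PolyVec n) (x : Param n) : G x ∈ osc G x :=
  mem_osc.2 ⟨1, 0, by simp⟩

theorem fderiv_mem_osc (G : Param n → PolyVec n) (x ξ : Param n) : fderiv ℝ G x ξ ∈ osc G x :=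
  mem_osc.2 ⟨0, ξ, by simp⟩

theorem mem_perp_osc {G : Param n → PolyVec n} {x : Param n} {X : PolyVec n} :
    X ∈ perp (osc G x) ↔ polyForm n X (G x) = 0 ∧ ∀ ξ, polyForm n X (fderiv ℝ G x ξ) = 0 := by
  rw [mem_perp]
  constructor
  · exact fun h => ⟨h _ (self_mem_osc G x), fun ξ => h _ (fderiv_mem_osc G x ξ)⟩
  · rintro ⟨h1, h2⟩ Y hY
    obtain ⟨c, ξ, rfl⟩ := mem_osc.1 hY
    rw [map_add, map_smul, h1, h2, smul_zero, add_zero]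

theorem IsLightlikeAt.differentiableAt {G : Param n → PolyVec n} {x : Param n}
    (h : IsLightlikeAt G x) : DifferentiableAt ℝ G x := h.smooth.differentiableAt (by simp)

/-- The immersion condition makes `(c, ξ) ↦ c G + dG(ξ)` injective on a space of dimension `1 + (n -
1)`. -/
theorem IsLightlikeAt.finrank_osc (hn : 3 ≤ n) {G : Param n → PolyVec n} {x : Param n}
    (h : IsLightlikeAt G x) : Module.finrank ℝ (osc G x) = n := by
  set A : ℝ × Param n →ₗ[ℝ] PolyVec n :=
    (LinearMap.toSpanSingleton ℝ (PolyVec n) (G x)).coprod (fderiv ℝ G x : Param n →ₗ[ℝ] PolyVec n)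
  have hA : ∀ c ξ, A (c, ξ) = c • G x + fderiv ℝ G x ξ := fun c ξ => by simp [A]
  have hr : osc G x = LinearMap.range A := by
    ext X
    rw [mem_osc]
    constructor
    · rintro ⟨c, ξ, rfl⟩
      exact ⟨(c, ξ), hA c ξ⟩
    · rintro ⟨⟨c, ξ⟩, rfl⟩
      exact ⟨c, ξ, hA c ξ⟩
  have hinj : Function.Injective A := by
    rw [injective_iff_map_eq_zero]
    rintro ⟨c, ξ⟩ h0
    rw [hA] at h0
    have hξ : ξ = 0 := h.immersive ξ (-c) (by rw [neg_smul, eq_neg_iff_add_eq_zero, add_comm, h0])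
    rw [hξ, map_zero, add_zero, smul_eq_zero] at h0
    rw [hξ, h0.resolve_right h.ne_zero]
    rfl
  rw [hr, LinearMap.finrank_range_of_inj hinj, Module.finrank_prod, Module.finrank_self,
    finrank_euclideanSpace_fin]
  omega

theorem IsLightlikeLift.self {G : Param n → PolyVec n} {x : Param n} (h : IsLightlikeLift G x) :
    IsLightlikeAt G x := Eventually.self_of_nhds h

theorem IsLightlikeLift.eventually {G : Param n → PolyVec n} {x : Param n}
    (h : IsLightlikeLift G x) : ∀ᶠ y in 𝓝 x, IsLightlikeLift G y := eventually_eventually_nhds.2 h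

theorem IsLightlikeLift.polyForm_fderiv {G : Param n → PolyVec n} {x : Param n}
    (h : IsLightlikeLift G x) (ξ : Param n) : polyForm n (G x) (fderiv ℝ G x ξ) = 0 := by
  have := polyForm_fderiv_add h.self.differentiableAt h.self.differentiableAt
    (h.mono fun y hy => hy.isotropic) ξ
  rw [polyForm_comm (fderiv ℝ G x ξ)] at this
  linarith

/-- The orthogonal complement of the tangent subspace is the isotropic line through `G x` in the
direction in which the form degenerates. -/
theorem IsLightlikeLift.perp_osc (hn : 3 ≤ n) {G : Param n → PolyVec n} {x : Param n}
    (h : IsLightlikeLift G x) : ∃ ξ, ξ ≠ 0 ∧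
      IsIsotropicPlane (perp (osc G x)) ∧
      LinearIndependent ℝ ![G x, fderiv ℝ G x ξ] ∧
      perp (osc G x) = Submodule.span ℝ {G x, fderiv ℝ G x ξ} := by
  obtain ⟨ξ, hξ, hlight⟩ := h.self.lightlike
  have hind : LinearIndependent ℝ ![G x, fderiv ℝ G x ξ] := by
    rw [LinearIndependent.pair_iff' h.self.ne_zero]
    exact fun a ha => hξ (h.self.immersive ξ a ha.symm)
  have hpl := isIsotropicPlane_span hind h.self.isotropic (h.polyForm_fderiv ξ) (hlight ξ)
  have hle : osc G x ≤ perp (Submodule.span ℝ {G x, fderiv ℝ G x ξ}) := by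
    intro X hX
    rw [mem_perp]
    intro Y hY
    obtain ⟨c, η, rfl⟩ := mem_osc.1 hX
    obtain ⟨a, b, rfl⟩ := Submodule.mem_span_pair.1 hY
    simp [h.self.isotropic, h.polyForm_fderiv, hlight, polyForm_comm _ (G x),
      polyForm_comm (fderiv ℝ G x η) (fderiv ℝ G x ξ)]
  have heq := Submodule.eq_of_le_of_finrank_eq hle
    (by rw [h.self.finrank_osc hn, hpl.finrank_perp hn])
  have heq' : perp (osc G x) = Submodule.span ℝ {G x, fderiv ℝ G x ξ} := by
    rw [heq, perp_perp hn]
  exact ⟨ξ, hξ, heq' ▸ hpl, hind, heq'⟩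

theorem IsLightlikeLift.isIsotropicPlane (hn : 3 ≤ n) {G : Param n → PolyVec n} {x : Param n}
    (h : IsLightlikeLift G x) : IsIsotropicPlane (perp (osc G x)) := (h.perp_osc hn).choose_spec.2.1

theorem IsLightlikeLift.self_mem_perp {G : Param n → PolyVec n} {x : Param n}
    (h : IsLightlikeLift G x) : G x ∈ perp (osc G x) :=
  mem_perp_osc.2 ⟨h.self.isotropic, h.polyForm_fderiv⟩

/-- An isotropic plane lies in its own orthogonal complement, which here is the tangent subspace. -/
theorem IsLightlikeLift.perp_le_osc (hn : 3 ≤ n) {G : Param n → PolyVec n} {x : Param n}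
    (h : IsLightlikeLift G x) : perp (osc G x) ≤ osc G x := by
  have := (h.isIsotropicPlane hn).le_perp
  rwa [perp_perp hn] at this

/-- The pairing of vectors with a tangent subspace, together with the negative coordinates. -/
noncomputable def pairing (Y : PolyVec n) (A : Param n →L[ℝ] PolyVec n) :
    PolyVec n →L[ℝ] ((Param n →L[ℝ] ℝ) × ℝ × (ℝ × ℝ)) :=
  (((ContinuousLinearMap.compL ℝ (Param n) (PolyVec n) ℝ).flip A).comp
      (polyFormL n)).prod ((polyFormL n Y).prod (negPart n).toContinuousLinearMap)

theorem pairing_apply (Y : PolyVec n) (A : Param n →L[ℝ] PolyVec n) (X : PolyVec n) :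
    pairing Y A X = ((polyFormL n X).comp A, polyForm n Y X, negPart n X) := rfl

theorem contDiffAt_pairing {k : WithTop ℕ∞} {Y : Param n → PolyVec n}
    {A : Param n → Param n →L[ℝ] PolyVec n} {x : Param n} (hY : ContDiffAt ℝ k Y x)
    (hA : ContDiffAt ℝ k A x) : ContDiffAt ℝ k (fun y => pairing (Y y) (A y)) x := by
  have h : ContDiff ℝ k (fun p : PolyVec n × (Param n →L[ℝ] PolyVec n) => pairing p.1 p.2) := by
    refine contDiff_clm_apply_iff.2 fun X => ?_
    have h1 : ContDiff ℝ k (fun p : PolyVec n × (Param n →L[ℝ] PolyVec n) =>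
        (polyFormL n X).comp p.2) := contDiff_const.clm_comp contDiff_snd
    have h2 : ContDiff ℝ k (fun p : PolyVec n × (Param n →L[ℝ] PolyVec n) =>
        polyFormL n p.1 X) := ((polyFormL n).contDiff.comp contDiff_fst).clm_apply contDiff_const
    exact h1.prodMk (h2.prodMk contDiff_const)
  exact h.contDiffAt.comp x (hY.prodMk hA)

theorem pairing_eq_iff {G : Param n → PolyVec n} {x : Param n} {X : PolyVec n} {c : ℝ × ℝ} :
    pairing (G x) (fderiv ℝ G x) X = (0, 0, c) ↔ X ∈ perp (osc G x) ∧ negPart n X = c := by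
  rw [pairing_apply, mem_perp_osc, polyForm_comm X (G x), Prod.mk.injEq, Prod.mk.injEq]
  constructor
  · rintro ⟨h1, h2, h3⟩
    exact ⟨⟨h2, fun ξ => congrArg (fun Z : Param n →L[ℝ] ℝ => Z ξ) h1⟩, h3⟩
  · rintro ⟨⟨h2, h1⟩, h3⟩
    exact ⟨ContinuousLinearMap.ext h1, h2, h3⟩

theorem finrank_pairing (hn : 3 ≤ n) : Module.finrank ℝ (PolyVec n) =
    Module.finrank ℝ ((Param n →L[ℝ] ℝ) × ℝ × (ℝ × ℝ)) := by
  have hd : Module.finrank ℝ (Param n →L[ℝ] ℝ) = n - 1 := by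
    rw [← LinearMap.toContinuousLinearMap.finrank_eq, Module.finrank_linearMap,
      finrank_euclideanSpace_fin, Module.finrank_self, mul_one]
  rw [finrank_polyVec, Module.finrank_prod, hd]
  simp only [Module.finrank_prod, Module.finrank_self]
  omega

theorem ContinuousLinearMap.isInvertible_of_injective {V W : Type*} [NormedAddCommGroup V]
    [NormedSpace ℝ V] [NormedAddCommGroup W] [NormedSpace ℝ W] [FiniteDimensional ℝ V]
    [FiniteDimensional ℝ W] (A : V →L[ℝ] W) (hA : Function.Injective A)
    (h : Module.finrank ℝ V = Module.finrank ℝ W) : A.IsInvertible :=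
  ⟨(LinearEquiv.ofInjectiveOfFinrankEq (A : V →ₗ[ℝ] W) hA h).toContinuousLinearEquiv, by
    ext; rfl⟩

/-- A kernel vector lies in the isotropic plane and has vanishing negative coordinates, so it is
zero. The dimensions agree because `n + 2 = (n - 1) + 1 + 2`. -/
theorem IsLightlikeLift.isInvertible_pairing (hn : 3 ≤ n) {G : Param n → PolyVec n} {x : Param n}
    (h : IsLightlikeLift G x) : (pairing (G x) (fderiv ℝ G x)).IsInvertible := by
  refine ContinuousLinearMap.isInvertible_of_injective _ ?_ (finrank_pairing hn)
  rw [injective_iff_map_eq_zero]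
  intro X hX
  obtain ⟨h1, h2⟩ := pairing_eq_iff.1 hX
  exact (h.isIsotropicPlane hn).eq_zero_of_negPart hn h1 h2

/-- Smooth sections of the family of isotropic lines with prescribed negative coordinates. -/
theorem IsLightlikeLift.exists_section (hn : 3 ≤ n) {G : Param n → PolyVec n} {x₀ : Param n}
    (h : IsLightlikeLift G x₀) (c : ℝ × ℝ) : ∃ N : Param n → PolyVec n, ∀ᶠ x in 𝓝 x₀,
      ContDiffAt ℝ ∞ N x ∧ N x ∈ perp (osc G x) ∧ negPart n (N x) = c := by
  -- The section is the solution of a square invertible linear system: zero products with `dG` and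
  -- `G`, and negative coordinates `c`. Smoothness follows from that of operator inversion.
  refine ⟨fun x => (pairing (G x) (fderiv ℝ G x)).inverse (0, 0, c), ?_⟩
  filter_upwards [h.eventually] with x hx
  have h1 := contDiffAt_pairing hx.self.smooth (hx.self.smooth.fderiv_right (m := ∞) (by simp))
  have h2 := hx.isInvertible_pairing hn
  have h3 : ContDiffAt ℝ ∞ ContinuousLinearMap.inverse (pairing (G x) (fderiv ℝ G x)) :=
    h2.contDiffAt_map_inverse
  exact ⟨(h3.comp x h1).clm_apply contDiffAt_const, pairing_eq_iff.1 (h2.self_apply_inverse _)⟩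

end Calculus

end LightlikeDarboux

namespace LightlikeDarboux

open ConformalSpace Filter

section Rulings

variable {n : ℕ}

/-! ### Sections of the family of isotropic lines -/

theorem IsLightlikeLift.exists_transversal_section (hn : 3 ≤ n) {G : Param n → PolyVec n}
    {x₀ : Param n} (h : IsLightlikeLift G x₀) : ∃ N : Param n → PolyVec n,
      (∀ᶠ x in 𝓝 x₀, ContDiffAt ℝ ∞ N x ∧ N x ∈ perp (osc G x)) ∧
      perp (osc G x₀) = Submodule.span ℝ {G x₀, N x₀} := by
  obtain ⟨ξ, -, hpl, -, hspan⟩ := h.perp_osc hn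
  obtain ⟨N, hN⟩ := h.exists_section hn (negPart n (fderiv ℝ G x₀ ξ))
  refine ⟨N, hN.mono fun x hx => ⟨hx.1, hx.2.1⟩, ?_⟩
  have : N x₀ = fderiv ℝ G x₀ ξ := hpl.eq_of_negPart_eq hn hN.self_of_nhds.2.1
    (hspan ▸ Submodule.subset_span (Or.inr rfl)) hN.self_of_nhds.2.2
  rw [this, hspan]

/-- It suffices that `dA` is orthogonal to `G` and to a transversal section `N`, since these span
the isotropic plane at `x₀`. Both follow by differentiating `⟨A, G⟩ = 0` and `⟨A, N⟩ = 0`; the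
unwanted terms vanish because `A` is orthogonal to `dG` and because `dN` is orthogonal to `G` and
`N`. -/
theorem IsLightlikeLift.fderiv_section_mem (hn : 3 ≤ n) {G : Param n → PolyVec n} {x₀ : Param n}
    (h : IsLightlikeLift G x₀) {A : Param n → PolyVec n} (hA : DifferentiableAt ℝ A x₀)
    (hmem : ∀ᶠ x in 𝓝 x₀, A x ∈ perp (osc G x)) (ξ : Param n) :
    fderiv ℝ A x₀ ξ ∈ osc G x₀ := by
  obtain ⟨N, hN, hspan⟩ := h.exists_transversal_section hn
  have hNd : DifferentiableAt ℝ N x₀ := hN.self_of_nhds.1.differentiableAt (by simp)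
  have hAG := polyForm_fderiv_add hA h.self.differentiableAt
    (hmem.mono fun x hx => (mem_perp_osc.1 hx).1) ξ
  have hNG := polyForm_fderiv_add hNd h.self.differentiableAt
    (hN.mono fun x hx => (mem_perp_osc.1 hx.2).1) ξ
  have hNN := polyForm_fderiv_add hNd hNd (k := 0) (by
    filter_upwards [hN, h.eventually] with x hx hx'
    exact (hx'.isIsotropicPlane hn).isotropic _ hx.2 _ hx.2) ξ
  have hAN := polyForm_fderiv_add hA hNd (k := 0) (by
    filter_upwards [hmem, hN, h.eventually] with x hx1 hx hx'
    exact (hx'.isIsotropicPlane hn).isotropic _ hx1 _ hx.2) ξ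
  rw [(mem_perp_osc.1 hmem.self_of_nhds).2, add_zero] at hAG
  rw [(mem_perp_osc.1 hN.self_of_nhds.2).2, add_zero] at hNG
  rw [polyForm_comm (N x₀), ← two_mul, mul_eq_zero, or_iff_right two_ne_zero] at hNN
  have hA0 := hmem.self_of_nhds
  rw [hspan, Submodule.mem_span_pair] at hA0
  obtain ⟨a, b, hab⟩ := hA0
  have hAN' : polyForm n (fderiv ℝ A x₀ ξ) (N x₀) = 0 := by
    rw [← hab, map_add, map_smul, map_smul, LinearMap.add_apply, LinearMap.smul_apply,
      LinearMap.smul_apply, polyForm_comm (G x₀), polyForm_comm (N x₀), hNN, hNG, smul_zero,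
      smul_zero, add_zero, add_zero] at hAN
    exact hAN
  rw [← perp_perp hn (osc G x₀), mem_perp, hspan]
  intro Y hY
  obtain ⟨p, q, rfl⟩ := Submodule.mem_span_pair.1 hY
  rw [map_add, map_smul, map_smul, hAG, hAN', smul_zero, smul_zero, add_zero]

/-- The second fundamental form of a section of the isotropic lines is symmetric. -/
theorem IsLightlikeLift.polyForm_fderiv_section_symm {G : Param n → PolyVec n} {x₀ : Param n}
    (h : IsLightlikeLift G x₀) {A : Param n → PolyVec n} (hA : DifferentiableAt ℝ A x₀)
    (hmem : ∀ᶠ x in 𝓝 x₀, A x ∈ perp (osc G x)) (ξ η : Param n) :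
    polyForm n (fderiv ℝ A x₀ ξ) (fderiv ℝ G x₀ η) =
      polyForm n (fderiv ℝ A x₀ η) (fderiv ℝ G x₀ ξ) := by
  have hd : DifferentiableAt ℝ (fderiv ℝ G) x₀ :=
    (h.self.smooth.fderiv_right (m := ∞) (by simp)).differentiableAt (by simp)
  -- Differentiating `⟨A, dG(η)⟩ = 0` along `ξ` expresses the bilinear form through the second
  -- derivative of `G`, which is symmetric.
  have key : ∀ ξ η, polyForm n (fderiv ℝ A x₀ ξ) (fderiv ℝ G x₀ η) +
      polyForm n (A x₀) (fderiv ℝ (fderiv ℝ G) x₀ ξ η) = 0 := fun ξ η => by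
    have hdη : HasFDerivAt (fun x => fderiv ℝ G x η)
        ((ContinuousLinearMap.apply ℝ (PolyVec n) η).comp (fderiv ℝ (fderiv ℝ G) x₀)) x₀ :=
      (ContinuousLinearMap.apply ℝ (PolyVec n) η).hasFDerivAt.comp x₀ hd.hasFDerivAt
    have := polyForm_fderiv_add hA hdη.differentiableAt
      (hmem.mono fun x hx => (mem_perp_osc.1 hx).2 η) ξ
    rw [hdη.fderiv] at this
    exact this
  have hsymm := h.self.smooth.isSymmSndFDerivAt
    (by rw [minSmoothness_of_isRCLikeNormedField]; exact WithTop.coe_le_coe.2 (le_top : (2 : ℕ∞) ≤ ⊤)) ξ η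
  have h1 := key ξ η
  have h2 := key η ξ
  rw [hsymm] at h1
  linarith

/-- In a direction where `G` moves inside its isotropic plane, every section of the moving plane
does so as well: symmetry moves `ξ` onto `G`, and `dA(η)` is orthogonal to the plane. This
infinitesimal statement is the reason the rulings are straight. -/
theorem IsLightlikeLift.fderiv_section_mem_perp (hn : 3 ≤ n) {G : Param n → PolyVec n}
    {x₀ : Param n} (h : IsLightlikeLift G x₀) {A : Param n → PolyVec n}
    (hA : DifferentiableAt ℝ A x₀) (hmem : ∀ᶠ x in 𝓝 x₀, A x ∈ perp (osc G x)) {ξ : Param n}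
    (hξ : fderiv ℝ G x₀ ξ ∈ perp (osc G x₀)) : fderiv ℝ A x₀ ξ ∈ perp (osc G x₀) := by
  rw [mem_perp_osc]
  refine ⟨?_, fun η => ?_⟩
  · rw [polyForm_comm]
    exact mem_perp.1 h.self_mem_perp _ (h.fderiv_section_mem hn hA hmem ξ)
  · rw [h.polyForm_fderiv_section_symm hA hmem, polyForm_comm]
    exact mem_perp.1 hξ _ (h.fderiv_section_mem hn hA hmem η)

/-! ### Change of homogeneous coordinates -/

theorem fderiv_smul_apply {E V : Type*} [NormedAddCommGroup E] [NormedSpace ℝ E]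
    [NormedAddCommGroup V] [NormedSpace ℝ V] {ρ : E → ℝ} {G : E → V} {x : E}
    (hρ : DifferentiableAt ℝ ρ x) (hG : DifferentiableAt ℝ G x) (ξ : E) :
    fderiv ℝ (fun y => ρ y • G y) x ξ = ρ x • fderiv ℝ G x ξ + fderiv ℝ ρ x ξ • G x := by
  rw [fderiv_fun_smul hρ hG]
  rfl

theorem osc_smul {G : Param n → PolyVec n} {x : Param n} {ρ : Param n → ℝ}
    (hG : DifferentiableAt ℝ G x) (hρ : DifferentiableAt ℝ ρ x) (h0 : ρ x ≠ 0) :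
    osc (fun y => ρ y • G y) x = osc G x := by
  ext X
  simp only [mem_osc, fderiv_smul_apply hρ hG]
  constructor
  · rintro ⟨c, ξ, rfl⟩
    refine ⟨c * ρ x + fderiv ℝ ρ x ξ, ρ x • ξ, ?_⟩
    rw [map_smul, add_smul, mul_smul]
    abel
  · rintro ⟨c, ξ, rfl⟩
    refine ⟨(ρ x)⁻¹ * (c - (ρ x)⁻¹ * fderiv ℝ ρ x ξ), (ρ x)⁻¹ • ξ, ?_⟩
    simp only [map_smul, smul_smul, mul_inv_cancel₀ h0, one_smul, smul_eq_mul]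
    rw [mul_right_comm, inv_mul_cancel₀ h0, one_mul, sub_smul]
    abel

/-- Since `d(ρG) = ρ dG + dρ G`, the degenerate direction survives as soon as `G` is orthogonal to
itself and to `dG`; the latter is the assumption `hd`. -/
theorem IsLightlikeAt.smul {G : Param n → PolyVec n} {x : Param n} (h : IsLightlikeAt G x)
    (hd : ∀ ξ, polyForm n (G x) (fderiv ℝ G x ξ) = 0) {ρ : Param n → ℝ}
    (hρ : ContDiffAt ℝ ∞ ρ x) (h0 : ρ x ≠ 0) : IsLightlikeAt (fun y => ρ y • G y) x := by
  have hρd : DifferentiableAt ℝ ρ x := hρ.differentiableAt (by simp)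
  have hGd := h.differentiableAt
  refine ⟨hρ.smul h.smooth, smul_ne_zero h0 h.ne_zero, ?_, ?_, ?_⟩
  · simp [h.isotropic]
  · intro ξ c hc
    rw [fderiv_smul_apply hρd hGd] at hc
    have : fderiv ℝ G x (ρ x • ξ) = (c * ρ x - fderiv ℝ ρ x ξ) • G x := by
      rw [map_smul, sub_smul, mul_smul, ← hc]
      abel
    exact (smul_eq_zero.1 (h.immersive _ _ this)).resolve_left h0
  · obtain ⟨ξ, hξ, hl⟩ := h.lightlike
    refine ⟨ξ, hξ, fun η => ?_⟩
    simp only [fderiv_smul_apply hρd hGd, map_add, map_smul, LinearMap.add_apply,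
      LinearMap.smul_apply, hl, hd, h.isotropic,
      polyForm_comm (fderiv ℝ G x ξ) (G x), smul_zero, add_zero]

theorem IsLightlikeLift.smul {G : Param n → PolyVec n} {x₀ : Param n} (h : IsLightlikeLift G x₀)
    {ρ : Param n → ℝ} (hρ : ∀ᶠ x in 𝓝 x₀, ContDiffAt ℝ ∞ ρ x ∧ ρ x ≠ 0) :
    IsLightlikeLift (fun x => ρ x • G x) x₀ := by
  filter_upwards [h.eventually, hρ] with x hx ⟨hρx, h0⟩
  exact hx.self.smul hx.polyForm_fderiv hρx h0

theorem IsLightlikeAt.congr {G G' : Param n → PolyVec n} {x : Param n} (h : IsLightlikeAt G x)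
    (he : G' =ᶠ[𝓝 x] G) : IsLightlikeAt G' x := by
  have h1 := he.fderiv_eq (𝕜 := ℝ)
  have h2 := he.self_of_nhds
  refine ⟨h.smooth.congr_of_eventuallyEq he, h2 ▸ h.ne_zero, ?_, ?_, ?_⟩
  · rw [h2]
    exact h.isotropic
  · rw [h1, h2]
    exact h.immersive
  · rw [h1]
    exact h.lightlike

theorem osc_congr {G G' : Param n → PolyVec n} {x : Param n} (he : G' =ᶠ[𝓝 x] G) :
    osc G' x = osc G x := by
  rw [osc, osc, he.fderiv_eq, he.self_of_nhds]

theorem IsLightlikeAt.of_comp {G : Param n → PolyVec n} {σ : Param n → Param n} {y : Param n}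
    (h : IsLightlikeAt (G ∘ σ) y) (hG : ContDiffAt ℝ ∞ G (σ y)) (hσ : DifferentiableAt ℝ σ y)
    (hinv : (fderiv ℝ σ y).IsInvertible) : IsLightlikeAt G (σ y) := by
  have hd : ∀ η, fderiv ℝ (G ∘ σ) y η = fderiv ℝ G (σ y) (fderiv ℝ σ y η) := fun η => by
    rw [fderiv_comp y (hG.differentiableAt (by simp)) hσ]
    rfl
  refine ⟨hG, h.ne_zero, h.isotropic, ?_, ?_⟩
  · intro ξ c hc
    obtain ⟨η, rfl⟩ := hinv.surjective ξ
    rw [h.immersive η c (by rw [hd, hc]; rfl), map_zero]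
  · obtain ⟨η, hη, hl⟩ := h.lightlike
    refine ⟨fderiv ℝ σ y η, fun h0 => hη (hinv.injective (by rw [h0, map_zero])), fun ζ => ?_⟩
    obtain ⟨ζ, rfl⟩ := hinv.surjective ζ
    rw [← hd, ← hd]
    exact hl ζ

theorem osc_comp {G : Param n → PolyVec n} {σ : Param n → Param n} {y : Param n}
    (hG : DifferentiableAt ℝ G (σ y)) (hσ : DifferentiableAt ℝ σ y)
    (hinv : (fderiv ℝ σ y).IsInvertible) : osc (G ∘ σ) y = osc G (σ y) := by
  ext X
  simp only [mem_osc, fderiv_comp y hG hσ]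
  constructor
  · rintro ⟨c, η, rfl⟩
    exact ⟨c, fderiv ℝ σ y η, rfl⟩
  · rintro ⟨c, ξ, rfl⟩
    obtain ⟨η, rfl⟩ := hinv.surjective ξ
    exact ⟨c, η, rfl⟩

/-- A smooth moving point of a smooth moving line through the origin is a smooth multiple of a
generator. -/
theorem exists_contDiffAt_smul_eq (hn : 3 ≤ n) {T G : Param n → PolyVec n} {x₀ : Param n}
    (hT : ContDiffAt ℝ ∞ T x₀) (hG : ContDiffAt ℝ ∞ G x₀) (h0 : G x₀ ≠ 0)
    (h : ∀ᶠ x in 𝓝 x₀, T x ∈ Submodule.span ℝ {G x}) :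
    ∃ ρ : Param n → ℝ, ContDiffAt ℝ ∞ ρ x₀ ∧ T =ᶠ[𝓝 x₀] fun x => ρ x • G x := by
  have hb := exists_polyForm_ne_zero hn h0
  set b := negReflect hn (G x₀)
  have hbG : ContDiffAt ℝ ∞ (fun x => polyForm n b (G x)) x₀ :=
    ContDiffAt.polyForm contDiffAt_const hG
  refine ⟨fun x => polyForm n b (T x) / polyForm n b (G x),
    (ContDiffAt.polyForm contDiffAt_const hT).div hbG hb, ?_⟩
  filter_upwards [h, hbG.continuousAt.eventually_ne hb] with x hx hx0
  obtain ⟨c, hc⟩ := Submodule.mem_span_singleton.1 hx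
  rw [← hc, map_smul, smul_eq_mul, mul_div_cancel_right₀ _ hx0]

/-! ### Integral curves -/

/-- The existence theorem for differential equations provides a differentiable solution. Full
smoothness is bootstrapped from `γ' = v ∘ γ`: a solution of class `C^m` has derivative of class
`C^m`. -/
theorem exists_smooth_integralCurve {E : Type*} [NormedAddCommGroup E] [NormedSpace ℝ E]
    [CompleteSpace E] {v : E → E} {x₀ : E} (hv : ∀ᶠ x in 𝓝 x₀, ContDiffAt ℝ ∞ v x) {U : Set E}
    (hU : U ∈ 𝓝 x₀) : ∃ (γ : ℝ → E) (ε : ℝ), 0 < ε ∧ γ 0 = x₀ ∧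
      ContDiffOn ℝ ∞ γ (Set.Ioo (-ε) ε) ∧
      ∀ t ∈ Set.Ioo (-ε) ε, γ t ∈ U ∧ HasDerivAt γ (v (γ t)) t := by
  obtain ⟨γ, h0, ε, hε, hγ⟩ :=
    (hv.self_of_nhds.of_le (by simp : (1 : WithTop ℕ∞) ≤ ∞)
      ).exists_forall_mem_closedBall_exists_eq_forall_mem_Ioo_hasDerivAt₀ 0
  rw [zero_sub, zero_add] at hγ
  have hc : ContinuousAt γ 0 := (hγ 0 ⟨by linarith, hε⟩).continuousAt
  have hev : ∀ᶠ t in 𝓝 (0 : ℝ), γ t ∈ U ∧ ContDiffAt ℝ ∞ v (γ t) := by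
    refine hc.eventually (p := fun x => x ∈ U ∧ ContDiffAt ℝ ∞ v x) ?_
    rw [h0]
    exact (eventually_mem_set.2 hU).and hv
  obtain ⟨δ, hδ, hball⟩ := Metric.eventually_nhds_iff.1 hev
  have hsub : ∀ t ∈ Set.Ioo (-min ε δ) (min ε δ), t ∈ Set.Ioo (-ε) ε ∧ dist t 0 < δ := by
    intro t ht
    have h1 := min_le_left ε δ
    have h2 := min_le_right ε δ
    refine ⟨⟨by linarith [ht.1], by linarith [ht.2]⟩, ?_⟩
    rw [Real.dist_0_eq_abs, abs_lt]
    exact ⟨by linarith [ht.1], by linarith [ht.2]⟩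
  have hd : ∀ t ∈ Set.Ioo (-min ε δ) (min ε δ), HasDerivAt γ (v (γ t)) t :=
    fun t ht => hγ t (hsub t ht).1
  refine ⟨γ, min ε δ, lt_min hε hδ, h0, ?_, fun t ht => ⟨(hball (hsub t ht).2).1, hd t ht⟩⟩
  rw [contDiffOn_infty]
  intro m
  induction m with
  | zero =>
    rw [Nat.cast_zero, contDiffOn_zero]
    exact fun t ht => (hd t ht).continuousAt.continuousWithinAt
  | succ m ih =>
    rw [Nat.cast_succ, contDiffOn_succ_iff_deriv_of_isOpen isOpen_Ioo]
    refine ⟨fun t ht => (hd t ht).differentiableAt.differentiableWithinAt, by simp, ?_⟩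
    have : ContDiffOn ℝ m (v ∘ γ) (Set.Ioo (-min ε δ) (min ε δ)) := fun t ht =>
      ((hball (hsub t ht).2).2.of_le (by exact_mod_cast le_top)).comp_contDiffWithinAt t (ih t ht)
    exact this.congr fun t ht => (hd t ht).deriv

theorem exists_continuousLinear_leftInverse {V W : Type*} [NormedAddCommGroup V]
    [NormedSpace ℝ V] [NormedAddCommGroup W] [NormedSpace ℝ W] [FiniteDimensional ℝ V]
    [FiniteDimensional ℝ W] (A : V →L[ℝ] W) (hA : Function.Injective A) :
    ∃ B : W →L[ℝ] V, ∀ v, B (A v) = v := by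
  obtain ⟨B, hB⟩ := LinearMap.exists_leftInverse_of_injective (A : V →ₗ[ℝ] W)
    (LinearMap.ker_eq_bot.2 hA)
  exact ⟨B.toContinuousLinearMap, fun v => LinearMap.congr_fun hB v⟩

/-- A smooth solution of a linear system whose operators are injective. -/
theorem exists_smooth_solution {E V W : Type*} [NormedAddCommGroup E] [NormedSpace ℝ E]
    [NormedAddCommGroup V] [NormedSpace ℝ V] [NormedAddCommGroup W] [NormedSpace ℝ W]
    [FiniteDimensional ℝ V] [FiniteDimensional ℝ W] {A : E → V →L[ℝ] W} {b : E → W} {x₀ : E}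
    (hA : ∀ᶠ x in 𝓝 x₀, ContDiffAt ℝ ∞ A x) (hb : ∀ᶠ x in 𝓝 x₀, ContDiffAt ℝ ∞ b x)
    (hinj : Function.Injective (A x₀)) (hsol : ∀ᶠ x in 𝓝 x₀, ∃ v, A x v = b x) :
    ∃ v : E → V, ∀ᶠ x in 𝓝 x₀, ContDiffAt ℝ ∞ v x ∧ A x (v x) = b x := by
  have : CompleteSpace V := FiniteDimensional.complete ℝ V
  -- The operators need not be square. Composing with a fixed left inverse of `A x₀` gives
  -- endomorphisms that are the identity at `x₀`, hence invertible nearby. As a solution exists by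
  -- assumption, it is recovered by inverting them.
  obtain ⟨B, hB⟩ := exists_continuousLinear_leftInverse (A x₀) hinj
  have hinv : ∀ᶠ x in 𝓝 x₀, (B.comp (A x)).IsInvertible := by
    have hcont : ContinuousAt (fun x => B.comp (A x)) x₀ :=
      continuousAt_const.clm_comp hA.self_of_nhds.continuousAt
    have h1 : B.comp (A x₀) = (ContinuousLinearEquiv.refl ℝ V : V →L[ℝ] V) :=
      ContinuousLinearMap.ext hB
    refine hcont.eventually (p := fun T : V →L[ℝ] V => T.IsInvertible) ?_
    change ∀ᶠ T in 𝓝 (B.comp (A x₀)), T.IsInvertible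
    rw [h1]
    exact ContinuousLinearEquiv.nhds (ContinuousLinearEquiv.refl ℝ V)
  refine ⟨fun x => (B.comp (A x)).inverse (B (b x)), ?_⟩
  filter_upwards [hA, hb, hsol, hinv] with x hAx hbx ⟨v, hv⟩ hinvx
  constructor
  · have h3 : ContDiffAt ℝ ∞ ContinuousLinearMap.inverse (B.comp (A x)) :=
      hinvx.contDiffAt_map_inverse
    exact (h3.comp x (contDiffAt_const.clm_comp hAx)).clm_apply
      (contDiffAt_const.clm_apply hbx)
  · rw [← hv]
    congr 1
    exact hinvx.inverse_apply_self v

/-- A left inverse of the differential turns `H` into a map to which the inverse function theorem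
applies. -/
theorem ContDiffAt.eventually_injOn {V W : Type*} [NormedAddCommGroup V]
    [NormedSpace ℝ V] [NormedAddCommGroup W] [NormedSpace ℝ W] [FiniteDimensional ℝ V]
    [FiniteDimensional ℝ W] {H : V → W} {x₀ : V} (hH : ContDiffAt ℝ ∞ H x₀)
    (hinj : Function.Injective (fderiv ℝ H x₀)) : ∃ U ∈ 𝓝 x₀, Set.InjOn H U := by
  have : CompleteSpace V := FiniteDimensional.complete ℝ V
  obtain ⟨B, hB⟩ := exists_continuousLinear_leftInverse _ hinj
  have h1 : HasStrictFDerivAt (B ∘ H) (B.comp (fderiv ℝ H x₀)) x₀ :=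
    B.hasStrictFDerivAt.comp x₀ (hH.hasStrictFDerivAt (by simp))
  have h2 : B.comp (fderiv ℝ H x₀) = (ContinuousLinearEquiv.refl ℝ V : V →L[ℝ] V) :=
    ContinuousLinearMap.ext hB
  rw [h2] at h1
  refine ⟨_, (h1.toOpenPartialHomeomorph _).open_source.mem_nhds
    h1.mem_toOpenPartialHomeomorph_source, fun x hx y hy hxy => ?_⟩
  refine (h1.toOpenPartialHomeomorph _).injOn hx hy ?_
  rw [h1.toOpenPartialHomeomorph_coe]
  exact congrArg B hxy

end Rulings

end LightlikeDarboux

namespace LightlikeDarboux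

open ConformalSpace Filter

/-! ### Integral curves in the isotropic direction and constancy of the tangent subspace along them
-/

section RulingCurve

variable {n : ℕ}

/-- The scalar product of the negative parts with a fixed pair. -/
noncomputable def negCoord (n : ℕ) (p : ℝ × ℝ) : PolyVec n →L[ℝ] ℝ :=
  LinearMap.toContinuousLinearMap
    ((p.1 • LinearMap.fst ℝ ℝ ℝ + p.2 • LinearMap.snd ℝ ℝ ℝ) ∘ₗ negPart n)

theorem sq_add_sq_pos {p : ℝ × ℝ} (hp : p ≠ 0) : 0 < p.1 ^ 2 + p.2 ^ 2 := by
  rcases eq_or_ne p.1 0 with h1 | h1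
  · have h2 : p.2 ≠ 0 := fun h2 => hp (Prod.ext h1 h2)
    positivity
  · positivity

/-- Homogeneous coordinates of a lightlike hypersurface that are affine along the rulings: `N` is
constant and `H` is affine along the integral curves of `ξ`. -/
theorem IsLightlikeLift.exists_normalForm (hn : 3 ≤ n) {G : Param n → PolyVec n} {x₀ : Param n}
    (h : IsLightlikeLift G x₀) : ∃ (H N : Param n → PolyVec n) (ξ : Param n → Param n)
      (τ : PolyVec n →L[ℝ] ℝ), IsLightlikeLift H x₀ ∧
      (∀ᶠ x in 𝓝 x₀, ContDiffAt ℝ ∞ N x ∧ ContDiffAt ℝ ∞ ξ x ∧ N x ∈ perp (osc H x) ∧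
        fderiv ℝ H x (ξ x) = N x ∧ fderiv ℝ N x (ξ x) = 0 ∧ osc H x = osc G x ∧
        Submodule.span ℝ {H x} = Submodule.span ℝ {G x} ∧
        (H x ∈ perp (osc H x₀) → H x = H x₀ + τ (H x) • N x₀)) ∧
      LinearIndependent ℝ ![H x₀, N x₀] ∧ τ (H x₀) = 0 := by
  have hpl := h.isIsotropicPlane hn
  set p := negPart n (G x₀) with hp
  have hp0 : p ≠ 0 := fun h0 => h.self.ne_zero (hpl.eq_zero_of_negPart hn h.self_mem_perp h0)
  set m := p.1 ^ 2 + p.2 ^ 2 with hm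
  have hmpos : 0 < m := sq_add_sq_pos hp0
  -- The pair `q` is `p` turned by a right angle, so `p, q` is an orthogonal basis of the negative
  -- coordinates; `β` and `τ` below are the coordinates with respect to it.
  set q : ℝ × ℝ := (-p.2, p.1) with hq
  set β : PolyVec n →L[ℝ] ℝ := m⁻¹ • negCoord n p with hβ
  set τ : PolyVec n →L[ℝ] ℝ := m⁻¹ • negCoord n q with hτ
  have hβa : ∀ X, β X = m⁻¹ * (p.1 * (negPart n X).1 + p.2 * (negPart n X).2) := fun X => rfl
  have hτa : ∀ X, τ X = m⁻¹ * (-p.2 * (negPart n X).1 + p.1 * (negPart n X).2) := fun X => rfl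
  have hneg : ∀ X, negPart n X = β X • p + τ X • q := by
    intro X
    refine Prod.ext ?_ ?_
    · simp only [hβa, hτa, hq, Prod.fst_add, Prod.smul_fst, smul_eq_mul]
      field_simp
      ring
    · simp only [hβa, hτa, hq, Prod.snd_add, Prod.smul_snd, smul_eq_mul]
      field_simp
      ring
  have hβG : β (G x₀) = 1 := by
    rw [hβa, ← hp]
    field_simp
    ring
  have hτG : τ (G x₀) = 0 := by
    rw [hτa, ← hp]
    ring
  -- Rescaling to `β(H) = 1` makes `β` vanish on `dH`. The section `N` chosen below has negative
  -- part `q`, so `β(N) = 0`.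
  set ρ : Param n → ℝ := fun x => (β (G x))⁻¹ with hρ
  have hρs : ∀ᶠ x in 𝓝 x₀, ContDiffAt ℝ ∞ ρ x ∧ ρ x ≠ 0 ∧ β (G x) ≠ 0 := by
    have hc : ContinuousAt (fun x => β (G x)) x₀ :=
      β.continuous.continuousAt.comp h.self.smooth.continuousAt
    filter_upwards [h, hc.eventually_ne (by rw [hβG]; exact one_ne_zero)] with x hx hx0
    exact ⟨(β.contDiff.contDiffAt.comp x hx.smooth).inv hx0, inv_ne_zero hx0, hx0⟩
  set H : Param n → PolyVec n := fun x => ρ x • G x with hHdef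
  have hH : IsLightlikeLift H x₀ := h.smul (hρs.mono fun x hx => ⟨hx.1, hx.2.1⟩)
  have hβH : ∀ᶠ x in 𝓝 x₀, β (H x) = 1 := hρs.mono fun x hx => by
    rw [hHdef, map_smul, smul_eq_mul]
    exact inv_mul_cancel₀ hx.2.2
  have hHx₀ : H x₀ = G x₀ := by
    simp only [hHdef, hρ, hβG, inv_one, one_smul]
  obtain ⟨N, hN⟩ := hH.exists_section hn q
  have hβN : ∀ X, negPart n X = q → β X = 0 := fun X hX => by
    rw [hβa, hX]
    simp only [hq]
    ring
  have hτN : ∀ X, negPart n X = q → τ X = 1 := fun X hX => by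
    rw [hτa, hX]
    simp only [hq]
    field_simp
    ring
  -- A priori `N = c H + dH(v)`, as the isotropic plane lies in the tangent subspace. Applying `β`
  -- gives `c = 0`.
  have hsol : ∀ᶠ x in 𝓝 x₀, ∃ v, fderiv ℝ H x v = N x := by
    filter_upwards [hN, hH.eventually, hβH.eventually_nhds] with x hNx hHx hβx
    obtain ⟨c, v, hcv⟩ := mem_osc.1 (hHx.perp_le_osc hn hNx.2.1)
    have hd : β (fderiv ℝ H x v) = 0 := by
      have h1 : HasFDerivAt (fun y => β (H y)) (β.comp (fderiv ℝ H x)) x :=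
        β.hasFDerivAt.comp x hHx.self.differentiableAt.hasFDerivAt
      have h2 : HasFDerivAt (fun y => β (H y)) (0 : Param n →L[ℝ] ℝ) x :=
        (hasFDerivAt_const (1 : ℝ) x).congr_of_eventuallyEq hβx
      exact congrArg (fun A : Param n →L[ℝ] ℝ => A v) (h1.unique h2)
    have hc : c = 0 := by
      have := congrArg β hcv
      rw [hβN _ hNx.2.2, map_add, map_smul, hd, hβx.self_of_nhds, smul_eq_mul, mul_one,
        add_zero] at this
      exact this.symm
    rw [hc, zero_smul, zero_add] at hcv
    exact ⟨v, hcv.symm⟩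
  have hinj : Function.Injective (fderiv ℝ H x₀) := by
    rw [injective_iff_map_eq_zero]
    exact fun v hv => hH.self.immersive v 0 (by rw [hv, zero_smul])
  obtain ⟨ξ, hξ⟩ := exists_smooth_solution
    (hH.mono fun x hx => hx.smooth.fderiv_right (m := ∞) (by simp)) (hN.mono fun x hx => hx.1)
    hinj hsol
  refine ⟨H, N, ξ, τ, hH, ?_, ?_, by rw [hHx₀, hτG]⟩
  · filter_upwards [hN.eventually_nhds, hξ, hH.eventually, h.eventually, hρs, hβH] with
      x hNx hξx hHx hGx hρx hβx
    have hNx' := hNx.self_of_nhds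
    have hNd : DifferentiableAt ℝ N x := hNx'.1.differentiableAt (by simp)
    refine ⟨hNx'.1, hξx.1, hNx'.2.1, hξx.2, ?_, ?_, ?_, ?_⟩
    -- Because `dH(ξ) = N` lies in the isotropic plane, so does `dN(ξ)`. Its negative coordinates
    -- vanish since those of `N` are constantly `q`; hence it is zero.
    · refine (hHx.isIsotropicPlane hn).eq_zero_of_negPart hn
        (hHx.fderiv_section_mem_perp hn hNd (hNx.mono fun y hy => hy.2.1)
          (by rw [hξx.2]; exact hNx'.2.1)) ?_
      have h1 : HasFDerivAt (fun y => negPart n (N y))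
          ((negPart n).toContinuousLinearMap.comp (fderiv ℝ N x)) x :=
        (negPart n).toContinuousLinearMap.hasFDerivAt.comp x hNd.hasFDerivAt
      have h2 : HasFDerivAt (fun y => negPart n (N y)) (0 : Param n →L[ℝ] ℝ × ℝ) x :=
        (hasFDerivAt_const q x).congr_of_eventuallyEq (hNx.mono fun y hy => hy.2.2)
      exact congrArg (fun A : Param n →L[ℝ] ℝ × ℝ => A (ξ x)) (h1.unique h2)
    · exact osc_smul hGx.self.differentiableAt (hρx.1.differentiableAt (by simp)) hρx.2.1
    · exact Submodule.span_singleton_smul_eq (IsUnit.mk0 _ hρx.2.1) _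
    · intro hmem
      -- Vectors of the plane at `x₀` are compared through negative coordinates: both sides have `p
      -- + τ(H x) q`.
      have hN0 := hN.self_of_nhds.2
      refine (hH.isIsotropicPlane hn).eq_of_negPart_eq hn hmem
        (Submodule.add_mem _ hH.self_mem_perp (Submodule.smul_mem _ _ hN0.1)) ?_
      rw [hneg (H x), hβx, one_smul, map_add, map_smul (negPart n) (τ (H x)) (N x₀), hN0.2, hHx₀,
        ← hp]
  · rw [LinearIndependent.pair_iff' hH.self.ne_zero]
    intro a ha
    have h1 := congrArg τ ha
    rw [map_smul, hHx₀, hτG, hτN _ hN.self_of_nhds.2.2, smul_zero] at h1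
    exact zero_ne_one h1

/-- Through every point there is a ruling, along which the tangent subspace is constant, and near
the point the hypersurface meets the line of the ruling only in the points of the ruling. -/
theorem IsLightlikeLift.exists_ruling (hn : 3 ≤ n) {G : Param n → PolyVec n} {x₀ : Param n}
    (h : IsLightlikeLift G x₀) {U : Set (Param n)} (hU : U ∈ 𝓝 x₀) :
    ∃ (a w : PolyVec n) (γ : ℝ → Param n) (ε : ℝ), LinearIndependent ℝ ![a, w] ∧
      perp (osc G x₀) = Submodule.span ℝ {a, w} ∧ 0 < ε ∧ γ 0 = x₀ ∧
      ContDiffOn ℝ ∞ γ (Set.Ioo (-ε) ε) ∧ deriv γ 0 ≠ 0 ∧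
      (∀ t ∈ Set.Ioo (-ε) ε, γ t ∈ U ∧ Submodule.span ℝ {G (γ t)} = Submodule.span ℝ {a + t • w} ∧
        osc G (γ t) = osc G x₀) ∧
      ∀ᶠ x in 𝓝 x₀, G x ∈ perp (osc G x₀) → ∃ t ∈ Set.Ioo (-ε) ε, x = γ t := by
  obtain ⟨H, N, ξ, τ, hH, hev, hind, hτ⟩ := h.exists_normalForm hn
  have hinj : Function.Injective (fderiv ℝ H x₀) := by
    rw [injective_iff_map_eq_zero]
    exact fun v hv => hH.self.immersive v 0 (by rw [hv, zero_smul])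
  obtain ⟨V, hV, hVinj⟩ := ContDiffAt.eventually_injOn hH.self.smooth hinj
  obtain ⟨γ, ε, hε, h0, hsm, hγ⟩ := exists_smooth_integralCurve (hev.mono fun x hx => hx.2.1)
    (inter_mem (inter_mem hU hV) (inter_mem hev hH.eventually))
  have hmem0 : (0 : ℝ) ∈ Set.Ioo (-ε) ε := ⟨by linarith, hε⟩
  have hNγ : ∀ t ∈ Set.Ioo (-ε) ε, N (γ t) = N x₀ := by
    have hd : ∀ t ∈ Set.Ioo (-ε) ε, HasDerivAt (fun t => N (γ t)) 0 t := fun t ht => by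
      obtain ⟨⟨-, hx, -⟩, hd⟩ := hγ t ht
      have := (hx.1.differentiableAt (by simp)).hasFDerivAt.comp_hasDerivAt t hd
      rwa [hx.2.2.2.2.1] at this
    intro t ht
    rw [← h0]
    exact isOpen_Ioo.is_const_of_deriv_eq_zero isPreconnected_Ioo
      (fun t ht => (hd t ht).differentiableAt.differentiableWithinAt)
      (fun t ht => (hd t ht).deriv) ht hmem0
  have hHγ : ∀ t ∈ Set.Ioo (-ε) ε, H (γ t) = H x₀ + t • N x₀ := by
    have hd : ∀ t ∈ Set.Ioo (-ε) ε, HasDerivAt (fun t => H (γ t) - t • N x₀) 0 t := fun t ht => by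
      obtain ⟨⟨-, hx, hHx⟩, hd⟩ := hγ t ht
      have h1 := hHx.self.differentiableAt.hasFDerivAt.comp_hasDerivAt t hd
      rw [hx.2.2.2.1, hNγ t ht] at h1
      have h2 : HasDerivAt (fun t : ℝ => t • N x₀) (N x₀) t := by
        simpa using (hasDerivAt_id t).smul_const (N x₀)
      have h3 := h1.sub h2
      rwa [sub_self] at h3
    intro t ht
    have := isOpen_Ioo.is_const_of_deriv_eq_zero isPreconnected_Ioo
      (fun t ht => (hd t ht).differentiableAt.differentiableWithinAt)
      (fun t ht => (hd t ht).deriv) ht hmem0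
    simp only [h0, zero_smul, sub_zero] at this
    rw [← this]
    abel
  have hx₀ := hev.self_of_nhds
  have hosc0 : osc H x₀ = osc G x₀ := hx₀.2.2.2.2.2.1
  have hspan : perp (osc H x₀) = Submodule.span ℝ {H x₀, N x₀} :=
    (hH.isIsotropicPlane hn).eq_span hind hH.self_mem_perp hx₀.2.2.1
  refine ⟨H x₀, N x₀, γ, ε, hind, by rw [← hosc0, hspan], hε, h0, hsm, ?_, ?_, ?_⟩
  · have h1 := (hγ 0 hmem0).2.deriv
    rw [h1, h0]
    intro hξ
    have h2 := hx₀.2.2.2.1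
    rw [hξ, map_zero] at h2
    exact hind.ne_zero 1 h2.symm
  · intro t ht
    obtain ⟨⟨hUV, hx, hHx⟩, hd⟩ := hγ t ht
    refine ⟨hUV.1, by rw [← hx.2.2.2.2.2.2.1, hHγ t ht], ?_⟩
    -- The plane at `γ t` contains `N x₀` and `H x₀ + t N x₀`, which span the plane at `x₀`;
    -- equality follows by dimension.
    have hperp : perp (osc H (γ t)) = perp (osc H x₀) := by
      have h1 : perp (osc H x₀) ≤ perp (osc H (γ t)) := by
        rw [hspan, Submodule.span_le]
        have hNm : N x₀ ∈ perp (osc H (γ t)) := by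
          have := hx.2.2.1
          rwa [hNγ t ht] at this
        rintro X (rfl | rfl)
        · have h2 := hHx.self_mem_perp
          rw [hHγ t ht] at h2
          have h3 := Submodule.sub_mem _ h2 (Submodule.smul_mem _ t hNm)
          rwa [add_sub_cancel_right] at h3
        · exact hNm
      exact ((hHx.isIsotropicPlane hn).eq_of_le (hH.isIsotropicPlane hn).finrank_eq h1).symm
    rw [← hx.2.2.2.2.2.1, ← perp_perp hn (osc H (γ t)), hperp, perp_perp hn, hosc0]
  -- A nearby `x` whose point lies on the line satisfies `H x = H x₀ + τ(H x) N x₀`, which is the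
  -- value of `H` on the curve at time `τ(H x)`. Local injectivity of `H` identifies the parameters.
  · have hτc : ContinuousAt (fun x => τ (H x)) x₀ :=
      τ.continuous.continuousAt.comp hH.self.smooth.continuousAt
    have hτe : ∀ᶠ x in 𝓝 x₀, τ (H x) ∈ Set.Ioo (-ε) ε :=
      hτc.eventually (by simp only [hτ]; exact Ioo_mem_nhds (by linarith) hε)
    filter_upwards [hev, hτe, hV] with x hx hτx hxV hGx
    refine ⟨τ (H x), hτx, ?_⟩
    have hHm : H x ∈ perp (osc H x₀) := by
      rw [hosc0]
      have : H x ∈ Submodule.span ℝ {G x} := by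
        rw [← hx.2.2.2.2.2.2.1]
        exact Submodule.mem_span_singleton_self _
      obtain ⟨c, hc⟩ := Submodule.mem_span_singleton.1 this
      rw [← hc]
      exact Submodule.smul_mem _ _ hGx
    refine hVinj hxV (hγ _ hτx).1.1.2 ?_
    rw [hHγ _ hτx]
    exact hx.2.2.2.2.2.2.2 hHm

theorem IsLightlikeLift.eventually_osc_eq (hn : 3 ≤ n) {G : Param n → PolyVec n} {x₀ : Param n}
    (h : IsLightlikeLift G x₀) :
    ∀ᶠ x in 𝓝 x₀, G x ∈ perp (osc G x₀) → osc G x = osc G x₀ := by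
  obtain ⟨a, w, γ, ε, -, -, -, -, -, -, hγ, hev⟩ := h.exists_ruling hn univ_mem
  filter_upwards [hev] with x hx hG
  obtain ⟨t, ht, rfl⟩ := hx hG
  exact (hγ t ht).2.2

/-- The family of tangent subspaces is continuous. -/
theorem IsLightlikeLift.eventually_osc_ne (hn : 3 ≤ n) {G : Param n → PolyVec n} {x₀ : Param n}
    (h : IsLightlikeLift G x₀) {ℓ : Submodule ℝ (PolyVec n)} (hℓ : perp (osc G x₀) ≠ ℓ) :
    ∀ᶠ x in 𝓝 x₀, perp (osc G x) ≠ ℓ := by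
  -- Either some vector of the plane avoids `ℓ`, and the section with its negative coordinates keeps
  -- avoiding this closed subspace, or `ℓ` has the wrong dimension for every nearby plane.
  have hex : ∃ X ∈ perp (osc G x₀), X ∉ ℓ ∨ Module.finrank ℝ ℓ ≠ 2 := by
    by_contra! hcon
    have hle : perp (osc G x₀) ≤ ℓ := fun X hX => (hcon X hX).1
    refine hℓ (Submodule.eq_of_le_of_finrank_eq hle ?_)
    rw [(h.isIsotropicPlane hn).finrank_eq, (hcon 0 (Submodule.zero_mem _)).2]
  obtain ⟨X, hX, hor⟩ := hex
  rcases hor with hXℓ | hfin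
  · obtain ⟨N, hN⟩ := h.exists_section hn (negPart n X)
    have hNX : N x₀ = X := (h.isIsotropicPlane hn).eq_of_negPart_eq hn hN.self_of_nhds.2.1 hX
      hN.self_of_nhds.2.2
    have hc : ContinuousAt N x₀ := hN.self_of_nhds.1.continuousAt
    have hopen : ∀ᶠ Y in 𝓝 (N x₀), Y ∉ ℓ := by
      rw [hNX]
      exact ℓ.closed_of_finiteDimensional.isOpen_compl.mem_nhds hXℓ
    filter_upwards [hN, hc.eventually hopen] with x hx hx' heq
    exact hx' (heq ▸ hx.2.1)
  · filter_upwards [h.eventually] with x hx heq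
    exact hfin (heq ▸ (hx.isIsotropicPlane hn).finrank_eq)

end RulingCurve

end LightlikeDarboux

namespace LightlikeDarboux

open ConformalSpace Filter

section Transfer

variable {n : ℕ} {M : Type*} [TopologicalSpace M]
  [ChartedSpace (EuclideanSpace ℝ (Fin (n - 1))) M]
  {V : Type*} [NormedAddCommGroup V] [NormedSpace ℝ V]

/-! ### Transfer to local coordinates -/

/-- The coordinates near `u`. -/
noncomputable abbrev coordAt (n : ℕ) {M : Type*} [TopologicalSpace M]
    [ChartedSpace (EuclideanSpace ℝ (Fin (n - 1))) M] (u : M) : PartialEquiv M (Param n) :=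
  extChartAt (𝓡 (n - 1)) u

theorem contDiffAt_coord {S : M → V} {u : M} {k : WithTop ℕ∞}
    (hS : ContMDiffAt (𝓡 (n - 1)) 𝓘(ℝ, V) k S u) :
    ContDiffAt ℝ k (S ∘ (coordAt n u).symm) (coordAt n u u) := by
  have := (contMDiffAt_iff.1 hS).2
  simp only [ModelWithCorners.range_eq_univ, contDiffWithinAt_univ] at this
  exact this

theorem mfderiv_coord {S : M → V} {u : M}
    (hS : ContMDiffAt (𝓡 (n - 1)) 𝓘(ℝ, V) ∞ S u) (ξ : Param n) :
    (mfderiv (𝓡 (n - 1)) 𝓘(ℝ, V) S u ξ : V) =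
      fderiv ℝ (S ∘ (coordAt n u).symm) (coordAt n u u) ξ := by
  have h := (hS.mdifferentiableAt (by simp)).mfderiv
  have h2 : fderivWithin ℝ (writtenInExtChartAt (𝓡 (n - 1)) 𝓘(ℝ, V) u S) (Set.range (𝓡 (n - 1)))
      (coordAt n u u) = fderiv ℝ (S ∘ (coordAt n u).symm) (coordAt n u u) := by
    simp only [ModelWithCorners.range_eq_univ, fderivWithin_univ]
    rfl
  rw [← h2]
  exact congrArg (fun A : TangentSpace (𝓡 (n - 1)) u →L[ℝ] V => A ξ) h

theorem contMDiffAt_of_coord {T : Param n → V} {u : M} {k : WithTop ℕ∞}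
    (hT : ContDiffAt ℝ k T (coordAt n u u)) :
    ContMDiffAt (𝓡 (n - 1)) 𝓘(ℝ, V) k (T ∘ coordAt n u) u :=
  hT.contMDiffAt.comp u contMDiffAt_extChartAt

theorem eventually_coord {p : M → Prop} {u : M} (h : ∀ᶠ v in 𝓝 u, p v) :
    ∀ᶠ x in 𝓝 (coordAt n u u), p ((coordAt n u).symm x) := by
  have hc := continuousAt_extChartAt_symm (I := 𝓡 (n - 1)) u
  refine hc.eventually ?_
  rwa [extChartAt_to_inv]

theorem eventually_of_coord {p : Param n → Prop} {u : M}
    (h : ∀ᶠ x in 𝓝 (coordAt n u u), p x) : ∀ᶠ v in 𝓝 u, p (coordAt n u v) :=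
  (continuousAt_extChartAt (I := 𝓡 (n - 1)) u).eventually h

theorem eventually_coord_left_inv (u : M) : ∀ᶠ v in 𝓝 u, (coordAt n u).symm (coordAt n u v) = v := by
  filter_upwards [extChartAt_source_mem_nhds (I := 𝓡 (n - 1)) u] with v hv
  exact (coordAt n u).left_inv hv

theorem eventually_coord_right_inv (u : M) :
    ∀ᶠ x in 𝓝 (coordAt n u u), coordAt n u ((coordAt n u).symm x) = x := by
  filter_upwards [extChartAt_target_mem_nhds (I := 𝓡 (n - 1)) u] with x hx
  exact (coordAt n u).right_inv hx

theorem eventually_of_coord_symm {p : M → Prop} {u : M}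
    (h : ∀ᶠ x in 𝓝 (coordAt n u u), p ((coordAt n u).symm x)) : ∀ᶠ v in 𝓝 u, p v := by
  filter_upwards [eventually_of_coord h, eventually_coord_left_inv (n := n) u] with v hv hv'
  rwa [hv'] at hv

theorem comp_coord_symm_eventuallyEq {V : Type*} (T : Param n → V) (u : M) :
    (T ∘ coordAt n u) ∘ (coordAt n u).symm =ᶠ[𝓝 (coordAt n u u)] T := by
  filter_upwards [eventually_coord_right_inv (n := n) u] with x hx
  simp only [Function.comp_apply, hx]

/-- Local sections in coordinates. -/
def IsCoordSection (Λ : M → Submodule ℝ (PolyVec n)) (u : M) (T : Param n → PolyVec n) : Prop :=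
  ContDiffAt ℝ ∞ T (coordAt n u u) ∧
    ∀ᶠ x in 𝓝 (coordAt n u u), T x ∈ Λ ((coordAt n u).symm x)

theorem IsLocalSection.coord {Λ : M → Submodule ℝ (PolyVec n)} {u : M} {S : M → PolyVec n}
    (hS : IsLocalSection Λ u S) : IsCoordSection Λ u (S ∘ (coordAt n u).symm) :=
  ⟨contDiffAt_coord hS.1, eventually_coord hS.2⟩

theorem IsCoordSection.isLocalSection {Λ : M → Submodule ℝ (PolyVec n)} {u : M}
    {T : Param n → PolyVec n} (hT : IsCoordSection Λ u T) :
    IsLocalSection Λ u (T ∘ coordAt n u) := by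
  refine ⟨contMDiffAt_of_coord hT.1, eventually_of_coord_symm (n := n) ?_⟩
  filter_upwards [hT.2, eventually_coord_right_inv (n := n) u] with x hx hx'
  simpa only [Function.comp_apply, hx'] using hx

theorem IsCoordSection.mfderiv_eq {Λ : M → Submodule ℝ (PolyVec n)} {u : M}
    {T : Param n → PolyVec n} (hT : IsCoordSection Λ u T) (ξ : Param n) :
    (mfderiv (𝓡 (n - 1)) 𝓘(ℝ, PolyVec n) (T ∘ coordAt n u) u ξ : PolyVec n) =
      fderiv ℝ T (coordAt n u u) ξ := by
  rw [mfderiv_coord hT.isLocalSection.1, (comp_coord_symm_eventuallyEq T u).fderiv_eq]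

theorem projSweptTangent_le {Λ : M → Submodule ℝ (PolyVec n)} {u : M} {P : ProjSpace n}
    {W : Submodule ℝ (PolyVec n)}
    (h : ∀ T, IsCoordSection Λ u T → T (coordAt n u u) ≠ 0 → T (coordAt n u u) ∈ P.submodule →
      ∀ ξ, fderiv ℝ T (coordAt n u u) ξ ∈ W) : projSweptTangent Λ u P ≤ W := by
  refine iSup₂_le fun S hS => Submodule.span_le.2 ?_
  rintro _ ⟨ξ, rfl⟩
  have h0 : (S ∘ (coordAt n u).symm) (coordAt n u u) = S u := by
    simp only [Function.comp_apply, extChartAt_to_inv]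
  have := h (S ∘ (coordAt n u).symm) hS.1.coord (by rw [h0]; exact hS.2.1)
    (by rw [h0]; exact hS.2.2) ξ
  exact (congrArg (· ∈ W) (mfderiv_coord hS.1.1 ξ)).mpr this

theorem fderiv_mem_projSweptTangent {Λ : M → Submodule ℝ (PolyVec n)} {u : M} {P : ProjSpace n}
    {T : Param n → PolyVec n} (hT : IsCoordSection Λ u T) (h0 : T (coordAt n u u) ≠ 0)
    (hP : T (coordAt n u u) ∈ P.submodule) (ξ : Param n) :
    fderiv ℝ T (coordAt n u u) ξ ∈ projSweptTangent Λ u P := by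
  exact Submodule.mem_iSup_of_mem (T ∘ coordAt n u) (Submodule.mem_iSup_of_mem
    ⟨hT.isLocalSection, h0, hP⟩ (Submodule.subset_span ⟨ξ, hT.mfderiv_eq ξ⟩))

theorem mem_grassmannKer_iff {Λ : M → Submodule ℝ (PolyVec n)} {u : M} {ξ : Param n} :
    ξ ∈ grassmannKer Λ u ↔
      ∀ T, IsCoordSection Λ u T → fderiv ℝ T (coordAt n u u) ξ ∈ Λ u := by
  constructor
  · intro h T hT
    have := h _ hT.isLocalSection
    rwa [hT.mfderiv_eq] at this
  · intro h S hS
    have := h _ hS.coord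
    rwa [← mfderiv_coord hS.1] at this

/-! ### Tangent planes -/

theorem exists_apply_eq_one (hn : 3 ≤ n) : ∃ (φ : Param n →L[ℝ] ℝ) (ξ : Param n), φ ξ = 1 := by
  have : Nonempty (Fin (n - 1)) := ⟨⟨0, by omega⟩⟩
  obtain ⟨ξ, hξ⟩ := exists_ne (0 : Param n)
  have h1 : (inner ℝ ξ ξ : ℝ) ≠ 0 := inner_self_ne_zero.2 hξ
  exact ⟨innerSL ℝ ξ, (inner ℝ ξ ξ : ℝ)⁻¹ • ξ, by
    rw [map_smul, innerSL_apply_apply, smul_eq_mul, inv_mul_cancel₀ h1]⟩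

/-- The tangent subspace is spanned by homogeneous coordinates and their differential. -/
theorem tangentPlane_eq_osc (hn : 3 ≤ n) {ψ : M → ProjSpace n} {u : M} {G : Param n → PolyVec n}
    (hG : ContDiffAt ℝ ∞ G (coordAt n u u)) (h0 : G (coordAt n u u) ≠ 0)
    (hspan : ∀ᶠ x in 𝓝 (coordAt n u u),
      (ψ ((coordAt n u).symm x)).submodule = Submodule.span ℝ {G x}) :
    tangentPlane ψ u = osc G (coordAt n u u) := by
  have hGd : DifferentiableAt ℝ G (coordAt n u u) := hG.differentiableAt (by simp)
  have hu : (ψ u).submodule = Submodule.span ℝ {G (coordAt n u u)} := by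
    have := hspan.self_of_nhds
    rwa [extChartAt_to_inv] at this
  have hsec : IsCoordSection (fun u' => (ψ u').submodule) u G :=
    ⟨hG, hspan.mono fun x hx => hx.ge (Submodule.mem_span_singleton_self _)⟩
  have hGu : G (coordAt n u u) ∈ (ψ u).submodule := hu ▸ Submodule.mem_span_singleton_self _
  apply le_antisymm
  · refine projSweptTangent_le fun T hT hT0 _ ξ => ?_
    obtain ⟨ρ, hρ, hTρ⟩ := exists_contDiffAt_smul_eq hn hT.1 hG h0 (by
      filter_upwards [hT.2, hspan] with x hx hx'
      rwa [hx'] at hx)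
    rw [hTρ.fderiv_eq, fderiv_smul_apply (hρ.differentiableAt (by simp)) hGd]
    exact mem_osc.2 ⟨_, ρ (coordAt n u u) • ξ, by rw [map_smul, add_comm]⟩
  · intro X hX
    obtain ⟨c, ξ, rfl⟩ := mem_osc.1 hX
    refine Submodule.add_mem _ (Submodule.smul_mem _ _ ?_)
      (fderiv_mem_projSweptTangent hsec h0 hGu ξ)
    -- The vector `G` itself is obtained as a difference of differentials: multiplying by a function
    -- with value 1 and derivative `φ` adds `φ(η) G = G` to `dG(η)`.
    obtain ⟨φ, η, hφ⟩ := exists_apply_eq_one hn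
    set ρ : Param n → ℝ := fun x => 1 + φ (x - coordAt n u u) with hρdef
    have hρs : ContDiff ℝ ∞ ρ := contDiff_const.add
      (φ.contDiff.comp (contDiff_id.sub contDiff_const))
    have hρ0 : ρ (coordAt n u u) = 1 := by simp [hρdef]
    have hρd : HasFDerivAt ρ φ (coordAt n u u) := by
      have : HasFDerivAt (fun x => φ x - φ (coordAt n u u)) φ (coordAt n u u) :=
        φ.hasFDerivAt.sub_const _
      simpa only [hρdef, map_sub] using this.const_add 1
    have hT : IsCoordSection (fun u' => (ψ u').submodule) u (fun x => ρ x • G x) :=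
      ⟨hρs.contDiffAt.smul hG, hsec.2.mono fun x hx => Submodule.smul_mem _ _ hx⟩
    have h1 := fderiv_mem_projSweptTangent (P := ψ u) hT (by rwa [hρ0, one_smul])
      (by rwa [hρ0, one_smul]) η
    rw [fderiv_smul_apply hρd.differentiableAt hGd, hρd.fderiv, hφ, hρ0, one_smul, one_smul] at h1
    have h2 := Submodule.sub_mem _ h1 (fderiv_mem_projSweptTangent hsec h0 hGu η)
    rwa [add_sub_cancel_left] at h2

end Transfer

end LightlikeDarboux

namespace LightlikeDarboux

open ConformalSpace Filter

section Lifts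

variable {n : ℕ} {M : Type*} [TopologicalSpace M]
  [ChartedSpace (EuclideanSpace ℝ (Fin (n - 1))) M]

/-! ### Lifts of maps into the pseudoconformal space -/

/-- The expression of a map into `C^n_1` in coordinates near `u`. -/
noncomputable def coordExpr (S : M → ConformalSpace n) (u : M) : Param n → Mink n :=
  fun x => chartOf (chartIndex (S u)) (S ((coordAt n u).symm x))

/-- Homogeneous coordinates of `darboux ∘ S` near `u`. -/
noncomputable def homLift (S : M → ConformalSpace n) (u : M) : M → PolyVec n :=
  fun v => chartLift (chartIndex (S u)) (chartOf (chartIndex (S u)) (S v))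

/-- Homogeneous coordinates of `darboux ∘ S` in coordinates near `u`. -/
noncomputable def localLift (S : M → ConformalSpace n) (u : M) : Param n → PolyVec n :=
  homLift S u ∘ (coordAt n u).symm

theorem localLift_eq (S : M → ConformalSpace n) (u : M) :
    localLift S u = chartLift (chartIndex (S u)) ∘ coordExpr S u := rfl

theorem localLift_self (S : M → ConformalSpace n) (u : M) :
    localLift S u (coordAt n u u) =
      chartLift (chartIndex (S u)) (chartOf (chartIndex (S u)) (S u)) := by
  simp only [localLift, homLift, Function.comp_apply, extChartAt_to_inv]

theorem localLift_ne_zero (S : M → ConformalSpace n) (u : M) (x : Param n) :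
    localLift S u x ≠ 0 := chartLift_ne_zero _ _

theorem polyForm_localLift (S : M → ConformalSpace n) (u : M) (x : Param n) :
    polyForm n (localLift S u x) (localLift S u x) = 0 := polyForm_chartLift _ _

theorem contDiffAt_coordExpr {S : M → ConformalSpace n} {u : M}
    (hS : ContMDiffAt (𝓡 (n - 1)) 𝓘(ℝ, Mink n) ∞ S u) :
    ContDiffAt ℝ ∞ (coordExpr S u) (coordAt n u u) := by
  have := (contMDiffAt_iff.1 hS).2
  simp only [ModelWithCorners.range_eq_univ, contDiffWithinAt_univ] at this
  exact this

theorem contDiffAt_localLift {S : M → ConformalSpace n} {u : M}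
    (hS : ContMDiffAt (𝓡 (n - 1)) 𝓘(ℝ, Mink n) ∞ S u) :
    ContDiffAt ℝ ∞ (localLift S u) (coordAt n u u) :=
  (contDiff_chartLift _).contDiffAt.comp _ (contDiffAt_coordExpr hS)

/-- The differential of a map into `C^n_1` as a map between the model spaces. -/
noncomputable def confDeriv (S : M → ConformalSpace n) (u : M) : Param n →L[ℝ] Mink n :=
  mfderiv (𝓡 (n - 1)) 𝓘(ℝ, Mink n) S u

theorem confDeriv_eq {S : M → ConformalSpace n} {u : M}
    (hS : ContMDiffAt (𝓡 (n - 1)) 𝓘(ℝ, Mink n) ∞ S u) (ξ : Param n) :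
    confDeriv S u ξ = fderiv ℝ (coordExpr S u) (coordAt n u u) ξ := by
  have h := (hS.mdifferentiableAt (by simp)).mfderiv
  have h2 : fderivWithin ℝ (writtenInExtChartAt (𝓡 (n - 1)) 𝓘(ℝ, Mink n) u S)
      (Set.range (𝓡 (n - 1))) (coordAt n u u) = fderiv ℝ (coordExpr S u) (coordAt n u u) := by
    simp only [ModelWithCorners.range_eq_univ, fderivWithin_univ]
    rfl
  rw [← h2]
  exact congrArg (fun A : TangentSpace (𝓡 (n - 1)) u →L[ℝ] Mink n => A ξ) h

theorem fderiv_localLift {S : M → ConformalSpace n} {u : M}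
    (hS : ContMDiffAt (𝓡 (n - 1)) 𝓘(ℝ, Mink n) ∞ S u) (ξ : Param n) :
    fderiv ℝ (localLift S u) (coordAt n u u) ξ =
      fderiv ℝ (chartLift (chartIndex (S u))) (chartOf (chartIndex (S u)) (S u))
        (confDeriv S u ξ) := by
  have h0 : coordExpr S u (coordAt n u u) = chartOf (chartIndex (S u)) (S u) := by
    simp only [coordExpr, extChartAt_to_inv]
  rw [confDeriv_eq hS, localLift_eq, ← h0, fderiv_comp _
    ((contDiff_chartLift _).differentiable (by simp) _)
    ((contDiffAt_coordExpr hS).differentiableAt (by simp))]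
  rfl

theorem submodule_darboux_homLift {M : Type*} {S : M → ConformalSpace n} {u v : M}
    (hv : S v ∈ (chartOf (chartIndex (S u))).source) :
    (darboux (S v)).submodule = Submodule.span ℝ {homLift S u v} := submodule_darboux hv

theorem eventually_mem_source {M : Type*} [TopologicalSpace M] {S : M → ConformalSpace n} {u : M}
    (hS : ContinuousAt S u) :
    ∀ᶠ v in 𝓝 u, S v ∈ (chartOf (chartIndex (S u))).source :=
  hS ((chartAt (Mink n) (S u)).open_source.mem_nhds (mem_chart_source _ _))

theorem eventually_submodule_localLift {S : M → ConformalSpace n} {u : M} (hS : ContinuousAt S u) :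
    ∀ᶠ x in 𝓝 (coordAt n u u),
      (darboux (S ((coordAt n u).symm x))).submodule = Submodule.span ℝ {localLift S u x} :=
  (eventually_coord (n := n) (eventually_mem_source hS)).mono fun _ hx =>
    submodule_darboux_homLift hx

theorem polyForm_fderiv_localLift {S : M → ConformalSpace n} {u : M} {x : Param n}
    (hS : DifferentiableAt ℝ (localLift S u) x) (ξ : Param n) :
    polyForm n (localLift S u x) (fderiv ℝ (localLift S u) x ξ) = 0 := by
  have := polyForm_fderiv_add hS hS (Eventually.of_forall fun y => polyForm_localLift S u y) ξ
  rw [polyForm_comm (fderiv ℝ _ _ _)] at this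
  linarith

theorem contMDiffAt_homLift {S : M → ConformalSpace n} {u v : M}
    (hS : ContMDiffAt (𝓡 (n - 1)) 𝓘(ℝ, Mink n) ∞ S v)
    (hv : S v ∈ (chartOf (chartIndex (S u))).source) :
    ContMDiffAt (𝓡 (n - 1)) 𝓘(ℝ, PolyVec n) ∞ (homLift S u) v := by
  have h1 : ContMDiffAt 𝓘(ℝ, Mink n) 𝓘(ℝ, Mink n) ∞ (extChartAt 𝓘(ℝ, Mink n) (S u)) (S v) :=
    contMDiffAt_extChartAt' hv
  exact (contDiff_chartLift _).contDiffAt.contMDiffAt.comp v (h1.comp v hS)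

/-! ### Lifts of lightlike hypersurfaces -/

/-- Degeneracy transfers because the chart lift has isometric differential. For immersivity, the
lift has weight 1 and its differential weight 0, so `dG(ξ) = c G` forces `c = 0`, and the vector
coordinate then gives `df(ξ) = 0`. -/
theorem IsLightlikeHypersurface.isLightlikeAt {f : M → ConformalSpace n}
    (hf : IsLightlikeHypersurface f) (u : M) :
    IsLightlikeAt (localLift f u) (coordAt n u u) := by
  have hd := fderiv_localLift (hf.smooth u)
  refine ⟨contDiffAt_localLift (hf.smooth u), localLift_ne_zero f u _, polyForm_localLift f u _,
    fun ξ c hc => ?_, ?_⟩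
  · rw [hd, localLift_self] at hc
    have h1 := congrArg (chartWeight (chartIndex (f u))) hc
    rw [chartWeight_fderiv_lift, map_smul, chartWeight_lift, smul_eq_mul, mul_one] at h1
    rw [← h1, zero_smul] at hc
    have h2 := congrArg (chartVec (chartIndex (f u))) hc
    rw [chartVec_fderiv_lift, map_zero] at h2
    exact hf.immersion u (h2.trans (map_zero (confDeriv f u)).symm)
  · obtain ⟨ξ, hξ, hl⟩ := hf.lightlike u
    refine ⟨ξ, hξ, fun η => ?_⟩
    exact ((congrArg₂ (fun X Y => polyForm n X Y) (hd ξ) (hd η)).trans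
      (polyForm_fderiv_lift _ _ _ _)).trans (hl η)

theorem IsLightlikeHypersurface.tangentPlane_eq (hn : 3 ≤ n) {f : M → ConformalSpace n}
    (hf : IsLightlikeHypersurface f) (u : M) :
    tangentPlane (darboux ∘ f) u = osc (localLift f u) (coordAt n u u) :=
  tangentPlane_eq_osc hn (hf.isLightlikeAt u).smooth (localLift_ne_zero f u _)
    (eventually_submodule_localLift (hf.smooth u).continuousAt)

variable [IsManifold (𝓡 (n - 1)) ∞ M]

/-- At a point near `u` the homogeneous coordinates adapted to `u` are obtained from those adapted
to the point by rescaling and a change of coordinates. -/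
theorem IsLightlikeHypersurface.isLightlikeAt_of_near {f : M → ConformalSpace n}
    (hf : IsLightlikeHypersurface f) {u v : M} (hv : v ∈ (coordAt n u).source)
    (hfv : f v ∈ (chartOf (chartIndex (f u))).source) :
    IsLightlikeAt (localLift f u) (coordAt n u v) ∧
      osc (localLift f u) (coordAt n u v) = osc (localLift f v) (coordAt n v v) := by
  have : IsManifold (𝓡 (n - 1)) 1 M := IsManifold.of_le (n := ∞) (by simp)
  set σ : Param n → Param n := coordAt n u ∘ (coordAt n v).symm with hσdef
  set y := coordAt n v v
  have hσy : σ y = coordAt n u v := by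
    simp only [hσdef, Function.comp_apply, y, extChartAt_to_inv]
  have hσm : ContMDiffAt (𝓡 (n - 1)) 𝓘(ℝ, Param n) ∞ (coordAt n u) v :=
    contMDiffAt_extChartAt' (by rwa [extChartAt_source] at hv)
  have hσs : ContDiffAt ℝ ∞ σ y := contDiffAt_coord hσm
  have hσd : DifferentiableAt ℝ σ y := hσs.differentiableAt (by simp)
  have hinv : (fderiv ℝ σ y).IsInvertible := by
    have h1 : (mfderiv (𝓡 (n - 1)) 𝓘(ℝ, Param n) (coordAt n u) v).IsInvertible :=
      isInvertible_mfderiv_extChartAt hv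
    refine ContinuousLinearMap.isInvertible_of_injective _ (fun ξ η h => h1.injective ?_) rfl
    exact (mfderiv_coord hσm ξ).trans (h.trans (mfderiv_coord hσm η).symm)
  have hF := contMDiffAt_homLift (hf.smooth v) hfv
  have hG : ContDiffAt ℝ ∞ (localLift f u) (σ y) := by
    have hvt : coordAt n u v ∈ (coordAt n u).target := (coordAt n u).map_source hv
    have h1 : ContMDiffAt 𝓘(ℝ, Param n) (𝓡 (n - 1)) ∞ (coordAt n u).symm (coordAt n u v) :=
      (contMDiffOn_extChartAt_symm u).contMDiffAt (extChartAt_target_mem_nhds' hvt)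
    have h2 : ContMDiffAt (𝓡 (n - 1)) 𝓘(ℝ, PolyVec n) ∞ (homLift f u)
        ((coordAt n u).symm (coordAt n u v)) := by
      rwa [(coordAt n u).left_inv hv]
    rw [hσy]
    exact (h2.comp _ h1).contDiffAt
  -- The lift adapted to `v` has weight one in the chart at `f v`, so the weight of the lift adapted
  -- to `u` in that chart is the factor of proportionality.
  set ρ : Param n → ℝ := fun x =>
    chartWeight (chartIndex (f v)) (homLift f u ((coordAt n v).symm x)) with hρdef
  have hρ : ContDiffAt ℝ ∞ ρ y :=
    (chartWeight (chartIndex (f v))).toContinuousLinearMap.contDiff.contDiffAt.comp y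
      (contDiffAt_coord hF)
  have hsrc : ∀ᶠ m in 𝓝 v, f m ∈ (chartOf (chartIndex (f u))).source :=
    (hf.smooth v).continuousAt ((chartAt (Mink n) (f u)).open_source.mem_nhds hfv)
  have hscale : ∀ m, f m ∈ (chartOf (chartIndex (f u))).source →
      f m ∈ (chartOf (chartIndex (f v))).source →
      homLift f u m = chartWeight (chartIndex (f v)) (homLift f u m) • homLift f v m := by
    intro m h1 h2
    have h3 : homLift f u m ∈ Submodule.span ℝ {homLift f v m} := by
      rw [← submodule_darboux_homLift h2, submodule_darboux_homLift h1]
      exact Submodule.mem_span_singleton_self _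
    obtain ⟨r, hr⟩ := Submodule.mem_span_singleton.1 h3
    have h4 : chartWeight (chartIndex (f v)) (homLift f u m) = r := by
      rw [← hr, map_smul]
      change r • chartWeight (chartIndex (f v)) (chartLift (chartIndex (f v)) _) = r
      rw [chartWeight_lift, smul_eq_mul, mul_one]
    rw [h4, hr]
  have hρ0 : ρ y ≠ 0 := by
    have h1 := hscale v hfv (mem_chartIndex_source _)
    intro h0
    have h2 : chartWeight (chartIndex (f v)) (homLift f u v) = 0 := by
      simpa only [hρdef, y, extChartAt_to_inv] using h0
    rw [h2, zero_smul] at h1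
    exact chartLift_ne_zero _ _ h1
  have heq : localLift f u ∘ σ =ᶠ[𝓝 y] fun x => ρ x • localLift f v x := by
    have h1 : ∀ᶠ m in 𝓝 v, m ∈ (coordAt n u).source := extChartAt_source_mem_nhds' hv
    filter_upwards [eventually_coord (n := n) h1, eventually_coord (n := n) hsrc,
      eventually_coord (n := n) (eventually_mem_source (hf.smooth v).continuousAt)] with
      x hx1 hx2 hx3
    simp only [hσdef, Function.comp_apply, localLift, (coordAt n u).left_inv hx1]
    exact hscale _ hx2 hx3
  have hv0 := hf.isLightlikeAt v
  have hA := (hv0.smul (polyForm_fderiv_localLift hv0.differentiableAt) hρ hρ0).congr heq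
  rw [← hσy]
  refine ⟨hA.of_comp hG hσd hinv, ?_⟩
  rw [← osc_comp (hG.differentiableAt (by simp)) hσd hinv, osc_congr heq,
    osc_smul hv0.differentiableAt (hρ.differentiableAt (by simp)) hρ0]

theorem IsLightlikeHypersurface.isLightlikeLift {f : M → ConformalSpace n}
    (hf : IsLightlikeHypersurface f) (u : M) :
    IsLightlikeLift (localLift f u) (coordAt n u u) := by
  filter_upwards [eventually_coord (n := n) (extChartAt_source_mem_nhds (I := 𝓡 (n - 1)) u),
    eventually_coord (n := n) (eventually_mem_source (hf.smooth u).continuousAt),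
    eventually_coord_right_inv (n := n) u] with x h1 h2 h3
  have := (hf.isLightlikeAt_of_near h1 h2).1
  rwa [h3] at this

theorem IsLightlikeHypersurface.eventually_tangentPlane_eq (hn : 3 ≤ n) {f : M → ConformalSpace n}
    (hf : IsLightlikeHypersurface f) (u : M) : ∀ᶠ x in 𝓝 (coordAt n u u),
      tangentPlane (darboux ∘ f) ((coordAt n u).symm x) = osc (localLift f u) x := by
  filter_upwards [eventually_coord (n := n) (extChartAt_source_mem_nhds (I := 𝓡 (n - 1)) u),
    eventually_coord (n := n) (eventually_mem_source (hf.smooth u).continuousAt),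
    eventually_coord_right_inv (n := n) u] with x h1 h2 h3
  have := (hf.isLightlikeAt_of_near h1 h2).2
  rw [h3] at this
  rw [hf.tangentPlane_eq hn, this]

end Lifts

end LightlikeDarboux

namespace LightlikeDarboux

open ConformalSpace Filter

section Frames

variable {n : ℕ}

/-! ## Adapted frames in coordinates -/

/-- An adapted frame in coordinates near `x₀`. -/
structure IsCoordFrame (G : Param n → PolyVec n) (x₀ : Param n) (A₀ A₁ : Param n → PolyVec n)
    (e : Fin (n - 2) → Param n → PolyVec n) (Aₙ Aₙ₁ : Param n → PolyVec n) : Prop where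
  smooth_zero : ContDiffAt ℝ ∞ A₀ x₀
  smooth_one : ContDiffAt ℝ ∞ A₁ x₀
  smooth_mid : ∀ i, ContDiffAt ℝ ∞ (e i) x₀
  smooth_n : ContDiffAt ℝ ∞ Aₙ x₀
  smooth_n_one : ContDiffAt ℝ ∞ Aₙ₁ x₀
  point_eq : ∀ᶠ x in 𝓝 x₀, Submodule.span ℝ {G x} = Submodule.span ℝ {A₀ x}
  one_mem : ∀ᶠ x in 𝓝 x₀, A₁ x ∈ osc G x
  mid_mem : ∀ᶠ x in 𝓝 x₀, ∀ i, e i x ∈ osc G x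
  mid_indep : ∀ᶠ x in 𝓝 x₀, LinearIndependent ℝ fun i => e i x
  gram_isotropic : ∀ᶠ x in 𝓝 x₀, polyForm n (A₀ x) (A₀ x) = 0 ∧ polyForm n (A₁ x) (A₁ x) = 0 ∧
    polyForm n (Aₙ x) (Aₙ x) = 0 ∧ polyForm n (Aₙ₁ x) (Aₙ₁ x) = 0
  gram_normal : ∀ᶠ x in 𝓝 x₀, polyForm n (A₀ x) (Aₙ₁ x) = -1 ∧ polyForm n (A₁ x) (Aₙ x) = -1
  gram_orthogonal : ∀ᶠ x in 𝓝 x₀, polyForm n (A₀ x) (A₁ x) = 0 ∧ polyForm n (A₀ x) (Aₙ x) = 0 ∧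
    polyForm n (A₁ x) (Aₙ₁ x) = 0 ∧ polyForm n (Aₙ x) (Aₙ₁ x) = 0
  gram_mid : ∀ᶠ x in 𝓝 x₀, ∀ i, polyForm n (A₀ x) (e i x) = 0 ∧ polyForm n (A₁ x) (e i x) = 0 ∧
    polyForm n (Aₙ x) (e i x) = 0 ∧ polyForm n (Aₙ₁ x) (e i x) = 0

/-! ### Existence -/

/-- The projection onto the orthogonal complement of two hyperbolic pairs. -/
noncomputable def hypProj (a b c d X : PolyVec n) : PolyVec n :=
  X + polyForm n X d • a + polyForm n X a • d + polyForm n X c • b + polyForm n X b • c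

/-- The Gram matrix of two isotropic vectors, with orthogonal negative parts of equal length, and
their reflections. -/
theorem gram_negReflect (hn : 3 ≤ n) {ℓ : Submodule ℝ (PolyVec n)} (hℓ : IsIsotropicPlane ℓ)
    {a b : PolyVec n} (ha : a ∈ ℓ) (hb : b ∈ ℓ)
    (hab : negPart n b = (-(negPart n a).2, (negPart n a).1)) :
    polyForm n (negReflect hn a) a = 2 * ((negPart n a).1 ^ 2 + (negPart n a).2 ^ 2) ∧
    polyForm n (negReflect hn b) b = 2 * ((negPart n a).1 ^ 2 + (negPart n a).2 ^ 2) ∧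
    polyForm n (negReflect hn a) b = 0 ∧ polyForm n (negReflect hn b) a = 0 := by
  have key : ∀ X ∈ ℓ, ∀ Y ∈ ℓ, polyForm n (negReflect hn X) Y =
      2 * ((negPart n X).1 * (negPart n Y).1 + (negPart n X).2 * (negPart n Y).2) := by
    intro X hX Y hY
    have h1 := hℓ.isotropic X hX Y hY
    rw [polyForm_eq_inner hn] at h1
    rw [polyForm_negReflect]
    linarith
  refine ⟨?_, ?_, ?_, ?_⟩
  · rw [key a ha a ha]; ring
  · rw [key b hb b hb, hab]; ring
  · rw [key a ha b hb, hab]; ring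
  · rw [key b hb a ha, hab]; ring

/-- The vector `G` and a second section span the isotropic plane. Their rescaled reflections supply
the dual vectors, and the middle vectors come from constant vectors projected away from these two
hyperbolic pairs. -/
theorem IsLightlikeLift.exists_coordFrame (hn : 3 ≤ n) {G : Param n → PolyVec n} {x₀ : Param n}
    (h : IsLightlikeLift G x₀) : ∃ A₀ A₁ e Aₙ Aₙ₁, IsCoordFrame G x₀ A₀ A₁ e Aₙ Aₙ₁ := by
  obtain ⟨N₁, hN₁⟩ := h.exists_section hn (1, 0)
  obtain ⟨N₂, hN₂⟩ := h.exists_section hn (0, 1)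
  set p : Param n → ℝ × ℝ := fun x => negPart n (G x) with hp
  have hps : ContDiffAt ℝ ∞ p x₀ :=
    (negPart n).toContinuousLinearMap.contDiff.contDiffAt.comp x₀ h.self.smooth
  have hp1 : ContDiffAt ℝ ∞ (fun x => (p x).1) x₀ := contDiffAt_fst.comp x₀ hps
  have hp2 : ContDiffAt ℝ ∞ (fun x => (p x).2) x₀ := contDiffAt_snd.comp x₀ hps
  -- The negative part of `A₁` is that of `G` turned by a right angle. This makes `A₁` independent
  -- of `G` and makes the cross terms with the reflections vanish in `gram_negReflect`.
  set A₁ : Param n → PolyVec n := fun x => -(p x).2 • N₁ x + (p x).1 • N₂ x with hA₁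
  have hA₁s : ContDiffAt ℝ ∞ A₁ x₀ :=
    (hp2.neg.smul hN₁.self_of_nhds.1).add (hp1.smul hN₂.self_of_nhds.1)
  have hA₁m : ∀ᶠ x in 𝓝 x₀, A₁ x ∈ perp (osc G x) ∧ negPart n (A₁ x) = (-(p x).2, (p x).1) := by
    filter_upwards [hN₁, hN₂] with x h1 h2
    refine ⟨Submodule.add_mem _ (Submodule.smul_mem _ _ h1.2.1) (Submodule.smul_mem _ _ h2.2.1), ?_⟩
    simp only [hA₁, map_add, map_smul, h1.2.2, h2.2.2]
    simp
  set m : Param n → ℝ := fun x => 2 * ((p x).1 ^ 2 + (p x).2 ^ 2) with hm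
  have hms : ContDiffAt ℝ ∞ m x₀ := contDiffAt_const.mul ((hp1.pow 2).add (hp2.pow 2))
  have hm0 : ∀ᶠ x in 𝓝 x₀, m x ≠ 0 := by
    filter_upwards [h.eventually] with x hx
    have : p x ≠ 0 := fun h0 => hx.self.ne_zero
      ((hx.isIsotropicPlane hn).eq_zero_of_negPart hn hx.self_mem_perp h0)
    exact (mul_pos two_pos (sq_add_sq_pos this)).ne'
  -- The reflection is an isometry, so reflected vectors stay isotropic and mutually orthogonal; the
  -- factor `-1/m` normalizes the two remaining products to `-1`.
  set Aₙ : Param n → PolyVec n := fun x => (-(m x)⁻¹) • negReflect hn (A₁ x) with hAₙ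
  set Aₙ₁ : Param n → PolyVec n := fun x => (-(m x)⁻¹) • negReflect hn (G x) with hAₙ₁
  have hmi : ContDiffAt ℝ ∞ (fun x => -(m x)⁻¹) x₀ := (hms.inv hm0.self_of_nhds).neg
  have hAₙs : ContDiffAt ℝ ∞ Aₙ x₀ := hmi.smul
    ((negReflect hn).toContinuousLinearMap.contDiff.contDiffAt.comp x₀ hA₁s)
  have hAₙ₁s : ContDiffAt ℝ ∞ Aₙ₁ x₀ := hmi.smul
    ((negReflect hn).toContinuousLinearMap.contDiff.contDiffAt.comp x₀ h.self.smooth)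
  have hgram : ∀ᶠ x in 𝓝 x₀, polyForm n (G x) (G x) = 0 ∧ polyForm n (A₁ x) (A₁ x) = 0 ∧
      polyForm n (Aₙ x) (Aₙ x) = 0 ∧ polyForm n (Aₙ₁ x) (Aₙ₁ x) = 0 ∧
      polyForm n (G x) (Aₙ₁ x) = -1 ∧ polyForm n (A₁ x) (Aₙ x) = -1 ∧
      polyForm n (G x) (A₁ x) = 0 ∧ polyForm n (G x) (Aₙ x) = 0 ∧
      polyForm n (A₁ x) (Aₙ₁ x) = 0 ∧ polyForm n (Aₙ x) (Aₙ₁ x) = 0 := by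
    filter_upwards [h.eventually, hA₁m, hm0] with x hx hAx hmx
    have hpl := hx.isIsotropicPlane hn
    have hGm := hx.self_mem_perp
    have h11 := hpl.isotropic _ hAx.1 _ hAx.1
    have h01 := hpl.isotropic _ hGm _ hAx.1
    have h00 := hpl.isotropic _ hGm _ hGm
    obtain ⟨g1, g2, g3, g4⟩ := gram_negReflect hn hpl hGm hAx.1 hAx.2
    have g1' : polyForm n (negReflect hn (G x)) (G x) = m x := g1
    have g2' : polyForm n (negReflect hn (A₁ x)) (A₁ x) = m x := g2
    have hmm : -(m x)⁻¹ * m x = -1 := by rw [neg_mul, inv_mul_cancel₀ hmx]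
    refine ⟨h00, h11, ?_, ?_, ?_, ?_, h01, ?_, ?_, ?_⟩
    · simp only [hAₙ, map_smul, LinearMap.smul_apply, polyForm_negReflect_negReflect, h11,
        smul_zero]
    · simp only [hAₙ₁, map_smul, LinearMap.smul_apply, polyForm_negReflect_negReflect, h00,
        smul_zero]
    · rw [polyForm_comm]
      simp only [hAₙ₁, map_smul, LinearMap.smul_apply, g1', smul_eq_mul, hmm]
    · rw [polyForm_comm]
      simp only [hAₙ, map_smul, LinearMap.smul_apply, g2', smul_eq_mul, hmm]
    · rw [polyForm_comm]
      simp only [hAₙ, map_smul, LinearMap.smul_apply, g4, smul_zero]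
    · rw [polyForm_comm]
      simp only [hAₙ₁, map_smul, LinearMap.smul_apply, g3, smul_zero]
    · simp only [hAₙ, hAₙ₁, map_smul, LinearMap.smul_apply, polyForm_negReflect_negReflect,
        polyForm_comm (A₁ x), h01, smul_zero]
  have hproj : ∀ᶠ x in 𝓝 x₀, ∀ X, polyForm n (G x) (hypProj (G x) (A₁ x) (Aₙ x) (Aₙ₁ x) X) = 0 ∧
      polyForm n (A₁ x) (hypProj (G x) (A₁ x) (Aₙ x) (Aₙ₁ x) X) = 0 ∧
      polyForm n (Aₙ x) (hypProj (G x) (A₁ x) (Aₙ x) (Aₙ₁ x) X) = 0 ∧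
      polyForm n (Aₙ₁ x) (hypProj (G x) (A₁ x) (Aₙ x) (Aₙ₁ x) X) = 0 := by
    filter_upwards [hgram] with x ⟨g1, g2, g3, g4, g5, g6, g7, g8, g9, g10⟩ X
    have g5' := g5
    have g6' := g6
    have g7' := g7
    have g8' := g8
    have g9' := g9
    have g10' := g10
    rw [polyForm_comm] at g5' g6' g7' g8' g9' g10'
    simp only [hypProj, map_add, map_smul, smul_eq_mul, g1, g2, g3, g4, g5, g6, g7, g8, g9, g10,
      g5', g6', g7', g8', g9', g10', polyForm_comm X]
    refine ⟨?_, ?_, ?_, ?_⟩ <;> ring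
  -- On `K` the projection at `x₀` is the identity. Projecting independent vectors of `K` at nearby
  -- points therefore gives smooth vectors that remain independent.
  set K : Submodule ℝ (PolyVec n) :=
    perp (Submodule.span ℝ {G x₀, A₁ x₀, Aₙ x₀, Aₙ₁ x₀}) with hK
  have hKdim : n - 2 ≤ Module.finrank ℝ K := by
    rw [hK, finrank_perp hn]
    have : Module.finrank ℝ (Submodule.span ℝ ({G x₀, A₁ x₀, Aₙ x₀, Aₙ₁ x₀} : Set (PolyVec n)))
        ≤ 4 := by
      classical
      have h1 := finrank_span_finset_le_card (R := ℝ)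
        ({G x₀, A₁ x₀, Aₙ x₀, Aₙ₁ x₀} : Finset (PolyVec n))
      have h2 := Finset.card_le_four (a := G x₀) (b := A₁ x₀) (c := Aₙ x₀) (d := Aₙ₁ x₀)
      simp only [Finset.coe_insert, Finset.coe_singleton] at h1
      exact h1.trans h2
    omega
  obtain ⟨b, hb⟩ : ∃ b : Fin (n - 2) → K, LinearIndependent ℝ b := by
    set B := Module.finBasis ℝ K
    exact ⟨fun i => B (Fin.castLE hKdim i),
      B.linearIndependent.comp _ (Fin.castLE_injective hKdim)⟩
  set e : Fin (n - 2) → Param n → PolyVec n := fun i x =>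
    hypProj (G x) (A₁ x) (Aₙ x) (Aₙ₁ x) (b i) with he
  have hes : ∀ i, ContDiffAt ℝ ∞ (e i) x₀ := by
    intro i
    have hc : ∀ Y : Param n → PolyVec n, ContDiffAt ℝ ∞ Y x₀ →
        ContDiffAt ℝ ∞ (fun x => polyForm n (b i : PolyVec n) (Y x)) x₀ := fun Y hY =>
      ContDiffAt.polyForm contDiffAt_const hY
    exact (((contDiffAt_const.add ((hc _ hAₙ₁s).smul h.self.smooth)).add
      ((hc _ h.self.smooth).smul hAₙ₁s)).add ((hc _ hAₙs).smul hA₁s)).add ((hc _ hA₁s).smul hAₙs)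
  have he0 : ∀ i, e i x₀ = b i := by
    intro i
    have hbi := mem_perp.1 (b i).2
    have g : ∀ Y ∈ ({G x₀, A₁ x₀, Aₙ x₀, Aₙ₁ x₀} : Set (PolyVec n)),
        polyForm n (b i : PolyVec n) Y = 0 := fun Y hY => hbi Y (Submodule.subset_span hY)
    simp only [he, hypProj]
    rw [g (G x₀) (by simp), g (A₁ x₀) (by simp), g (Aₙ x₀) (by simp), g (Aₙ₁ x₀) (by simp)]
    simp
  have hind : ∀ᶠ x in 𝓝 x₀, LinearIndependent ℝ fun i => e i x := by
    have hc : ContinuousAt (fun x => fun i => e i x) x₀ :=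
      continuousAt_pi.2 fun i => (hes i).continuousAt
    refine hc.eventually (p := fun w : Fin (n - 2) → PolyVec n => LinearIndependent ℝ w) ?_
    refine isOpen_setOfPred_linearIndependent.mem_nhds ?_
    change LinearIndependent ℝ fun i => e i x₀
    simp only [he0]
    exact hb.map' K.subtype (Submodule.ker_subtype K)
  refine ⟨G, A₁, e, Aₙ, Aₙ₁, h.self.smooth, hA₁s, hes, hAₙs, hAₙ₁s, Eventually.of_forall fun x => rfl,
    ?_, ?_, hind, ?_, ?_, ?_, ?_⟩
  · filter_upwards [hA₁m, h.eventually] with x h1 h2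
    exact h2.perp_le_osc hn h1.1
  · filter_upwards [hA₁m, h.eventually, hproj, hgram] with x h1 h2 h3 h4 i
    -- The tangent subspace is the orthogonal complement of `span {G, A₁}`, and the projected
    -- vectors are orthogonal to both.
    rw [← perp_perp hn (osc G x), mem_perp]
    have hli : LinearIndependent ℝ ![G x, A₁ x] := by
      rw [LinearIndependent.pair_iff' h2.self.ne_zero]
      intro a ha
      have := congrArg (fun Y => polyForm n Y (Aₙ x)) ha
      simp only [map_smul, LinearMap.smul_apply, h4.2.2.2.2.2.2.2.1, h4.2.2.2.2.2.1,
        smul_zero] at this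
      norm_num at this
    rw [(h2.isIsotropicPlane hn).eq_span hli h2.self_mem_perp h1.1]
    intro Y hY
    obtain ⟨s, t, rfl⟩ := Submodule.mem_span_pair.1 hY
    have h5 := h3 (b i)
    simp only [he, map_add, map_smul]
    rw [polyForm_comm _ (G x), polyForm_comm _ (A₁ x), h5.1, h5.2.1, smul_zero, smul_zero, add_zero]
  · exact hgram.mono fun x g => ⟨g.1, g.2.1, g.2.2.1, g.2.2.2.1⟩
  · exact hgram.mono fun x g => ⟨g.2.2.2.2.1, g.2.2.2.2.2.1⟩
  · exact hgram.mono fun x g => ⟨g.2.2.2.2.2.2.1, g.2.2.2.2.2.2.2.1, g.2.2.2.2.2.2.2.2.1,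
      g.2.2.2.2.2.2.2.2.2⟩
  · filter_upwards [hproj] with x hx i
    exact hx (b i)

end Frames

end LightlikeDarboux

namespace LightlikeDarboux

open ConformalSpace Filter

section PerpBasis

variable {n : ℕ}

/-! ### Bases adapted to an isotropic line -/

/-- `a`, `b` span the isotropic line `ℓ` and are completed by the `e i` to a basis of the orthogonal
complement of `ℓ`. -/
structure IsPerpBasis (ℓ : Submodule ℝ (PolyVec n)) (a b : PolyVec n) (e : Fin (n - 2) → PolyVec n) :
    Prop where
  isotropic : IsIsotropicPlane ℓ
  indep : LinearIndependent ℝ ![a, b]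
  span_eq : ℓ = Submodule.span ℝ {a, b}
  mid_mem : ∀ i, e i ∈ perp ℓ
  mid_indep : ∀ θ : Fin (n - 2) → ℝ, ∑ i, θ i • e i ∈ ℓ → θ = 0

/-- The Gram matrix of the vectors `e i`. -/
noncomputable def gramMatrix (e : Fin (n - 2) → PolyVec n) : Matrix (Fin (n - 2)) (Fin (n - 2)) ℝ :=
  Matrix.of fun i j => polyForm n (e i) (e j)

/-- The components along the `e i` of vectors of the orthogonal complement of `ℓ`. -/
noncomputable def coframe (e : Fin (n - 2) → PolyVec n) : PolyVec n →ₗ[ℝ] (Fin (n - 2) → ℝ) :=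
  (gramMatrix e)⁻¹.mulVecLin ∘ₗ LinearMap.pi fun i => polyForm n (e i)

theorem coframe_apply (e : Fin (n - 2) → PolyVec n) (X : PolyVec n) :
    coframe e X = (gramMatrix e)⁻¹.mulVec fun i => polyForm n (e i) X := rfl

theorem polyForm_sum_smul (e : Fin (n - 2) → PolyVec n) (X : PolyVec n) (θ : Fin (n - 2) → ℝ) :
    polyForm n X (∑ i, θ i • e i) = ∑ i, θ i * polyForm n X (e i) := by
  simp only [map_sum, map_smul, smul_eq_mul]

theorem polyForm_mid_sum (e : Fin (n - 2) → PolyVec n) (θ : Fin (n - 2) → ℝ) :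
    (fun i => polyForm n (e i) (∑ j, θ j • e j)) = (gramMatrix e).mulVec θ := by
  funext i
  simp only [polyForm_sum_smul, Matrix.mulVec, dotProduct, gramMatrix, Matrix.of_apply]
  exact Finset.sum_congr rfl fun j _ => mul_comm _ _

theorem polyForm_sum_sum (e : Fin (n - 2) → PolyVec n) (θ τ : Fin (n - 2) → ℝ) :
    polyForm n (∑ i, θ i • e i) (∑ i, τ i • e i) = θ ⬝ᵥ (gramMatrix e).mulVec τ := by
  rw [polyForm_comm, polyForm_sum_smul, ← polyForm_mid_sum]
  simp only [dotProduct, polyForm_comm _ (e _)]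

theorem gramMatrix_isSymm (e : Fin (n - 2) → PolyVec n) : (gramMatrix e).IsSymm :=
  Matrix.IsSymm.ext fun _ _ => polyForm_comm _ _

namespace IsPerpBasis

variable {ℓ : Submodule ℝ (PolyVec n)} {a b : PolyVec n} {e : Fin (n - 2) → PolyVec n}

theorem left_mem (h : IsPerpBasis ℓ a b e) : a ∈ ℓ := by
  rw [h.span_eq]
  exact Submodule.subset_span (by simp)

theorem right_mem (h : IsPerpBasis ℓ a b e) : b ∈ ℓ := by
  rw [h.span_eq]
  exact Submodule.subset_span (by simp)

theorem sum_mem (h : IsPerpBasis ℓ a b e) (θ : Fin (n - 2) → ℝ) : ∑ i, θ i • e i ∈ perp ℓ :=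
  Submodule.sum_mem _ fun i _ => Submodule.smul_mem _ _ (h.mid_mem i)

/-- The form is semidefinite on the complement of `ℓ`, and its null vectors lie in `ℓ`, where no
nontrivial combination of the `e i` can be. -/
theorem posDef (hn : 3 ≤ n) (h : IsPerpBasis ℓ a b e) : (gramMatrix e).PosDef := by
  refine Matrix.PosDef.of_dotProduct_mulVec_pos ?_ fun θ hθ => ?_
  · rw [Matrix.IsHermitian, Matrix.conjTranspose_eq_transpose_of_trivial]
    exact gramMatrix_isSymm e
  · rw [star_trivial, ← polyForm_sum_sum]
    refine lt_of_le_of_ne (h.isotropic.polyForm_nonneg hn (h.sum_mem θ)) fun h0 => hθ ?_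
    exact h.mid_indep θ (h.isotropic.mem_of_polyForm_self hn (h.sum_mem θ) h0.symm)

theorem isUnit_det (hn : 3 ≤ n) (h : IsPerpBasis ℓ a b e) : IsUnit (gramMatrix e).det :=
  (h.posDef hn).det_pos.ne'.isUnit

theorem coframe_eq_zero (h : IsPerpBasis ℓ a b e) {X : PolyVec n} (hX : X ∈ ℓ) :
    coframe e X = 0 := by
  have : (fun i => polyForm n (e i) X) = 0 := funext fun i => mem_perp.1 (h.mid_mem i) X hX
  rw [coframe_apply, this, Matrix.mulVec_zero]

theorem coframe_sum (hn : 3 ≤ n) (h : IsPerpBasis ℓ a b e) (θ : Fin (n - 2) → ℝ) :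
    coframe e (∑ i, θ i • e i) = θ := by
  rw [coframe_apply, polyForm_mid_sum, Matrix.mulVec_mulVec, Matrix.nonsing_inv_mul _
    (h.isUnit_det hn), Matrix.one_mulVec]

theorem coframe_repr (hn : 3 ≤ n) (h : IsPerpBasis ℓ a b e) (p q : ℝ) (θ : Fin (n - 2) → ℝ) :
    coframe e (p • a + q • b + ∑ i, θ i • e i) = θ := by
  rw [map_add, h.coframe_eq_zero (ℓ.add_mem (ℓ.smul_mem _ h.left_mem) (ℓ.smul_mem _ h.right_mem)),
    zero_add, h.coframe_sum hn]

/-- The sum of `ℓ` and the span of the `e i` is direct, of dimension `2 + (n - 2) = n`, so it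
exhausts the orthogonal complement. -/
theorem exists_repr (hn : 3 ≤ n) (h : IsPerpBasis ℓ a b e) {X : PolyVec n} (hX : X ∈ perp ℓ) :
    ∃ p q : ℝ, X = p • a + q • b + ∑ i, coframe e X i • e i := by
  set S : (Fin (n - 2) → ℝ) →ₗ[ℝ] PolyVec n := Fintype.linearCombination ℝ e with hS
  have hSa : ∀ θ, S θ = ∑ i, θ i • e i := fun θ => rfl
  have hinj : Function.Injective S := by
    rw [injective_iff_map_eq_zero]
    exact fun θ hθ => h.mid_indep θ (by rw [← hSa, hθ]; exact ℓ.zero_mem)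
  have hdisj : ℓ ⊓ LinearMap.range S = ⊥ := by
    rw [eq_bot_iff]
    rintro _ ⟨h1, θ, rfl⟩
    have := h.mid_indep θ h1
    rw [this, map_zero]
    exact Submodule.zero_mem _
  have hdim := Submodule.finrank_sup_add_finrank_inf_eq ℓ (LinearMap.range S)
  rw [hdisj, finrank_bot, LinearMap.finrank_range_of_inj hinj, Module.finrank_fin_fun,
    h.isotropic.finrank_eq] at hdim
  have hle : ℓ ⊔ LinearMap.range S ≤ perp ℓ := by
    refine sup_le h.isotropic.le_perp ?_
    rintro _ ⟨θ, rfl⟩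
    exact h.sum_mem θ
  have heq := Submodule.eq_of_le_of_finrank_eq hle (by rw [h.isotropic.finrank_perp hn]; omega)
  rw [← heq] at hX
  obtain ⟨Y, hY, _, ⟨θ, rfl⟩, rfl⟩ := Submodule.mem_sup.1 hX
  rw [h.span_eq] at hY
  obtain ⟨p, q, rfl⟩ := Submodule.mem_span_pair.1 hY
  exact ⟨p, q, by rw [hSa, h.coframe_repr hn]⟩

theorem mem_iff (hn : 3 ≤ n) (h : IsPerpBasis ℓ a b e) {X : PolyVec n} (hX : X ∈ perp ℓ) :
    X ∈ ℓ ↔ coframe e X = 0 := by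
  refine ⟨h.coframe_eq_zero, fun h0 => ?_⟩
  obtain ⟨p, q, hpq⟩ := h.exists_repr hn hX
  rw [hpq, h0]
  simpa using ℓ.add_mem (ℓ.smul_mem p h.left_mem) (ℓ.smul_mem q h.right_mem)

theorem polyForm_eq (hn : 3 ≤ n) (h : IsPerpBasis ℓ a b e) {X Y : PolyVec n} (hX : X ∈ perp ℓ)
    (hY : Y ∈ perp ℓ) :
    polyForm n X Y = coframe e X ⬝ᵥ (gramMatrix e).mulVec (coframe e Y) := by
  obtain ⟨p, q, hpq⟩ := h.exists_repr hn hX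
  obtain ⟨r, s, hrs⟩ := h.exists_repr hn hY
  have hab : ∀ p q : ℝ, p • a + q • b ∈ ℓ := fun p q =>
    ℓ.add_mem (ℓ.smul_mem _ h.left_mem) (ℓ.smul_mem _ h.right_mem)
  have h1 := mem_perp.1 (h.sum_mem (coframe e X)) _ (hab r s)
  have h2 := mem_perp.1 hY _ (hab p q)
  rw [polyForm_comm] at h2
  rw [← polyForm_sum_sum]
  conv_lhs => rw [hpq, map_add, LinearMap.add_apply, h2, zero_add, hrs, map_add, h1, zero_add]

end IsPerpBasis

end PerpBasis

/-! ### Reality of the eigenvalues of a self-adjoint operator -/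

section Affinor

variable {k : ℕ}

open scoped MatrixOrder in
/-- An operator that is self-adjoint with respect to a positive definite form has real
eigenvalues. -/
theorem card_roots_singularPolynomial {g Λ : Matrix (Fin k) (Fin k) ℝ} (hg : g.PosDef)
    (hs : (g * Λ).IsSymm) : (singularPolynomial Λ).roots.card = k := by
  obtain ⟨B, hB⟩ : ∃ B : Matrix (Fin k) (Fin k) ℝ, g = B.conjTranspose * B :=
    CStarAlgebra.nonneg_iff_eq_star_mul_self.1 hg.posSemidef.nonneg
  rw [Matrix.conjTranspose_eq_transpose_of_trivial] at hB
  have hBu : IsUnit B := by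
    have h1 := hg.det_pos.ne'
    rw [hB, Matrix.det_mul] at h1
    exact (Matrix.isUnit_iff_isUnit_det B).2 (right_ne_zero_of_mul h1).isUnit
  obtain ⟨u, rfl⟩ := hBu
  -- Writing `g = uᵀ u` makes conjugation by `u` turn self-adjointness for `g` into ordinary
  -- symmetry. The sign is there because `det(Λ + x)` is the characteristic polynomial of `-Λ`.
  have hconj : ((u : Matrix (Fin k) (Fin k) ℝ) * (-Λ) * (u⁻¹ : (Matrix (Fin k) (Fin k) ℝ)ˣ)).IsHermitian := by
    rw [Matrix.IsHermitian, Matrix.conjTranspose_eq_transpose_of_trivial]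
    have hs' : (u : Matrix (Fin k) (Fin k) ℝ).transpose * u * Λ =
        Λ.transpose * ((u : Matrix (Fin k) (Fin k) ℝ).transpose * u) := by
      have := hs.eq
      rw [Matrix.transpose_mul, hB, Matrix.transpose_mul, Matrix.transpose_transpose] at this
      exact this.symm
    have h1 : (u : Matrix (Fin k) (Fin k) ℝ) * (u⁻¹ : (Matrix (Fin k) (Fin k) ℝ)ˣ) = 1 := u.mul_inv
    have h2 : ((u⁻¹ : (Matrix (Fin k) (Fin k) ℝ)ˣ) : Matrix (Fin k) (Fin k) ℝ).transpose *
        (u : Matrix (Fin k) (Fin k) ℝ).transpose = 1 := by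
      rw [← Matrix.transpose_mul, h1, Matrix.transpose_one]
    set U : Matrix (Fin k) (Fin k) ℝ := (u : Matrix (Fin k) (Fin k) ℝ)
    set V : Matrix (Fin k) (Fin k) ℝ := ((u⁻¹ : (Matrix (Fin k) (Fin k) ℝ)ˣ) : Matrix (Fin k) (Fin k) ℝ)
    rw [Matrix.transpose_mul, Matrix.transpose_mul, Matrix.transpose_neg]
    calc V.transpose * (-Λ.transpose * U.transpose)
        = -(V.transpose * (Λ.transpose * (U.transpose * U)) * V) := by
          rw [show V.transpose * (Λ.transpose * (U.transpose * U)) * V =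
            V.transpose * (Λ.transpose * (U.transpose * (U * V))) by simp only [mul_assoc], h1]
          simp
      _ = -((V.transpose * U.transpose) * U * Λ * V) := by
          rw [← hs']
          simp only [mul_assoc]
      _ = U * -Λ * V := by
          rw [h2]
          simp
  have hsp := hconj.splits_charpoly
  rw [Matrix.coe_units_inv, Matrix.charpoly_units_conj] at hsp
  have hpoly : singularPolynomial Λ = (-Λ).charpoly := by
    rw [singularPolynomial, Matrix.charpoly, Matrix.charmatrix]
    congr 1
    ext i j
    by_cases hij : i = j
    · subst hij
      simp [add_comm]
    · simp [hij]
  rw [hpoly, ← hsp.natDegree_eq_card_roots, Matrix.charpoly_natDegree_eq_dim, Fintype.card_fin]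

end Affinor

end LightlikeDarboux

namespace LightlikeDarboux

open ConformalSpace Filter

section FrameConsequences

variable {n : ℕ} {G : Param n → PolyVec n} {x₀ : Param n} {A₀ A₁ : Param n → PolyVec n}
  {e : Fin (n - 2) → Param n → PolyVec n} {Aₙ Aₙ₁ : Param n → PolyVec n}

/-! ### The affinor of an adapted frame -/

/-- The frame conditions place `A₁` only in the tangent subspace; being isotropic there, it must lie
in the isotropic plane. Products with `Aₙ₁` and `Aₙ` read off the coefficients of `A₀` and `A₁`.
They prove independence and show that no nontrivial combination of the `e i` lies in the plane. -/
theorem IsCoordFrame.eventually_isPerpBasis (hn : 3 ≤ n) (h : IsLightlikeLift G x₀)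
    (hF : IsCoordFrame G x₀ A₀ A₁ e Aₙ Aₙ₁) :
    ∀ᶠ x in 𝓝 x₀, IsPerpBasis (perp (osc G x)) (A₀ x) (A₁ x) fun i => e i x := by
  filter_upwards [h.eventually, hF.point_eq, hF.one_mem, hF.mid_mem, hF.mid_indep,
    hF.gram_isotropic, hF.gram_normal, hF.gram_orthogonal, hF.gram_mid] with
    x hx h0 h1 he hind hi hnorm ho hm
  have hpl := hx.isIsotropicPlane hn
  have hm0 : A₀ x ∈ perp (osc G x) := by
    have : A₀ x ∈ Submodule.span ℝ {G x} := h0 ▸ Submodule.mem_span_singleton_self _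
    exact (Submodule.span_singleton_le_iff_mem _ _).2 hx.self_mem_perp this
  have hm1 : A₁ x ∈ perp (osc G x) :=
    hpl.mem_of_polyForm_self hn (by rwa [perp_perp hn]) hi.2.1
  have key : ∀ s t : ℝ, polyForm n (s • A₀ x + t • A₁ x) (Aₙ₁ x) = -s ∧
      polyForm n (s • A₀ x + t • A₁ x) (Aₙ x) = -t := by
    intro s t
    simp only [map_add, map_smul, LinearMap.add_apply, LinearMap.smul_apply, smul_eq_mul,
      hnorm.1, hnorm.2, ho.2.1, ho.2.2.1]
    constructor <;> ring
  have hli : LinearIndependent ℝ ![A₀ x, A₁ x] := by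
    rw [LinearIndependent.pair_iff]
    intro s t hst
    obtain ⟨k1, k2⟩ := key s t
    rw [hst, map_zero, LinearMap.zero_apply] at k1 k2
    constructor <;> linarith
  have hspan := hpl.eq_span hli hm0 hm1
  refine ⟨hpl, hli, hspan, fun i => by rw [perp_perp hn]; exact he i, fun θ hθ => ?_⟩
  rw [hspan] at hθ
  obtain ⟨s, t, hst⟩ := Submodule.mem_span_pair.1 hθ
  obtain ⟨k1, k2⟩ := key s t
  rw [hst, polyForm_comm, polyForm_sum_smul] at k1 k2
  simp only [(hm _).2.2.1, (hm _).2.2.2, mul_zero, Finset.sum_const_zero] at k1 k2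
  have hs : s = 0 := by linarith
  have ht : t = 0 := by linarith
  rw [hs, ht, zero_smul, zero_smul, add_zero] at hst
  exact funext (Fintype.linearIndependent_iff.1 hind θ hst.symm)

theorem IsCoordFrame.isPerpBasis (hn : 3 ≤ n) (h : IsLightlikeLift G x₀)
    (hF : IsCoordFrame G x₀ A₀ A₁ e Aₙ Aₙ₁) :
    IsPerpBasis (perp (osc G x₀)) (A₀ x₀) (A₁ x₀) fun i => e i x₀ :=
  (hF.eventually_isPerpBasis hn h).self_of_nhds

/-- The principal parts `ω₀ⁱ` of the frame. -/
noncomputable def principalForm (A₀ : Param n → PolyVec n) (e : Fin (n - 2) → Param n → PolyVec n)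
    (x₀ : Param n) : Param n →ₗ[ℝ] (Fin (n - 2) → ℝ) :=
  coframe (fun i => e i x₀) ∘ₗ (fderiv ℝ A₀ x₀ : Param n →ₗ[ℝ] PolyVec n)

theorem principalForm_apply (A₀ : Param n → PolyVec n) (e : Fin (n - 2) → Param n → PolyVec n)
    (x₀ ξ : Param n) :
    principalForm A₀ e x₀ ξ = coframe (fun i => e i x₀) (fderiv ℝ A₀ x₀ ξ) := rfl

theorem IsCoordFrame.diff_zero (hF : IsCoordFrame G x₀ A₀ A₁ e Aₙ Aₙ₁) :
    DifferentiableAt ℝ A₀ x₀ := hF.smooth_zero.differentiableAt (by simp)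

theorem IsCoordFrame.diff_one (hF : IsCoordFrame G x₀ A₀ A₁ e Aₙ Aₙ₁) :
    DifferentiableAt ℝ A₁ x₀ := hF.smooth_one.differentiableAt (by simp)

/-- Passing from `G` to `A₀` changes the differential by a nonzero factor and a multiple of `G`; the
latter is invisible modulo the isotropic plane. -/
theorem IsCoordFrame.exists_scale (hn : 3 ≤ n) (h : IsLightlikeLift G x₀)
    (hF : IsCoordFrame G x₀ A₀ A₁ e Aₙ Aₙ₁) : ∃ ρ : ℝ, ρ ≠ 0 ∧
      ∀ ξ, ∃ c : ℝ, fderiv ℝ A₀ x₀ ξ = ρ • fderiv ℝ G x₀ ξ + c • G x₀ := by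
  obtain ⟨ρ, hρ, heq⟩ := exists_contDiffAt_smul_eq hn hF.smooth_zero h.self.smooth h.self.ne_zero
    (hF.point_eq.mono fun x hx => hx ▸ Submodule.mem_span_singleton_self _)
  refine ⟨ρ x₀, fun h0 => ?_, fun ξ => ⟨fderiv ℝ ρ x₀ ξ, ?_⟩⟩
  · have h1 : A₀ x₀ = ρ x₀ • G x₀ := heq.self_of_nhds
    rw [h0, zero_smul] at h1
    exact (hF.isPerpBasis hn h).indep.ne_zero 0 h1
  · rw [heq.fderiv_eq, fderiv_smul_apply (hρ.differentiableAt (by simp)) h.self.differentiableAt]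

theorem IsCoordFrame.principalForm_surjective (hn : 3 ≤ n) (h : IsLightlikeLift G x₀)
    (hF : IsCoordFrame G x₀ A₀ A₁ e Aₙ Aₙ₁) : Function.Surjective (principalForm A₀ e x₀) := by
  have hB := hF.isPerpBasis hn h
  obtain ⟨ρ, hρ, hd⟩ := hF.exists_scale hn h
  intro τ
  have h1 := hB.sum_mem τ
  rw [perp_perp hn] at h1
  obtain ⟨c, ξ, hξ⟩ := mem_osc.1 h1
  refine ⟨ρ⁻¹ • ξ, ?_⟩
  obtain ⟨c', hc'⟩ := hd (ρ⁻¹ • ξ)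
  have h2 := congrArg (coframe fun i => e i x₀) hξ
  rw [hB.coframe_sum hn, map_add, hB.coframe_eq_zero (Submodule.smul_mem _ c h.self_mem_perp),
    zero_add] at h2
  rw [principalForm_apply, hc', map_add,
    hB.coframe_eq_zero (Submodule.smul_mem _ c' h.self_mem_perp), add_zero, map_smul, map_smul,
    map_smul, smul_smul, mul_inv_cancel₀ hρ, one_smul, h2]

theorem IsCoordFrame.eventually_zero_mem (hn : 3 ≤ n) (h : IsLightlikeLift G x₀)
    (hF : IsCoordFrame G x₀ A₀ A₁ e Aₙ Aₙ₁) : ∀ᶠ x in 𝓝 x₀, A₀ x ∈ perp (osc G x) :=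
  (hF.eventually_isPerpBasis hn h).mono fun _ hx => hx.left_mem

theorem IsCoordFrame.eventually_one_mem (hn : 3 ≤ n) (h : IsLightlikeLift G x₀)
    (hF : IsCoordFrame G x₀ A₀ A₁ e Aₙ Aₙ₁) : ∀ᶠ x in 𝓝 x₀, A₁ x ∈ perp (osc G x) :=
  (hF.eventually_isPerpBasis hn h).mono fun _ hx => hx.right_mem

theorem IsCoordFrame.fderiv_zero_mem (hn : 3 ≤ n) (h : IsLightlikeLift G x₀)
    (hF : IsCoordFrame G x₀ A₀ A₁ e Aₙ Aₙ₁) (ξ : Param n) :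
    fderiv ℝ A₀ x₀ ξ ∈ perp (perp (osc G x₀)) := by
  rw [perp_perp hn]
  exact h.fderiv_section_mem hn hF.diff_zero (hF.eventually_zero_mem hn h) ξ

theorem IsCoordFrame.fderiv_one_mem (hn : 3 ≤ n) (h : IsLightlikeLift G x₀)
    (hF : IsCoordFrame G x₀ A₀ A₁ e Aₙ Aₙ₁) (ξ : Param n) :
    fderiv ℝ A₁ x₀ ξ ∈ perp (perp (osc G x₀)) := by
  rw [perp_perp hn]
  exact h.fderiv_section_mem hn hF.diff_one (hF.eventually_one_mem hn h) ξ

/-- The principal forms vanish on the directions in which `G` moves along its isotropic line. -/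
theorem IsCoordFrame.principalForm_eq_zero_iff (hn : 3 ≤ n) (h : IsLightlikeLift G x₀)
    (hF : IsCoordFrame G x₀ A₀ A₁ e Aₙ Aₙ₁) (ξ : Param n) :
    principalForm A₀ e x₀ ξ = 0 ↔ fderiv ℝ G x₀ ξ ∈ perp (osc G x₀) := by
  have hB := hF.isPerpBasis hn h
  obtain ⟨ρ, hρ, hd⟩ := hF.exists_scale hn h
  obtain ⟨c, hc⟩ := hd ξ
  rw [principalForm_apply, ← hB.mem_iff hn (hF.fderiv_zero_mem hn h ξ), hc,
    Submodule.add_mem_iff_left _ (Submodule.smul_mem _ c h.self_mem_perp),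
    Submodule.smul_mem_iff _ hρ]

/-- The affinor of an adapted frame. -/
theorem IsCoordFrame.exists_affinor (hn : 3 ≤ n) (h : IsLightlikeLift G x₀)
    (hF : IsCoordFrame G x₀ A₀ A₁ e Aₙ Aₙ₁) : ∃ Λ : Matrix (Fin (n - 2)) (Fin (n - 2)) ℝ,
      (∀ ξ, coframe (fun i => e i x₀) (fderiv ℝ A₁ x₀ ξ) = Λ.mulVec (principalForm A₀ e x₀ ξ)) ∧
      (gramMatrix (fun i => e i x₀) * Λ).IsSymm := by
  have hB := hF.isPerpBasis hn h
  have hsurj := hF.principalForm_surjective hn h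
  set σ : Param n →ₗ[ℝ] (Fin (n - 2) → ℝ) :=
    coframe (fun i => e i x₀) ∘ₗ (fderiv ℝ A₁ x₀ : Param n →ₗ[ℝ] PolyVec n) with hσ
  have hσa : ∀ ξ, σ ξ = coframe (fun i => e i x₀) (fderiv ℝ A₁ x₀ ξ) := fun ξ => rfl
  have hker : ∀ ξ, principalForm A₀ e x₀ ξ = 0 → σ ξ = 0 := by
    intro ξ hξ
    rw [hF.principalForm_eq_zero_iff hn h] at hξ
    rw [hσa]
    exact hB.coframe_eq_zero
      (h.fderiv_section_mem_perp hn hF.diff_one (hF.eventually_one_mem hn h) hξ)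
  -- As `σ` vanishes on the kernel of the surjective principal forms, it factors through them; `σ ∘
  -- r` is the factor, whatever right inverse `r` is taken.
  obtain ⟨r, hr⟩ := (principalForm A₀ e x₀).exists_rightInverse_of_surjective
    (LinearMap.range_eq_top.2 hsurj)
  have hr' : ∀ τ, principalForm A₀ e x₀ (r τ) = τ := fun τ => LinearMap.congr_fun hr τ
  set Λ := LinearMap.toMatrix' (σ ∘ₗ r) with hΛ
  have hΛa : ∀ τ, Λ.mulVec τ = σ (r τ) := fun τ => by
    rw [hΛ, LinearMap.toMatrix'_mulVec]
    rfl
  have hmain : ∀ ξ, σ ξ = Λ.mulVec (principalForm A₀ e x₀ ξ) := by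
    intro ξ
    rw [hΛa, ← sub_eq_zero, ← map_sub]
    exact hker _ (by rw [map_sub, hr', sub_self])
  refine ⟨Λ, hmain, ?_⟩
  obtain ⟨ρ, hρ, hd⟩ := hF.exists_scale hn h
  set g := gramMatrix (fun i => e i x₀) with hg
  -- The symmetry known for `dG` passes to `dA₀`, since `dA₁` is orthogonal to `G`.
  have hsym : ∀ ξ η, polyForm n (fderiv ℝ A₁ x₀ ξ) (fderiv ℝ A₀ x₀ η) =
      polyForm n (fderiv ℝ A₁ x₀ η) (fderiv ℝ A₀ x₀ ξ) := by
    intro ξ η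
    obtain ⟨c, hc⟩ := hd η
    obtain ⟨c', hc'⟩ := hd ξ
    have h0 : ∀ ξ, polyForm n (fderiv ℝ A₁ x₀ ξ) (G x₀) = 0 := fun ξ =>
      mem_perp.1 (hF.fderiv_one_mem hn h ξ) _ h.self_mem_perp
    rw [hc, hc', map_add, map_add, map_smul, map_smul, map_smul, map_smul, h0, h0,
      h.polyForm_fderiv_section_symm hF.diff_one (hF.eventually_one_mem hn h) ξ η, smul_zero,
      smul_zero]
  have hsym' : ∀ τ υ : Fin (n - 2) → ℝ, Λ.mulVec τ ⬝ᵥ g.mulVec υ = Λ.mulVec υ ⬝ᵥ g.mulVec τ := by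
    intro τ υ
    obtain ⟨ξ, rfl⟩ := hsurj τ
    obtain ⟨η, rfl⟩ := hsurj υ
    have := hsym ξ η
    rw [hB.polyForm_eq hn (hF.fderiv_one_mem hn h _) (hF.fderiv_zero_mem hn h _),
      hB.polyForm_eq hn (hF.fderiv_one_mem hn h _) (hF.fderiv_zero_mem hn h _)] at this
    rw [← hmain, ← hmain]
    exact this
  have hgs : g.transpose = g := gramMatrix_isSymm _
  have key : ∀ τ υ, υ ⬝ᵥ (g * Λ).mulVec τ = Λ.mulVec τ ⬝ᵥ g.mulVec υ := by
    intro τ υ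
    rw [← Matrix.mulVec_mulVec, Matrix.dotProduct_mulVec, ← Matrix.mulVec_transpose, hgs,
      dotProduct_comm]
  ext i j
  have h1 := key (Pi.single i 1) (Pi.single j 1)
  have h2 := key (Pi.single j 1) (Pi.single i 1)
  rw [hsym', ← h2] at h1
  simpa using h1

theorem IsCoordFrame.affinor_unique (hn : 3 ≤ n) (h : IsLightlikeLift G x₀)
    (hF : IsCoordFrame G x₀ A₀ A₁ e Aₙ Aₙ₁) {Λ Λ' : Matrix (Fin (n - 2)) (Fin (n - 2)) ℝ}
    (hΛ : ∀ ξ, Λ.mulVec (principalForm A₀ e x₀ ξ) = Λ'.mulVec (principalForm A₀ e x₀ ξ)) :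
    Λ = Λ' := by
  refine Matrix.mulVec_injective (funext fun τ => ?_)
  obtain ⟨ξ, rfl⟩ := hF.principalForm_surjective hn h τ
  exact hΛ ξ

/-- Smooth sections of the family of isotropic lines are combinations of `A₀` and `A₁`. -/
theorem IsCoordFrame.exists_section_eq (hn : 3 ≤ n) (h : IsLightlikeLift G x₀)
    (hF : IsCoordFrame G x₀ A₀ A₁ e Aₙ Aₙ₁) {T : Param n → PolyVec n} (hT : ContDiffAt ℝ ∞ T x₀)
    (hmem : ∀ᶠ x in 𝓝 x₀, T x ∈ perp (osc G x)) : ∃ a b : Param n → ℝ, ContDiffAt ℝ ∞ a x₀ ∧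
      ContDiffAt ℝ ∞ b x₀ ∧ T =ᶠ[𝓝 x₀] fun x => a x • A₀ x + b x • A₁ x := by
  -- The dual vectors of the frame read off the coefficients; the signs come from the normalization
  -- of the products to `-1`.
  refine ⟨fun x => -polyForm n (T x) (Aₙ₁ x), fun x => -polyForm n (T x) (Aₙ x),
    (ContDiffAt.polyForm hT hF.smooth_n_one).neg, (ContDiffAt.polyForm hT hF.smooth_n).neg, ?_⟩
  filter_upwards [hmem, hF.eventually_isPerpBasis hn h, hF.gram_normal, hF.gram_orthogonal] with
    x hx hB hnorm ho
  rw [hB.span_eq] at hx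
  obtain ⟨s, t, hst⟩ := Submodule.mem_span_pair.1 hx
  simp only [← hst, map_add, map_smul, LinearMap.add_apply, LinearMap.smul_apply, smul_eq_mul,
      hnorm.1, hnorm.2, ho.2.1, ho.2.2.1]
  simp

theorem fderiv_combination {a b : Param n → ℝ} {A B : Param n → PolyVec n} {x : Param n}
    (ha : DifferentiableAt ℝ a x) (hb : DifferentiableAt ℝ b x) (hA : DifferentiableAt ℝ A x)
    (hB : DifferentiableAt ℝ B x) (ξ : Param n) :
    fderiv ℝ (fun y => a y • A y + b y • B y) x ξ =
      (fderiv ℝ a x ξ • A x + fderiv ℝ b x ξ • B x) +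
        (a x • fderiv ℝ A x ξ + b x • fderiv ℝ B x ξ) := by
  rw [fderiv_fun_add (ha.fun_smul hA) (hb.fun_smul hB), add_apply,
    fderiv_smul_apply ha hA, fderiv_smul_apply hb hB]
  abel

end FrameConsequences

end LightlikeDarboux

namespace LightlikeDarboux

open ConformalSpace Filter

section SingularPoints

variable {n : ℕ} {M : Type*} [TopologicalSpace M]
  [ChartedSpace (EuclideanSpace ℝ (Fin (n - 1))) M] {u : M}
  {G : Param n → PolyVec n} {A₀ A₁ : Param n → PolyVec n}
  {e : Fin (n - 2) → Param n → PolyVec n} {Aₙ Aₙ₁ : Param n → PolyVec n}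
  {ℓ : M → Submodule ℝ (PolyVec n)}

/-! ### Singular points of the rulings -/

/-- The differential `α dA₀ + β dA₁`. -/
noncomputable def pointDifferential (A₀ A₁ : Param n → PolyVec n) (x : Param n) (α β : ℝ) :
    Param n →ₗ[ℝ] PolyVec n :=
  α • (fderiv ℝ A₀ x : Param n →ₗ[ℝ] PolyVec n) + β • (fderiv ℝ A₁ x : Param n →ₗ[ℝ] PolyVec n)

theorem pointDifferential_apply (A₀ A₁ : Param n → PolyVec n) (x : Param n) (α β : ℝ)
    (ξ : Param n) :
    pointDifferential A₀ A₁ x α β ξ = α • fderiv ℝ A₀ x ξ + β • fderiv ℝ A₁ x ξ := rfl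

/-- A section is `a A₀ + b A₁`, with differential `(da A₀ + db A₁) + (a dA₀ + b dA₁)`. The first
bracket lies in the isotropic plane and can be made any vector of it by choice of `da` and `db`; the
second depends only on the point, up to scale. -/
theorem IsCoordFrame.projSweptTangent_eq (hn : 3 ≤ n) (h : IsLightlikeLift G (coordAt n u u))
    (hF : IsCoordFrame G (coordAt n u u) A₀ A₁ e Aₙ Aₙ₁)
    (hℓ : ∀ᶠ x in 𝓝 (coordAt n u u), ℓ ((coordAt n u).symm x) = perp (osc G x)) {α β : ℝ}
    {P : ProjSpace n} (hP : P.submodule =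
      Submodule.span ℝ {α • A₀ (coordAt n u u) + β • A₁ (coordAt n u u)}) :
    projSweptTangent ℓ u P = perp (osc G (coordAt n u u)) ⊔
      LinearMap.range (pointDifferential A₀ A₁ (coordAt n u u) α β) := by
  set x₀ := coordAt n u u
  have hB := hF.isPerpBasis hn h
  have hne : α • A₀ x₀ + β • A₁ x₀ ≠ 0 := by
    intro h0
    have h1 := P.finrank_submodule
    rw [hP, h0, Submodule.span_zero_singleton, finrank_bot] at h1
    exact absurd h1 zero_ne_one
  apply le_antisymm
  · refine projSweptTangent_le fun T hT _ hTP ξ => ?_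
    obtain ⟨a, b, ha, hb, hab⟩ := hF.exists_section_eq hn h hT.1 (by
      filter_upwards [hT.2, hℓ] with x hx hx'
      rwa [hx'] at hx)
    have had : DifferentiableAt ℝ a x₀ := ha.differentiableAt (by simp)
    have hbd : DifferentiableAt ℝ b x₀ := hb.differentiableAt (by simp)
    rw [hP, hab.self_of_nhds] at hTP
    obtain ⟨s, hs⟩ := Submodule.mem_span_singleton.1 hTP
    have h1 : (s * α - a x₀) • A₀ x₀ + (s * β - b x₀) • A₁ x₀ = 0 := by
      rw [sub_smul, sub_smul, mul_smul, mul_smul]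
      rw [smul_add] at hs
      rw [sub_add_sub_comm, hs, sub_self]
    obtain ⟨h2, h3⟩ := LinearIndependent.pair_iff.1 hB.indep _ _ h1
    rw [hab.fderiv_eq, fderiv_combination had hbd hF.diff_zero hF.diff_one,
      ← sub_eq_zero.1 h2, ← sub_eq_zero.1 h3]
    refine Submodule.add_mem_sup (Submodule.add_mem _ (Submodule.smul_mem _ _ hB.left_mem)
      (Submodule.smul_mem _ _ hB.right_mem)) ⟨s • ξ, ?_⟩
    rw [map_smul, pointDifferential_apply, smul_add, smul_smul, smul_smul]
  -- The test sections have coefficients `α + c φ(x - x₀)` and `β + d φ(x - x₀)`, so their values at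
  -- `x₀` stay fixed while `da = c φ` and `db = d φ`.
  · have key : ∀ (φ : Param n →L[ℝ] ℝ) (c d : ℝ) (ξ : Param n),
        φ ξ • (c • A₀ x₀ + d • A₁ x₀) + pointDifferential A₀ A₁ x₀ α β ξ ∈
          projSweptTangent ℓ u P := by
      intro φ c d ξ
      have hs : ∀ p q : ℝ, HasFDerivAt (fun x => p + q * φ (x - x₀)) (q • φ) x₀ ∧
          ContDiffAt ℝ ∞ (fun x => p + q * φ (x - x₀)) x₀ := by
        intro p q
        constructor
        · have h1 : HasFDerivAt (fun x => φ x - φ x₀) φ x₀ := φ.hasFDerivAt.sub_const _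
          simpa only [map_sub] using (h1.const_mul q).const_add p
        · exact contDiffAt_const.add (contDiffAt_const.mul
            (φ.contDiff.contDiffAt.comp _ (contDiffAt_id.sub contDiffAt_const)))
      set T : Param n → PolyVec n := fun x =>
        (α + c * φ (x - x₀)) • A₀ x + (β + d * φ (x - x₀)) • A₁ x with hT
      have hTx : T x₀ = α • A₀ x₀ + β • A₁ x₀ := by simp [hT]
      have hTs : IsCoordSection ℓ u T := by
        refine ⟨((hs α c).2.smul hF.smooth_zero).add ((hs β d).2.smul hF.smooth_one), ?_⟩
        filter_upwards [hℓ, hF.eventually_zero_mem hn h, hF.eventually_one_mem hn h] with x h1 h2 h3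
        rw [h1]
        exact Submodule.add_mem _ (Submodule.smul_mem _ _ h2) (Submodule.smul_mem _ _ h3)
      have h1 := fderiv_mem_projSweptTangent hTs (P := P) (hTx ▸ hne)
        (by rw [hP]; exact hTx ▸ Submodule.mem_span_singleton_self _) ξ
      rw [hT, fderiv_combination (hs α c).1.differentiableAt (hs β d).1.differentiableAt
        hF.diff_zero hF.diff_one, (hs α c).1.fderiv, (hs β d).1.fderiv] at h1
      simp only [sub_self, map_zero, mul_zero, add_zero, FunLike.coe_smul,
        Pi.smul_apply, smul_eq_mul] at h1
      rw [pointDifferential_apply, smul_add, smul_smul, smul_smul, mul_comm _ c, mul_comm _ d]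
      exact h1
    have hrange : ∀ ξ, pointDifferential A₀ A₁ x₀ α β ξ ∈ projSweptTangent ℓ u P := by
      intro ξ
      simpa using key 0 0 0 ξ
    refine sup_le ?_ ?_
    · rw [hB.span_eq]
      intro X hX
      obtain ⟨c, d, rfl⟩ := Submodule.mem_span_pair.1 hX
      obtain ⟨φ, η, hφ⟩ := exists_apply_eq_one hn
      have h1 := Submodule.sub_mem _ (key φ c d η) (hrange η)
      rwa [hφ, one_smul, add_sub_cancel_right] at h1
    · rintro _ ⟨ξ, rfl⟩
      exact hrange ξ

theorem IsLightlikeLift.projSweptTangent_le (hn : 3 ≤ n) (h : IsLightlikeLift G (coordAt n u u))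
    (hℓ : ∀ᶠ x in 𝓝 (coordAt n u u), ℓ ((coordAt n u).symm x) = perp (osc G x))
    (P : ProjSpace n) : projSweptTangent ℓ u P ≤ osc G (coordAt n u u) := by
  refine LightlikeDarboux.projSweptTangent_le fun T hT _ _ ξ =>
    h.fderiv_section_mem hn (hT.1.differentiableAt (by simp)) ?_ ξ
  filter_upwards [hT.2, hℓ] with x hx hx'
  rwa [hx'] at hx

/-- Modulo the isotropic plane, `α dA₀ + β dA₁` is the matrix `α + β Λ` applied to the surjective
principal forms. The swept tangent space therefore fills the tangent subspace exactly when this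
matrix is surjective. -/
theorem IsCoordFrame.finrank_projSweptTangent_lt_iff (hn : 3 ≤ n)
    (h : IsLightlikeLift G (coordAt n u u))
    (hF : IsCoordFrame G (coordAt n u u) A₀ A₁ e Aₙ Aₙ₁)
    (hℓ : ∀ᶠ x in 𝓝 (coordAt n u u), ℓ ((coordAt n u).symm x) = perp (osc G x)) {α β : ℝ}
    {P : ProjSpace n} (hP : P.submodule =
      Submodule.span ℝ {α • A₀ (coordAt n u u) + β • A₁ (coordAt n u u)})
    {Λ : Matrix (Fin (n - 2)) (Fin (n - 2)) ℝ}
    (hΛ : ∀ ξ, coframe (fun i => e i (coordAt n u u)) (fderiv ℝ A₁ (coordAt n u u) ξ) =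
      Λ.mulVec (principalForm A₀ e (coordAt n u u) ξ)) :
    Module.finrank ℝ (projSweptTangent ℓ u P) < n ↔
      (α • (1 : Matrix (Fin (n - 2)) (Fin (n - 2)) ℝ) + β • Λ).det = 0 := by
  have hB := hF.isPerpBasis hn h
  have hle := h.projSweptTangent_le hn hℓ P
  have hsurj := hF.principalForm_surjective hn h
  have heq := hF.projSweptTangent_eq hn h hℓ hP
  set x₀ := coordAt n u u
  set m : Matrix (Fin (n - 2)) (Fin (n - 2)) ℝ := α • 1 + β • Λ with hm
  set μ := pointDifferential A₀ A₁ x₀ α β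
  have hμmem : ∀ ξ, μ ξ ∈ perp (perp (osc G x₀)) := fun ξ => Submodule.add_mem _
    (Submodule.smul_mem _ _ (hF.fderiv_zero_mem hn h ξ))
    (Submodule.smul_mem _ _ (hF.fderiv_one_mem hn h ξ))
  have hμ : ∀ ξ, coframe (fun i => e i x₀) (μ ξ) = m.mulVec (principalForm A₀ e x₀ ξ) := by
    intro ξ
    rw [pointDifferential_apply, map_add, map_smul, map_smul, hΛ, hm, Matrix.add_mulVec,
      Matrix.smul_mulVec, Matrix.smul_mulVec, Matrix.one_mulVec]
    rfl
  have hfr : Module.finrank ℝ (osc G x₀) = n := h.self.finrank_osc hn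
  have h1 : projSweptTangent ℓ u P = osc G x₀ ↔ m.det ≠ 0 := by
    rw [← isUnit_iff_ne_zero, ← Matrix.isUnit_iff_isUnit_det, ← Matrix.mulVec_surjective_iff_isUnit,
      heq]
    constructor
    · intro hW τ
      have h2 := hB.sum_mem τ
      rw [perp_perp hn, ← hW] at h2
      obtain ⟨Y, hY, _, ⟨ξ, rfl⟩, hYξ⟩ := Submodule.mem_sup.1 h2
      refine ⟨principalForm A₀ e x₀ ξ, ?_⟩
      rw [← hμ]
      have h3 := congrArg (coframe fun i => e i x₀) hYξ
      rwa [hB.coframe_sum hn, map_add, hB.coframe_eq_zero hY, zero_add] at h3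
    · intro hs
      refine le_antisymm (heq ▸ hle) fun X hX => ?_
      obtain ⟨τ, hτ⟩ := hs (coframe (fun i => e i x₀) X)
      obtain ⟨ξ, rfl⟩ := hsurj τ
      have h2 : X - μ ξ ∈ perp (osc G x₀) := by
        refine (hB.mem_iff hn (Submodule.sub_mem _ (by rwa [perp_perp hn]) (hμmem ξ))).2 ?_
        rw [map_sub, hμ]
        exact sub_eq_zero.2 hτ.symm
      have h3 := Submodule.add_mem_sup h2 (LinearMap.mem_range_self μ ξ)
      rwa [sub_add_cancel] at h3
  rw [← not_iff_not, ← ne_eq, ← h1, not_lt]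
  constructor
  · intro h2
    exact Submodule.eq_of_le_of_finrank_le hle (hfr.trans_le h2)
  · intro h2
    rw [h2, hfr]

/-- The singular points of a ruling. -/
theorem IsCoordFrame.isProjSingularPoint_iff (hn : 3 ≤ n) (h : IsLightlikeLift G (coordAt n u u))
    (hF : IsCoordFrame G (coordAt n u u) A₀ A₁ e Aₙ Aₙ₁)
    (hℓ : ∀ᶠ x in 𝓝 (coordAt n u u), ℓ ((coordAt n u).symm x) = perp (osc G x))
    {Λ : Matrix (Fin (n - 2)) (Fin (n - 2)) ℝ}
    (hΛ : ∀ ξ, coframe (fun i => e i (coordAt n u u)) (fderiv ℝ A₁ (coordAt n u u) ξ) =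
      Λ.mulVec (principalForm A₀ e (coordAt n u u) ξ)) (P : ProjSpace n) :
    IsProjSingularPoint ℓ u P ↔
      ∃ x : ℝ, (Λ + x • (1 : Matrix (Fin (n - 2)) (Fin (n - 2)) ℝ)).det = 0 ∧
        P.submodule = Submodule.span ℝ {A₁ (coordAt n u u) + x • A₀ (coordAt n u u)} := by
  have hB := hF.isPerpBasis hn h
  have hℓu : ℓ u = perp (osc G (coordAt n u u)) := by
    have := hℓ.self_of_nhds
    rwa [extChartAt_to_inv] at this
  constructor
  · rintro ⟨hP, hlt⟩
    have hrep : P.rep ∈ P.submodule := rep_mem_submodule P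
    have h1 := hP hrep
    rw [hℓu, hB.span_eq] at h1
    obtain ⟨α, β, hαβ⟩ := Submodule.mem_span_pair.1 h1
    have hspan : P.submodule =
        Submodule.span ℝ {α • A₀ (coordAt n u u) + β • A₁ (coordAt n u u)} := by
      rw [hαβ]
      exact P.submodule_eq
    rw [hF.finrank_projSweptTangent_lt_iff hn h hℓ hspan hΛ] at hlt
    -- The point `A₀` is never singular: there the determinant is a power of `α`, and `α = β = 0`
    -- represents no point.
    have hβ : β ≠ 0 := by
      rintro rfl
      rw [zero_smul, add_zero, Matrix.det_smul, Matrix.det_one, mul_one] at hlt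
      have hα : α = 0 := eq_zero_of_pow_eq_zero hlt
      rw [hα, zero_smul, zero_smul, add_zero] at hαβ
      exact P.rep_nonzero hαβ.symm
    have h2 : α • (1 : Matrix (Fin (n - 2)) (Fin (n - 2)) ℝ) + β • Λ =
        β • (Λ + (β⁻¹ * α) • (1 : Matrix (Fin (n - 2)) (Fin (n - 2)) ℝ)) := by
      rw [smul_add, smul_smul, mul_inv_cancel_left₀ hβ, add_comm]
    refine ⟨β⁻¹ * α, ?_, ?_⟩
    · rw [h2, Matrix.det_smul] at hlt
      exact (mul_eq_zero.1 hlt).resolve_left (pow_ne_zero _ hβ)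
    · rw [hspan, ← Submodule.span_singleton_smul_eq (IsUnit.mk0 _ (inv_ne_zero hβ)), smul_add,
        smul_smul, smul_smul, inv_mul_cancel₀ hβ, one_smul, add_comm]
  · rintro ⟨x, hdet, hP⟩
    have hP' : P.submodule =
        Submodule.span ℝ {x • A₀ (coordAt n u u) + (1 : ℝ) • A₁ (coordAt n u u)} := by
      rw [hP, one_smul, add_comm]
    refine ⟨?_, ?_⟩
    · rw [hP, hℓu, Submodule.span_singleton_le_iff_mem]
      exact Submodule.add_mem _ hB.right_mem (Submodule.smul_mem _ _ hB.left_mem)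
    · rw [hF.finrank_projSweptTangent_lt_iff hn h hℓ hP' hΛ, one_smul, add_comm]
      exact hdet

/-! ### The rank of the Gauss map -/

/-- The kernel of the differential is that of the principal forms. If `de_i(ξ)` stays in the tangent
subspace, differentiating `⟨e_i, A₀⟩ = 0` gives `⟨e_i, dA₀(ξ)⟩ = 0`. Conversely, when `dG(ξ)` lies
in the isotropic plane, so do `dA₀(ξ)` and `dA₁(ξ)`; differentiating the products of a tangent
section `T` with `A₀` and `A₁` then keeps `dT(ξ)` in the tangent subspace. -/
theorem IsCoordFrame.grassmannRank_eq (hn : 3 ≤ n) (h : IsLightlikeLift G (coordAt n u u))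
    (hF : IsCoordFrame G (coordAt n u u) A₀ A₁ e Aₙ Aₙ₁) {W : M → Submodule ℝ (PolyVec n)}
    (hW : ∀ᶠ x in 𝓝 (coordAt n u u), W ((coordAt n u).symm x) = osc G x) :
    grassmannRank W u = n - 2 := by
  have hB := hF.isPerpBasis hn h
  have hWu : W u = osc G (coordAt n u u) := by
    have := hW.self_of_nhds
    rwa [extChartAt_to_inv] at this
  have hiff : ∀ ξ : Param n, (∀ T, IsCoordSection W u T →
      fderiv ℝ T (coordAt n u u) ξ ∈ osc G (coordAt n u u)) ↔
        principalForm A₀ e (coordAt n u u) ξ = 0 := by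
    intro ξ
    constructor
    · intro hξ
      have h1 : (fun i => polyForm n (e i (coordAt n u u)) (fderiv ℝ A₀ (coordAt n u u) ξ)) =
          0 := by
        funext i
        have hi := hF.smooth_mid i
        have h2 := hξ (e i) ⟨hi, by
          filter_upwards [hF.mid_mem, hW] with x hx hx'
          rw [hx']
          exact hx i⟩
        have h3 := polyForm_fderiv_add (hi.differentiableAt (by simp)) hF.diff_zero
          (hF.gram_mid.mono fun x hx => (polyForm_comm _ _).trans (hx i).1) ξ
        have h4 := mem_perp.1 hB.left_mem _ h2
        rw [polyForm_comm] at h4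
        rw [h4, zero_add] at h3
        exact h3
      rw [principalForm_apply, coframe_apply, h1, Matrix.mulVec_zero]
    · intro hξ T hT
      rw [hF.principalForm_eq_zero_iff hn h] at hξ
      rw [← perp_perp hn (osc G (coordAt n u u)), mem_perp]
      intro Y hY
      have hTm : ∀ᶠ x in 𝓝 (coordAt n u u), T x ∈ osc G x := by
        filter_upwards [hT.2, hW] with x hx hx'
        rwa [hx'] at hx
      have hTd : DifferentiableAt ℝ T (coordAt n u u) := hT.1.differentiableAt (by simp)
      have key : ∀ A : Param n → PolyVec n, DifferentiableAt ℝ A (coordAt n u u) →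
          (∀ᶠ x in 𝓝 (coordAt n u u), A x ∈ perp (osc G x)) →
          polyForm n (fderiv ℝ T (coordAt n u u) ξ) (A (coordAt n u u)) = 0 := by
        intro A hA hAm
        have h3 := polyForm_fderiv_add hTd hA (k := 0) (by
          filter_upwards [hTm, hAm] with x h1 h2
          rw [polyForm_comm]
          exact mem_perp.1 h2 _ h1) ξ
        have h4 := mem_perp.1 (h.fderiv_section_mem_perp hn hA hAm hξ) _ hTm.self_of_nhds
        rw [polyForm_comm] at h4
        rwa [h4, add_zero] at h3
      rw [hB.span_eq] at hY
      obtain ⟨c, d, rfl⟩ := Submodule.mem_span_pair.1 hY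
      rw [map_add, map_smul, map_smul, key A₀ hF.diff_zero (hF.eventually_zero_mem hn h),
        key A₁ hF.diff_one (hF.eventually_one_mem hn h), smul_zero, smul_zero, add_zero]
  have hker : (grassmannKer W u : Submodule ℝ (Param n)) =
      LinearMap.ker (principalForm A₀ e (coordAt n u u)) :=
    Submodule.ext fun ξ => mem_grassmannKer_iff.trans (by rw [hWu]; exact hiff ξ)
  have h1 : Module.finrank ℝ (Param n ⧸ LinearMap.ker (principalForm A₀ e (coordAt n u u))) =
      n - 2 := by
    rw [((principalForm A₀ e (coordAt n u u)).quotKerEquivOfSurjective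
      (hF.principalForm_surjective hn h)).finrank_eq, Module.finrank_fin_fun]
  rw [← h1, ← hker]
  rfl

end SingularPoints

end LightlikeDarboux

namespace LightlikeDarboux

open ConformalSpace Filter

section SweptTangents

variable {n : ℕ} {M : Type*} [TopologicalSpace M]
  [ChartedSpace (EuclideanSpace ℝ (Fin (n - 1))) M]

/-! ### Singular points in the pseudoconformal space -/

theorem sweptTangent_le {L : M → Set (ConformalSpace n)} {u : M} {X : ConformalSpace n}
    {W : Submodule ℝ (Mink n)}
    (h : ∀ S : M → ConformalSpace n, S u = X → ContMDiffAt (𝓡 (n - 1)) 𝓘(ℝ, Mink n) ∞ S u →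
      (∀ᶠ v in 𝓝 u, S v ∈ L v) → ∀ ξ, confDeriv S u ξ ∈ W) : sweptTangent L u X ≤ W := by
  refine iSup₂_le fun S hS => Submodule.span_le.2 ?_
  rintro _ ⟨ξ, rfl⟩
  exact h S hS.1 hS.2.1 hS.2.2 ξ

theorem confDeriv_mem_sweptTangent {L : M → Set (ConformalSpace n)} {u : M}
    {S : M → ConformalSpace n} (hS : ContMDiffAt (𝓡 (n - 1)) 𝓘(ℝ, Mink n) ∞ S u)
    (hL : ∀ᶠ v in 𝓝 u, S v ∈ L v) (ξ : Param n) : confDeriv S u ξ ∈ sweptTangent L u (S u) :=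
  Submodule.mem_iSup_of_mem S (Submodule.mem_iSup_of_mem ⟨rfl, hS, hL⟩
    (Submodule.subset_span ⟨ξ, rfl⟩))

/-- A moving point of `C^n_1` with given homogeneous coordinates. -/
theorem exists_conformal_section {ℓ : M → Submodule ℝ (PolyVec n)}
    (hℓ : ∀ v, ∀ X ∈ ℓ v, polyForm n X X = 0) {u : M} {X : ConformalSpace n}
    {T : Param n → PolyVec n} (hT : IsCoordSection ℓ u T) (h0 : T (coordAt n u u) ≠ 0)
    (hX : T (coordAt n u u) ∈ (darboux X).submodule) :
    ∃ (S : M → ConformalSpace n) (ρ : Param n → ℝ), S u = X ∧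
      ContMDiffAt (𝓡 (n - 1)) 𝓘(ℝ, Mink n) ∞ S u ∧
      (∀ᶠ v in 𝓝 u, S v ∈ darbouxPreimage (ℓ v)) ∧ ContDiffAt ℝ ∞ ρ (coordAt n u u) ∧
      T =ᶠ[𝓝 (coordAt n u u)] fun x => ρ x • localLift S u x := by
  have hsrc := mem_chartIndex_source X
  set c := chartIndex X with hc
  set x₀ := coordAt n u u with hx₀
  -- Divided by its weight in the chart at `X`, the isotropic vector `T` becomes the lift of a point
  -- of `C^n_1` with coordinates `y`; the weight is then the factor `ρ` relating `T` to this lift.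
  set ρ : Param n → ℝ := fun x => chartWeight c (T x) with hρdef
  set y : Param n → Mink n := fun x => (ρ x)⁻¹ • chartVec c (T x) with hydef
  have hρ : ContDiffAt ℝ ∞ ρ x₀ :=
    (chartWeight c).toContinuousLinearMap.contDiff.contDiffAt.comp x₀ hT.1
  have hρ0 : ρ x₀ ≠ 0 := (chartWeight_ne_zero_iff c X h0 hX).2 hsrc
  have hy : ContDiffAt ℝ ∞ y x₀ := (hρ.inv hρ0).smul
    ((chartVec c).toContinuousLinearMap.contDiff.contDiffAt.comp x₀ hT.1)
  have hρev : ∀ᶠ x in 𝓝 x₀, ρ x ≠ 0 := hρ.continuousAt.eventually_ne hρ0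
  have hiso : ∀ᶠ x in 𝓝 x₀, polyForm n (T x) (T x) = 0 := hT.2.mono fun x hx => hℓ _ _ hx
  have hlift : ∀ᶠ x in 𝓝 x₀, chartLift c (y x) = (ρ x)⁻¹ • T x := by
    filter_upwards [hρev, hiso] with x h1 h2
    exact chartLift_inv_smul h2 h1
  set S : M → ConformalSpace n := fun v => (chartOf c).symm (y (coordAt n u v)) with hSdef
  have htgt : ∀ z, z ∈ (chartOf c).target := fun z => by
    have := chartAt_target X
    exact this.ge (Set.mem_univ z)
  have hSu : S u = X := by
    have h1 : y x₀ = chartOf c X := by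
      have h2 : T x₀ ∈ Submodule.span ℝ {chartLift c (chartOf c X)} := by
        rwa [← submodule_darboux hsrc]
      obtain ⟨r, hr⟩ := Submodule.mem_span_singleton.1 h2
      have h3 : ρ x₀ = r := by
        simp only [hρdef, ← hr, map_smul, chartWeight_lift, smul_eq_mul, mul_one]
      simp only [hydef]
      rw [h3, ← hr, map_smul, chartVec_lift, smul_smul, inv_mul_cancel₀ (h3 ▸ hρ0), one_smul]
    simp only [hSdef]
    rw [← hx₀, h1, (chartOf c).left_inv hsrc]
  have hsub : ∀ᶠ x in 𝓝 x₀, (darboux ((chartOf c).symm (y x))).submodule =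
      Submodule.span ℝ {T x} := by
    filter_upwards [hρev, hiso] with x h1 h2
    exact submodule_darboux_chart_symm h2 h1
  have hSs : ContMDiffAt (𝓡 (n - 1)) 𝓘(ℝ, Mink n) ∞ S u := by
    have h1 : ContMDiffAt 𝓘(ℝ, Mink n) 𝓘(ℝ, Mink n) ∞ (extChartAt 𝓘(ℝ, Mink n) X).symm (y x₀) :=
      (contMDiffOn_extChartAt_symm X).contMDiffAt
        (extChartAt_target_mem_nhds' (by
          rw [extChartAt_target]
          exact ⟨htgt _, Set.mem_range_self _⟩))
    exact h1.comp u (contMDiffAt_of_coord hy)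
  refine ⟨S, ρ, hSu, hSs, ?_, hρ, ?_⟩
  · refine eventually_of_coord_symm (n := n) ?_
    filter_upwards [hsub, hT.2, eventually_coord_right_inv (n := n) u] with x h1 h2 h3
    change (darboux ((chartOf c).symm (y (coordAt n u ((coordAt n u).symm x))))).submodule ≤ _
    rw [h3, h1, Submodule.span_singleton_le_iff_mem]
    exact h2
  · filter_upwards [hlift, hρev, eventually_coord_right_inv (n := n) u] with x h1 h2 h3
    have h4 : localLift S u x = chartLift c (y x) := by
      change chartLift (chartIndex (S u)) (chartOf (chartIndex (S u))
        ((chartOf c).symm (y (coordAt n u ((coordAt n u).symm x))))) = _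
      rw [hSu, h3, ← hc, (chartOf c).right_inv (htgt _)]
    rw [h4, h1, smul_smul, mul_inv_cancel₀ h2, one_smul]

/-- The differential of the lift at a point of `C^n_1`. -/
noncomputable def liftDeriv (X : ConformalSpace n) : Mink n →ₗ[ℝ] PolyVec n :=
  (fderiv ℝ (chartLift (chartIndex X)) (chartOf (chartIndex X) X) : Mink n →ₗ[ℝ] PolyVec n)

theorem liftDeriv_apply (X : ConformalSpace n) (η : Mink n) :
    liftDeriv X η = fderiv ℝ (chartLift (chartIndex X)) (chartOf (chartIndex X) X) η := rfl

theorem submodule_darboux_chartIndex (X : ConformalSpace n) : (darboux X).submodule =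
    Submodule.span ℝ {chartLift (chartIndex X) (chartOf (chartIndex X) X)} :=
  submodule_darboux (mem_chartIndex_source X)

/-- The tangent subspaces of the swept varieties correspond under the Darboux mapping. -/
theorem projSweptTangent_eq_map {ℓ : M → Submodule ℝ (PolyVec n)}
    (hℓ : ∀ v, ∀ X ∈ ℓ v, polyForm n X X = 0) {u : M} {X : ConformalSpace n}
    (hX : (darboux X).submodule ≤ projSweptTangent ℓ u (darboux X)) :
    projSweptTangent ℓ u (darboux X) = (darboux X).submodule ⊔
      (sweptTangent (fun v => darbouxPreimage (ℓ v)) u X).map (liftDeriv X) := by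
  apply le_antisymm
  · refine projSweptTangent_le fun T hT h0 hP ξ => ?_
    obtain ⟨S, ρ, rfl, hS, hL, hρ, heq⟩ := exists_conformal_section hℓ hT h0 hP
    rw [heq.fderiv_eq, fderiv_smul_apply (hρ.differentiableAt (by simp))
      ((contDiffAt_localLift hS).differentiableAt (by simp)), add_comm]
    refine Submodule.add_mem_sup (Submodule.smul_mem _ _ ?_) (Submodule.smul_mem _ _ ?_)
    · rw [submodule_darboux_chartIndex, localLift_self]
      exact Submodule.mem_span_singleton_self _
    · rw [fderiv_localLift hS]
      exact Submodule.mem_map_of_mem (confDeriv_mem_sweptTangent hS hL ξ)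
  · refine sup_le hX (Submodule.map_le_iff_le_comap.2 (sweptTangent_le ?_))
    rintro S rfl hS hL ξ
    rw [Submodule.mem_comap, liftDeriv_apply, ← fderiv_localLift hS]
    have hsub := eventually_submodule_localLift hS.continuousAt
    refine fderiv_mem_projSweptTangent ⟨contDiffAt_localLift hS, ?_⟩ (localLift_ne_zero S u _) ?_ ξ
    · filter_upwards [hsub, eventually_coord (n := n) hL] with x h1 h2
      have h3 : (darboux (S ((coordAt n u).symm x))).submodule ≤ ℓ ((coordAt n u).symm x) := h2
      rw [h1] at h3
      exact (Submodule.span_singleton_le_iff_mem _ _).1 h3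
    · rw [submodule_darboux_chartIndex, localLift_self]
      exact Submodule.mem_span_singleton_self _

/-- The sum is direct because the lift of the point has weight one and differentials of the lift
have weight zero. The lift differential is injective, so exactly one dimension is added. -/
theorem finrank_projSweptTangent {ℓ : M → Submodule ℝ (PolyVec n)}
    (hℓ : ∀ v, ∀ X ∈ ℓ v, polyForm n X X = 0) {u : M} {X : ConformalSpace n}
    (hX : (darboux X).submodule ≤ projSweptTangent ℓ u (darboux X)) :
    Module.finrank ℝ (projSweptTangent ℓ u (darboux X)) =
      1 + Module.finrank ℝ (sweptTangent (fun v => darbouxPreimage (ℓ v)) u X) := by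
  rw [projSweptTangent_eq_map hℓ hX]
  have hinj : Function.Injective (liftDeriv X) := fun η η' h => by
    have := congrArg (chartVec (chartIndex X)) h
    rwa [liftDeriv_apply, liftDeriv_apply, chartVec_fderiv_lift, chartVec_fderiv_lift] at this
  set W := sweptTangent (fun v => darbouxPreimage (ℓ v)) u X
  have hdisj : (darboux X).submodule ⊓ W.map (liftDeriv X) = ⊥ := by
    rw [eq_bot_iff]
    rintro Y ⟨h1, η, -, h2⟩
    rw [SetLike.mem_coe, submodule_darboux_chartIndex] at h1
    obtain ⟨r, rfl⟩ := Submodule.mem_span_singleton.1 h1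
    have h3 := congrArg (chartWeight (chartIndex X)) h2
    rw [liftDeriv_apply, chartWeight_fderiv_lift, map_smul, chartWeight_lift, smul_eq_mul,
      mul_one] at h3
    rw [← h3, zero_smul]
    exact Submodule.zero_mem _
  have hdim := Submodule.finrank_sup_add_finrank_inf_eq (darboux X).submodule (W.map (liftDeriv X))
  rw [hdisj, finrank_bot, add_zero, Projectivization.finrank_submodule,
    ← (Submodule.equivMapOfInjective _ hinj W).finrank_eq] at hdim
  exact hdim

/-- The additional dimension matches the bounds: less than `n - 1` in the conformal space against
less than `n` for vector subspaces. -/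
theorem image_isSingularPoint (hn : 3 ≤ n) {ℓ : M → Submodule ℝ (PolyVec n)}
    (hℓ : ∀ v, ∀ X ∈ ℓ v, polyForm n X X = 0) {u : M}
    (hle : ∀ P : ProjSpace n, P.submodule ≤ ℓ u → P.submodule ≤ projSweptTangent ℓ u P) :
    darboux '' {X | IsSingularPoint (fun v => darbouxPreimage (ℓ v)) u X} =
      {P | IsProjSingularPoint ℓ u P} := by
  have key : ∀ X, IsSingularPoint (fun v => darbouxPreimage (ℓ v)) u X ↔
      IsProjSingularPoint ℓ u (darboux X) := by
    intro X
    refine and_congr_right fun hX => ?_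
    rw [finrank_projSweptTangent hℓ (hle _ hX)]
    omega
  ext P
  constructor
  · rintro ⟨X, hX, rfl⟩
    exact (key X).1 hX
  · intro hP
    obtain ⟨X, -, rfl⟩ : P ∈ darboux '' darbouxPreimage (ℓ u) := by
      rw [image_darbouxPreimage (hℓ u)]
      exact hP.1
    exact ⟨X, (key X).2 hP, rfl⟩

end SweptTangents

section FrameTransfer

variable {n : ℕ} {M : Type*} [TopologicalSpace M]
  [ChartedSpace (EuclideanSpace ℝ (Fin (n - 1))) M]
  {f : M → ConformalSpace n} {u : M}

/-! ### Adapted frames along the hypersurface -/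

theorem isAffinor_iff (hn : 3 ≤ n) {ℓ : Submodule ℝ (PolyVec n)} {A₀ A₁ : M → PolyVec n}
    {e : Fin (n - 2) → M → PolyVec n}
    (hB : IsPerpBasis ℓ (A₀ u) (A₁ u) fun i => e i u)
    (h₀ : ContMDiffAt (𝓡 (n - 1)) 𝓘(ℝ, PolyVec n) ∞ A₀ u)
    (h₁ : ContMDiffAt (𝓡 (n - 1)) 𝓘(ℝ, PolyVec n) ∞ A₁ u)
    (hd₀ : ∀ ξ, fderiv ℝ (A₀ ∘ (coordAt n u).symm) (coordAt n u u) ξ ∈ perp ℓ)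
    (hd₁ : ∀ ξ, fderiv ℝ (A₁ ∘ (coordAt n u).symm) (coordAt n u u) ξ ∈ perp ℓ)
    (Λ : Matrix (Fin (n - 2)) (Fin (n - 2)) ℝ) :
    IsAffinor u A₀ A₁ e Λ ↔ ∀ ξ,
      coframe (fun i => e i u) (fderiv ℝ (A₁ ∘ (coordAt n u).symm) (coordAt n u u) ξ) =
        Λ.mulVec (coframe (fun i => e i u)
          (fderiv ℝ (A₀ ∘ (coordAt n u).symm) (coordAt n u u) ξ)) := by
  constructor
  · intro h ξ
    obtain ⟨p₀, p₁, q₀, q₁, θ, h1, h2⟩ := h ξ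
    rw [← (mfderiv_coord h₁ ξ).symm.trans h2 |>.symm, ← (mfderiv_coord h₀ ξ).symm.trans h1 |>.symm,
      hB.coframe_repr hn, hB.coframe_repr hn]
  · intro h ξ
    obtain ⟨p₀, p₁, hp⟩ := hB.exists_repr hn (hd₀ ξ)
    obtain ⟨q₀, q₁, hq⟩ := hB.exists_repr hn (hd₁ ξ)
    rw [h ξ] at hq
    exact ⟨p₀, p₁, q₀, q₁, _, (mfderiv_coord h₀ ξ).trans hp, (mfderiv_coord h₁ ξ).trans hq⟩

variable [IsManifold (𝓡 (n - 1)) ∞ M]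

theorem IsAdaptedFrame.coord (hn : 3 ≤ n) (hf : IsLightlikeHypersurface f)
    {A₀ A₁ : M → PolyVec n} {e : Fin (n - 2) → M → PolyVec n} {Aₙ Aₙ₁ : M → PolyVec n}
    (hA : IsAdaptedFrame (darboux ∘ f) u A₀ A₁ e Aₙ Aₙ₁) :
    IsCoordFrame (localLift f u) (coordAt n u u) (A₀ ∘ (coordAt n u).symm)
      (A₁ ∘ (coordAt n u).symm) (fun i => e i ∘ (coordAt n u).symm) (Aₙ ∘ (coordAt n u).symm)
      (Aₙ₁ ∘ (coordAt n u).symm) where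
  smooth_zero := contDiffAt_coord hA.smooth_zero
  smooth_one := contDiffAt_coord hA.smooth_one
  smooth_mid i := contDiffAt_coord (hA.smooth_mid i)
  smooth_n := contDiffAt_coord hA.smooth_n
  smooth_n_one := contDiffAt_coord hA.smooth_n_one
  point_eq := by
    filter_upwards [eventually_coord (n := n) hA.point_eq,
      eventually_submodule_localLift (hf.smooth u).continuousAt] with x h1 h2
    exact h2.symm.trans h1
  one_mem := by
    filter_upwards [eventually_coord (n := n) hA.one_mem, hf.eventually_tangentPlane_eq hn u] with
      x h1 h2
    exact h2 ▸ h1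
  mid_mem := by
    filter_upwards [eventually_coord (n := n) hA.mid_mem, hf.eventually_tangentPlane_eq hn u] with
      x h1 h2
    exact h2 ▸ h1
  mid_indep := eventually_coord (n := n) hA.mid_indep
  gram_isotropic := eventually_coord (n := n) hA.gram_isotropic
  gram_normal := eventually_coord (n := n) hA.gram_normal
  gram_orthogonal := eventually_coord (n := n) hA.gram_orthogonal
  gram_mid := eventually_coord (n := n) hA.gram_mid

theorem IsCoordFrame.isAdaptedFrame (hn : 3 ≤ n) (hf : IsLightlikeHypersurface f)
    {A₀ A₁ : Param n → PolyVec n} {e : Fin (n - 2) → Param n → PolyVec n}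
    {Aₙ Aₙ₁ : Param n → PolyVec n}
    (hA : IsCoordFrame (localLift f u) (coordAt n u u) A₀ A₁ e Aₙ Aₙ₁) :
    IsAdaptedFrame (darboux ∘ f) u (A₀ ∘ coordAt n u) (A₁ ∘ coordAt n u)
      (fun i => e i ∘ coordAt n u) (Aₙ ∘ coordAt n u) (Aₙ₁ ∘ coordAt n u) where
  smooth_zero := contMDiffAt_of_coord hA.smooth_zero
  smooth_one := contMDiffAt_of_coord hA.smooth_one
  smooth_mid i := contMDiffAt_of_coord (hA.smooth_mid i)
  smooth_n := contMDiffAt_of_coord hA.smooth_n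
  smooth_n_one := contMDiffAt_of_coord hA.smooth_n_one
  point_eq := by
    filter_upwards [eventually_of_coord hA.point_eq, eventually_of_coord
      (eventually_submodule_localLift (hf.smooth u).continuousAt),
      eventually_coord_left_inv (n := n) u] with v h1 h2 h3
    rw [h3] at h2
    exact h2.trans h1
  one_mem := by
    filter_upwards [eventually_of_coord hA.one_mem, eventually_of_coord
      (hf.eventually_tangentPlane_eq hn u), eventually_coord_left_inv (n := n) u] with v h1 h2 h3
    rw [h3] at h2
    exact h2 ▸ h1
  mid_mem := by
    filter_upwards [eventually_of_coord hA.mid_mem, eventually_of_coord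
      (hf.eventually_tangentPlane_eq hn u), eventually_coord_left_inv (n := n) u] with v h1 h2 h3
    rw [h3] at h2
    exact h2 ▸ h1
  mid_indep := eventually_of_coord hA.mid_indep
  gram_isotropic := eventually_of_coord hA.gram_isotropic
  gram_normal := eventually_of_coord hA.gram_normal
  gram_orthogonal := eventually_of_coord hA.gram_orthogonal
  gram_mid := eventually_of_coord hA.gram_mid

end FrameTransfer

end LightlikeDarboux

namespace LightlikeDarboux

open ConformalSpace Filter

section Curves

variable {n : ℕ} {M : Type*} [TopologicalSpace M]
  [ChartedSpace (EuclideanSpace ℝ (Fin (n - 1))) M]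

/-! ### Curves -/

/-- The subspace is cut out by the linear functionals given by products with its orthogonal
complement, and each of them can be differentiated along the curve. -/
theorem HasDerivAt.mem_submodule (hn : 3 ≤ n) {c : ℝ → PolyVec n} {c' : PolyVec n} {t : ℝ}
    (hc : HasDerivAt c c' t) {W : Submodule ℝ (PolyVec n)} (hW : ∀ᶠ s in 𝓝 t, c s ∈ W) :
    c' ∈ W := by
  rw [← perp_perp hn W, mem_perp]
  intro Y hY
  have h1 : HasDerivAt (fun s => polyFormL n Y (c s)) (polyFormL n Y c') t :=
    (polyFormL n Y).hasFDerivAt.comp_hasDerivAt t hc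
  have h2 : HasDerivAt (fun s => polyFormL n Y (c s)) 0 t :=
    (hasDerivAt_const t (0 : ℝ)).congr_of_eventuallyEq
      (hW.mono fun s hs => mem_perp.1 hY _ hs)
  rw [polyForm_comm]
  exact h1.unique h2

/-- The velocity in coordinates of a curve. -/
theorem exists_hasDerivAt_coord {γ : ℝ → M} {ε : ℝ} (hε : 0 < ε)
    (hγ : ContMDiffOn 𝓘(ℝ, ℝ) (𝓡 (n - 1)) ∞ γ (Set.Ioo (-ε) ε)) :
    ∃ v : Param n, HasDerivAt (coordAt n (γ 0) ∘ γ) v 0 ∧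
      (mfderiv 𝓘(ℝ, ℝ) (𝓡 (n - 1)) γ 0 ≠ 0 ↔ v ≠ 0) := by
  have hγ0 : ContMDiffAt 𝓘(ℝ, ℝ) (𝓡 (n - 1)) ∞ γ 0 :=
    hγ.contMDiffAt (Ioo_mem_nhds (by linarith) hε)
  have hs : ContDiffAt ℝ ∞ (coordAt n (γ 0) ∘ γ) 0 :=
    ((contMDiffAt_extChartAt (I := 𝓡 (n - 1)) (x := γ 0)).comp 0 hγ0).contDiffAt
  have hd : DifferentiableAt ℝ (coordAt n (γ 0) ∘ γ) 0 := hs.differentiableAt (by simp)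
  refine ⟨_, hd.hasDerivAt, not_congr ?_⟩
  have h1 : (mfderiv 𝓘(ℝ, ℝ) (𝓡 (n - 1)) γ 0 : ℝ →L[ℝ] Param n) =
      fderiv ℝ (coordAt n (γ 0) ∘ γ) 0 := by
    refine (hγ0.mdifferentiableAt (by simp)).mfderiv.trans ?_
    simp only [ModelWithCorners.range_eq_univ, fderivWithin_univ]
    rfl
  have h2 : (mfderiv 𝓘(ℝ, ℝ) (𝓡 (n - 1)) γ 0 : ℝ →L[ℝ] Param n) = 0 ↔
      deriv (coordAt n (γ 0) ∘ γ) 0 = 0 := by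
    rw [h1, ← fderiv_apply_one_eq_deriv]
    constructor
    · intro h
      rw [h]
      rfl
    · intro h
      ext1
      exact h
  exact h2

theorem contMDiffOn_coord_symm [IsManifold (𝓡 (n - 1)) ∞ M] {u : M} {γ : ℝ → Param n} {s : Set ℝ}
    (hγ : ContDiffOn ℝ ∞ γ s) (hs : ∀ t ∈ s, γ t ∈ (coordAt n u).target) :
    ContMDiffOn 𝓘(ℝ, ℝ) (𝓡 (n - 1)) ∞ ((coordAt n u).symm ∘ γ) s :=
  (contMDiffOn_extChartAt_symm u).comp hγ.contMDiffOn hs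

end Curves

section Rulings

variable {n : ℕ} {M : Type*} [TopologicalSpace M]
  [ChartedSpace (EuclideanSpace ℝ (Fin (n - 1))) M] {f : M → ConformalSpace n}

/-! ### Rulings and isotropic generators -/

/-- The ruling through the point with parameter `u`. -/
noncomputable def rulingLine (f : M → ConformalSpace n) (u : M) : Submodule ℝ (PolyVec n) :=
  perp (tangentPlane (darboux ∘ f) u)

theorem perp_rulingLine (hn : 3 ≤ n) (f : M → ConformalSpace n) (u : M) :
    perp (rulingLine f u) = tangentPlane (darboux ∘ f) u := perp_perp hn _

namespace IsLightlikeHypersurface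

theorem rulingLine_eq (hn : 3 ≤ n) (hf : IsLightlikeHypersurface f) (u : M) :
    rulingLine f u = perp (osc (localLift f u) (coordAt n u u)) := by
  rw [rulingLine, hf.tangentPlane_eq hn]

/-- An isotropic line through the point, tangent to the hypersurface, is the ruling. -/
theorem eq_rulingLine (hn : 3 ≤ n) (hf : IsLightlikeHypersurface f) {u : M}
    (hpl : IsIsotropicPlane (rulingLine f u)) {ℓ' : Submodule ℝ (PolyVec n)}
    (hℓ' : IsIsotropicPlane ℓ') (h : ℓ' ≤ osc (localLift f u) (coordAt n u u)) :
    ℓ' = rulingLine f u :=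
  hpl.eq_of_le_perp hn hℓ' (by rwa [perp_rulingLine hn, hf.tangentPlane_eq hn])

theorem isProjImmersion (hn : 3 ≤ n) (hf : IsLightlikeHypersurface f) :
    IsProjImmersion (darboux ∘ f) := by
  intro u
  refine ⟨⟨homLift f u, ⟨contMDiffAt_homLift (hf.smooth u) (mem_chartIndex_source _), ?_⟩,
    chartLift_ne_zero _ _⟩, ?_⟩
  · filter_upwards [eventually_mem_source (hf.smooth u).continuousAt] with v hv
    change homLift f u v ∈ (darboux (f v)).submodule
    rw [submodule_darboux_homLift hv]
    exact Submodule.mem_span_singleton_self _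
  · rw [hf.tangentPlane_eq hn]
    exact (hf.isLightlikeAt u).finrank_osc hn

theorem hasDerivAt_localLift_comp (hf : IsLightlikeHypersurface f) {u : M} {c : ℝ → Param n}
    {v : Param n} (hc : HasDerivAt c v 0) (h0 : c 0 = coordAt n u u) :
    HasDerivAt (localLift f u ∘ c) (fderiv ℝ (localLift f u) (coordAt n u u) v) 0 :=
  ((hf.isLightlikeAt u).differentiableAt.hasFDerivAt).comp_hasDerivAt_of_eq 0 hc
    h0.symm

theorem eventually_curve (hf : IsLightlikeHypersurface f) {γ : ℝ → M}
    (hγ : ContinuousAt γ 0) : ∀ᶠ t in 𝓝 (0 : ℝ), (darboux (f (γ t))).submodule =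
      Submodule.span ℝ {localLift f (γ 0) (coordAt n (γ 0) (γ t))} := by
  have h1 := eventually_of_coord (eventually_submodule_localLift (hf.smooth (γ 0)).continuousAt)
  filter_upwards [hγ.eventually h1, hγ.eventually (eventually_coord_left_inv (n := n) (γ 0))] with
    t h2 h3
  rwa [h3] at h2

variable [IsManifold (𝓡 (n - 1)) ∞ M]

theorem isIsotropicPlane_rulingLine (hn : 3 ≤ n) (hf : IsLightlikeHypersurface f) (u : M) :
    IsIsotropicPlane (rulingLine f u) := by
  rw [hf.rulingLine_eq hn]
  exact (hf.isLightlikeLift u).isIsotropicPlane hn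

theorem eventually_rulingLine_eq (hn : 3 ≤ n) (hf : IsLightlikeHypersurface f) (u : M) :
    ∀ᶠ x in 𝓝 (coordAt n u u),
      rulingLine f ((coordAt n u).symm x) = perp (osc (localLift f u) x) :=
  (hf.eventually_tangentPlane_eq hn u).mono fun x hx => by rw [rulingLine, hx]

/-- A smooth curve of the hypersurface that runs through an open segment of the ruling. -/
theorem exists_ruling_curve (hn : 3 ≤ n) (hf : IsLightlikeHypersurface f) (u : M) :
    ∃ (a w : PolyVec n) (γ : ℝ → M) (ε : ℝ), rulingLine f u = Submodule.span ℝ {a, w} ∧ 0 < ε ∧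
      γ 0 = u ∧ ContMDiffOn 𝓘(ℝ, ℝ) (𝓡 (n - 1)) ∞ γ (Set.Ioo (-ε) ε) ∧
      mfderiv 𝓘(ℝ, ℝ) (𝓡 (n - 1)) γ 0 ≠ 0 ∧
      ∀ t ∈ Set.Ioo (-ε) ε, (darboux (f (γ t))).submodule = Submodule.span ℝ {a + t • w} := by
  obtain ⟨a, w, c, ε, -, hspan, hε, h0, hc, hc0, hct, -⟩ :=
    (hf.isLightlikeLift u).exists_ruling hn
      (inter_mem (extChartAt_target_mem_nhds (I := 𝓡 (n - 1)) u)
        (eventually_submodule_localLift (hf.smooth u).continuousAt))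
  set γ := (coordAt n u).symm ∘ c with hγdef
  have hγ0 : γ 0 = u := by
    simp only [hγdef, Function.comp_apply, h0, extChartAt_to_inv]
  have hγ : ContMDiffOn 𝓘(ℝ, ℝ) (𝓡 (n - 1)) ∞ γ (Set.Ioo (-ε) ε) :=
    contMDiffOn_coord_symm hc fun t ht => (hct t ht).1.1
  refine ⟨a, w, γ, ε, by rw [hf.rulingLine_eq hn, hspan], hε, hγ0, hγ, ?_, fun t ht => ?_⟩
  · obtain ⟨v, hv, hiff⟩ := exists_hasDerivAt_coord hε hγ
    rw [hiff]
    rw [hγ0] at hv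
    have heq : coordAt n u ∘ γ =ᶠ[𝓝 0] c := by
      filter_upwards [Ioo_mem_nhds (by linarith : -ε < 0) hε] with t ht
      exact (coordAt n u).right_inv (hct t ht).1.1
    rwa [← hv.deriv, heq.deriv_eq]
  · exact (hct t ht).1.2.trans (hct t ht).2.1

theorem isRuling_rulingLine (hn : 3 ≤ n) (hf : IsLightlikeHypersurface f) (u : M) :
    IsRuling (darboux ∘ f) u (rulingLine f u) := by
  obtain ⟨a, w, γ, ε, h1, h2, h3, h4, -, h5⟩ := hf.exists_ruling_curve hn u
  exact ⟨(hf.isIsotropicPlane_rulingLine hn u).finrank_eq, a, w, γ, ε, h1, h2, h3, h4, h5⟩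

theorem isIsotropicGenerator_rulingLine (hn : 3 ≤ n) (hf : IsLightlikeHypersurface f) (u : M) :
    IsIsotropicGenerator f u (darbouxPreimage (rulingLine f u)) := by
  obtain ⟨a, w, γ, ε, h1, h2, h3, h4, h5, h6⟩ := hf.exists_ruling_curve hn u
  refine ⟨(hf.isIsotropicPlane_rulingLine hn u).isIsotropicLine hn, γ, ε, h2, h3, h4, h5,
    fun t ht => ?_⟩
  change (darboux (f (γ t))).submodule ≤ _
  rw [h6 t ht, h1, Submodule.span_singleton_le_iff_mem]
  exact Submodule.add_mem _ (Submodule.subset_span (by simp))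
    (Submodule.smul_mem _ _ (Submodule.subset_span (by simp)))

/-- The lifted curve stays in the plane of the given line, so its position and its nonzero velocity,
independent by immersivity, span that plane. It is thus an isotropic plane inside the tangent
subspace, and there is only one. -/
theorem eq_of_isIsotropicGenerator (hn : 3 ≤ n) (hf : IsLightlikeHypersurface f) {u : M}
    {L' : Set (ConformalSpace n)} (hL : IsIsotropicGenerator f u L') :
    L' = darbouxPreimage (rulingLine f u) := by
  obtain ⟨hline, γ, ε, hε, rfl, hγ, hγ', hmem⟩ := hL
  obtain ⟨ℓ', hℓ', rfl⟩ := hline.exists_plane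
  obtain ⟨v, hv, hiff⟩ := exists_hasDerivAt_coord hε hγ
  have hv0 : v ≠ 0 := hiff.1 hγ'
  have hnhds : Set.Ioo (-ε) ε ∈ 𝓝 (0 : ℝ) := Ioo_mem_nhds (by linarith) hε
  have hc : ContinuousAt γ 0 := (hγ.contMDiffAt hnhds).continuousAt
  have hev : ∀ᶠ t in 𝓝 (0 : ℝ), localLift f (γ 0) (coordAt n (γ 0) (γ t)) ∈ ℓ' := by
    filter_upwards [hf.eventually_curve hc, hnhds] with t h1 h2
    have h3 : (darboux (f (γ t))).submodule ≤ ℓ' := hmem t h2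
    rwa [h1, Submodule.span_singleton_le_iff_mem] at h3
  have hder := HasDerivAt.mem_submodule hn (hf.hasDerivAt_localLift_comp hv rfl) hev
  have hlift := hf.isLightlikeAt (γ 0)
  have hind : LinearIndependent ℝ ![localLift f (γ 0) (coordAt n (γ 0) (γ 0)),
      fderiv ℝ (localLift f (γ 0)) (coordAt n (γ 0) (γ 0)) v] := by
    rw [LinearIndependent.pair_iff' hlift.ne_zero]
    exact fun a ha => hv0 (hlift.immersive v a ha.symm)
  congr 1
  refine hf.eq_rulingLine hn (hf.isIsotropicPlane_rulingLine hn _) hℓ' ?_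
  rw [hℓ'.eq_span hind hev.self_of_nhds hder, Submodule.span_le]
  rintro _ (rfl | rfl)
  · exact self_mem_osc _ _
  · exact fderiv_mem_osc _ _ _

/-- A line with a segment on the quadric is isotropic, and differentiating its parametrization
places it in the tangent subspace. Uniqueness of isotropic planes there concludes, and no condition
on the velocity of the curve is required. -/
theorem eq_of_isRuling (hn : 3 ≤ n) (hf : IsLightlikeHypersurface f) {u : M}
    {ℓ' : Submodule ℝ (PolyVec n)} (hℓ : IsRuling (darboux ∘ f) u ℓ') : ℓ' = rulingLine f u := by
  obtain ⟨hfin, a, w, γ, ε, rfl, hε, rfl, hγ, hmem⟩ := hℓ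
  obtain ⟨v, hv, -⟩ := exists_hasDerivAt_coord hε hγ
  have hnhds : Set.Ioo (-ε) ε ∈ 𝓝 (0 : ℝ) := Ioo_mem_nhds (by linarith) hε
  have hc : ContinuousAt γ 0 := (hγ.contMDiffAt hnhds).continuousAt
  set G := localLift f (γ 0) with hG
  set x₀ := coordAt n (γ 0) (γ 0) with hx₀
  set κ := chartWeight (chartIndex (f (γ 0))) with hκ
  have hκG : ∀ x, κ (G x) = 1 := fun x => chartWeight_lift _ _
  -- The lift has weight one, so the weight of `a + t w` is the proportionality factor. It is linear
  -- in `w`, and the product can be differentiated.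
  have hev : ∀ᶠ t in 𝓝 (0 : ℝ), a + t • w = κ (a + t • w) • G (coordAt n (γ 0) (γ t)) := by
    filter_upwards [hf.eventually_curve hc, hnhds] with t h1 h2
    have h3 : a + t • w ∈ Submodule.span ℝ {G (coordAt n (γ 0) (γ t))} := by
      rw [← h1]
      exact (hmem t h2).ge (Submodule.mem_span_singleton_self _)
    obtain ⟨r, hr⟩ := Submodule.mem_span_singleton.1 h3
    rw [← hr, map_smul, hκG, smul_eq_mul, mul_one]
  have ha : a = κ a • G x₀ := by
    have := hev.self_of_nhds
    rwa [zero_smul, add_zero] at this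
  have hline : HasDerivAt (fun t : ℝ => a + t • w) w 0 := by
    simpa using ((hasDerivAt_id (0 : ℝ)).smul_const w).const_add a
  have hs : HasDerivAt (fun t : ℝ => κ (a + t • w)) (κ w) 0 :=
    κ.toContinuousLinearMap.hasFDerivAt.comp_hasDerivAt 0 hline
  have hprod := (hs.smul (hf.hasDerivAt_localLift_comp hv rfl)).congr_of_eventuallyEq hev
  have hw := hline.unique hprod
  have hiso : ∀ t ∈ Set.Ioo (-ε) ε, polyForm n (a + t • w) (a + t • w) = 0 := by
    intro t ht
    have h1 : a + t • w ∈ (darboux (f (γ t))).submodule :=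
      (hmem t ht).ge (Submodule.mem_span_singleton_self _)
    exact polyForm_of_mem_darboux _ h1 h1
  have hexp : ∀ t : ℝ, polyForm n (a + t • w) (a + t • w) =
      polyForm n a a + 2 * t * polyForm n a w + t ^ 2 * polyForm n w w := by
    intro t
    simp only [map_add, map_smul, LinearMap.add_apply, LinearMap.smul_apply, smul_eq_mul,
      polyForm_comm w a]
    ring
  -- The square of `a + t w` is a quadratic polynomial in `t`; its vanishing at `0` and `±ε/2` kills
  -- all three coefficients.
  have h0 := hiso 0 ⟨by linarith, hε⟩
  have h1 := hiso (ε / 2) ⟨by linarith, by linarith⟩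
  have h2 := hiso (-(ε / 2)) ⟨by linarith, by linarith⟩
  rw [hexp] at h0 h1 h2
  have haa : polyForm n a a = 0 := by simpa using h0
  have haw : polyForm n a w = 0 := by
    have : ε * polyForm n a w = 0 := by linarith
    exact (mul_eq_zero.1 this).resolve_left hε.ne'
  have hww : polyForm n w w = 0 := by
    rw [haa, haw] at h1
    have : (ε / 2) ^ 2 * polyForm n w w = 0 := by linarith
    exact (mul_eq_zero.1 this).resolve_left (by positivity)
  have hpl : IsIsotropicPlane (Submodule.span ℝ {a, w}) := by
    refine ⟨hfin, fun X hX Y hY => ?_⟩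
    obtain ⟨p, q, rfl⟩ := Submodule.mem_span_pair.1 hX
    obtain ⟨r, s, rfl⟩ := Submodule.mem_span_pair.1 hY
    simp [haa, haw, hww, polyForm_comm w a]
  refine hf.eq_rulingLine hn (hf.isIsotropicPlane_rulingLine hn _) hpl ?_
  rw [Submodule.span_le]
  rintro _ (rfl | rfl)
  · rw [ha]
    exact Submodule.smul_mem _ _ (self_mem_osc _ _)
  · rw [hw]
    exact Submodule.add_mem _ (Submodule.smul_mem _ _ (fderiv_mem_osc _ _ _))
      (Submodule.smul_mem _ _ (self_mem_osc _ _))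

/-! ### Constancy along the rulings -/

/-- Among parameters of points on the line of `u`, having the tangent subspace of `u` is an open and
closed condition. Where it holds, nearby points on the line belong to the same ruling; where it
fails, continuity of the planes keeps it failing. -/
theorem eventually_tangentPlane_eq_iff (hn : 3 ≤ n) (hf : IsLightlikeHypersurface f) (u v : M) :
    ∀ᶠ v' in 𝓝 v, (darboux (f v')).submodule ≤ rulingLine f u →
      (tangentPlane (darboux ∘ f) v = tangentPlane (darboux ∘ f) u ↔
        tangentPlane (darboux ∘ f) v' = tangentPlane (darboux ∘ f) u) := by
  have hinj : ∀ W W' : Submodule ℝ (PolyVec n), perp W = perp W' → W = W' := fun W W' h => by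
    rw [← perp_perp hn W, h, perp_perp hn]
  have hlift := hf.isLightlikeLift v
  refine eventually_of_coord_symm (n := n) ?_
  by_cases h : tangentPlane (darboux ∘ f) v = tangentPlane (darboux ∘ f) u
  · filter_upwards [hlift.eventually_osc_eq hn, hf.eventually_tangentPlane_eq hn v,
      eventually_submodule_localLift (hf.smooth v).continuousAt] with x h1 h2 h3 h4
    refine ⟨fun _ => ?_, fun _ => h⟩
    rw [h3, rulingLine, ← h, hf.tangentPlane_eq hn, Submodule.span_singleton_le_iff_mem] at h4
    rw [h2, h1 h4, ← hf.tangentPlane_eq hn, h]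
  · have hne : perp (osc (localLift f v) (coordAt n v v)) ≠ rulingLine f u := fun h1 =>
      h (by rw [hf.tangentPlane_eq hn v]; exact hinj _ _ h1)
    filter_upwards [hlift.eventually_osc_ne hn hne, hf.eventually_tangentPlane_eq hn v] with
      x h1 h2 _
    refine ⟨fun h3 => absurd h3 h, fun h3 => absurd ?_ h1⟩
    rw [← h2, h3]
    rfl

/-- A locally constant property is constant on a preconnected set; the property is equality with the
tangent subspace at `u`. -/
theorem tangentPlane_eq_of_mem_component (hn : 3 ≤ n) (hf : IsLightlikeHypersurface f) {u u' : M}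
    (hu' : u' ∈ connectedComponentIn {v | (darboux (f v)).submodule ≤ rulingLine f u} u) :
    tangentPlane (darboux ∘ f) u' = tangentPlane (darboux ∘ f) u := by
  set S := {v | (darboux (f v)).submodule ≤ rulingLine f u}
  have hu : u ∈ connectedComponentIn S u :=
    mem_connectedComponentIn (connectedComponentIn_nonempty_iff.1 ⟨u', hu'⟩)
  have key := isPreconnected_connectedComponentIn.induction₂'
    (fun v v' => (tangentPlane (darboux ∘ f) v = tangentPlane (darboux ∘ f) u ↔
      tangentPlane (darboux ∘ f) v' = tangentPlane (darboux ∘ f) u))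
    (s := connectedComponentIn S u) (fun v _ => ?_) (fun _ _ _ _ _ _ h1 h2 => h1.trans h2) hu hu'
  · exact key.1 rfl
  · filter_upwards [mem_nhdsWithin_of_mem_nhds (hf.eventually_tangentPlane_eq_iff hn u v),
      self_mem_nhdsWithin] with v' h1 h2
    have h3 := h1 (connectedComponentIn_subset _ _ h2)
    exact ⟨h3, h3.symm⟩

/-! ### Singular points of the rulings -/

theorem exists_isAdaptedFrame (hn : 3 ≤ n) (hf : IsLightlikeHypersurface f) (u : M) :
    ∃ A₀ A₁ e Aₙ Aₙ₁, IsAdaptedFrame (darboux ∘ f) u A₀ A₁ e Aₙ Aₙ₁ := by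
  obtain ⟨A₀, A₁, e, Aₙ, Aₙ₁, hF⟩ := (hf.isLightlikeLift u).exists_coordFrame hn
  exact ⟨_, _, _, _, _, hF.isAdaptedFrame hn hf⟩

theorem grassmannRank_eq (hn : 3 ≤ n) (hf : IsLightlikeHypersurface f) (u : M) :
    grassmannRank (tangentPlane (darboux ∘ f)) u = n - 2 := by
  obtain ⟨A₀, A₁, e, Aₙ, Aₙ₁, hF⟩ := (hf.isLightlikeLift u).exists_coordFrame hn
  exact hF.grassmannRank_eq hn (hf.isLightlikeLift u) (hf.eventually_tangentPlane_eq hn u)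

theorem projSweptTangent_eq_tangentPlane (hn : 3 ≤ n) (hf : IsLightlikeHypersurface f) {u : M}
    {P : ProjSpace n} (hP : P.submodule ≤ rulingLine f u)
    (hs : ¬ IsProjSingularPoint (rulingLine f) u P) :
    projSweptTangent (rulingLine f) u P = tangentPlane (darboux ∘ f) u := by
  have hle := (hf.isLightlikeLift u).projSweptTangent_le hn (hf.eventually_rulingLine_eq hn u) P
  rw [hf.tangentPlane_eq hn]
  refine Submodule.eq_of_le_of_finrank_le hle ?_
  rw [(hf.isLightlikeAt u).finrank_osc hn]
  exact not_lt.1 fun h => hs ⟨hP, h⟩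

/-- The swept tangent space contains the whole ruling, so the point itself accounts for the one
dimension lost on passing to the conformal space. -/
theorem submodule_le_projSweptTangent (hn : 3 ≤ n) (hf : IsLightlikeHypersurface f) {u : M}
    {P : ProjSpace n} (hP : P.submodule ≤ rulingLine f u) :
    P.submodule ≤ projSweptTangent (rulingLine f) u P := by
  obtain ⟨A₀, A₁, e, Aₙ, Aₙ₁, hF⟩ := (hf.isLightlikeLift u).exists_coordFrame hn
  have h1 := hP (rep_mem_submodule P)
  rw [hf.rulingLine_eq hn, (hF.isPerpBasis hn (hf.isLightlikeLift u)).span_eq] at h1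
  obtain ⟨α, β, hαβ⟩ := Submodule.mem_span_pair.1 h1
  rw [hF.projSweptTangent_eq hn (hf.isLightlikeLift u) (hf.eventually_rulingLine_eq hn u)
    (α := α) (β := β) (by rw [hαβ]; exact P.submodule_eq), ← hf.rulingLine_eq hn]
  exact hP.trans le_sup_left

theorem image_isSingularPoint (hn : 3 ≤ n) (hf : IsLightlikeHypersurface f) (u : M) :
    darboux '' {X | IsSingularPoint (fun v => darbouxPreimage (rulingLine f v)) u X} =
      {P | IsProjSingularPoint (rulingLine f) u P} :=
  LightlikeDarboux.image_isSingularPoint hn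
    (fun v X hX => (hf.isIsotropicPlane_rulingLine hn v).isotropic X hX X hX)
    fun _ hP => hf.submodule_le_projSweptTangent hn hP

theorem frame_properties (hn : 3 ≤ n) (hf : IsLightlikeHypersurface f) {u : M}
    {A₀ A₁ : M → PolyVec n} {e : Fin (n - 2) → M → PolyVec n} {Aₙ Aₙ₁ : M → PolyVec n}
    (hA : IsAdaptedFrame (darboux ∘ f) u A₀ A₁ e Aₙ Aₙ₁) :
    rulingLine f u = Submodule.span ℝ {A₀ u, A₁ u} ∧
      ∃ Λ : Matrix (Fin (n - 2)) (Fin (n - 2)) ℝ,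
        IsAffinor u A₀ A₁ e Λ ∧ (∀ Λ', IsAffinor u A₀ A₁ e Λ' → Λ' = Λ) ∧
        (frameMetric e u).PosDef ∧ (frameMetric e u * Λ).IsSymm ∧
        (singularPolynomial Λ).roots.card = n - 2 ∧
        ∀ P, IsProjSingularPoint (rulingLine f) u P ↔
          ∃ x : ℝ, (Λ + x • (1 : Matrix (Fin (n - 2)) (Fin (n - 2)) ℝ)).det = 0 ∧
            P.submodule = Submodule.span ℝ {A₁ u + x • A₀ u} := by
  have hlift := hf.isLightlikeLift u
  have hF := hA.coord hn hf
  have hinv : ∀ A : M → PolyVec n, (A ∘ (coordAt n u).symm) (coordAt n u u) = A u := fun A => by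
    simp only [Function.comp_apply, extChartAt_to_inv]
  have hB := hF.isPerpBasis hn hlift
  simp only [hinv, ← hf.rulingLine_eq hn] at hB
  have hpos : (frameMetric e u).PosDef := hB.posDef hn
  obtain ⟨Λ, hΛ, hsymm⟩ := hF.exists_affinor hn hlift
  have haff := isAffinor_iff hn hB hA.smooth_zero hA.smooth_one
    (by simpa only [← hf.rulingLine_eq hn] using hF.fderiv_zero_mem hn hlift)
    (by simpa only [← hf.rulingLine_eq hn] using hF.fderiv_one_mem hn hlift)
  have hsing := hF.isProjSingularPoint_iff hn hlift (hf.eventually_rulingLine_eq hn u) hΛ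
  simp only [hinv] at hsing hsymm
  have hΛ' : IsAffinor u A₀ A₁ e Λ := (haff Λ).2 (by
    simpa only [principalForm_apply, hinv] using hΛ)
  refine ⟨hB.span_eq, Λ, hΛ', fun Λ' h' => ?_, hpos, hsymm,
    card_roots_singularPolynomial hpos hsymm, hsing⟩
  refine hF.affinor_unique hn hlift fun ξ => ?_
  have h1 := (haff Λ').1 h' ξ
  have h2 := (haff Λ).1 hΛ' ξ
  simp only [principalForm_apply, hinv]
  rw [← h1, h2]

end IsLightlikeHypersurface

end Rulings

end LightlikeDarboux

/-! ### The main theorem -/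

open scoped Manifold ContDiff Topology in
open LightlikeDarboux in
theorem theorem1 {n : ℕ} (hn : 3 ≤ n) {M : Type*} [TopologicalSpace M]
    [ChartedSpace (EuclideanSpace ℝ (Fin (n - 1))) M] [IsManifold (𝓡 (n - 1)) ∞ M]
    (f : M → ConformalSpace n) (hf : IsLightlikeHypersurface f) :
    -- the image `U` is an `(n-1)`-dimensional submanifold contained in the Darboux hyperquadric
    IsProjImmersion (darboux ∘ f) ∧
    (Topology.IsEmbedding f → Topology.IsEmbedding (darboux ∘ f)) ∧
    (∀ u, darboux (f u) ∈ darbouxQuadric n) ∧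
    ∃ (L : M → Set (ConformalSpace n)) (ℓ : M → Submodule ℝ (PolyVec n)),
      -- `L u` is the isotropic line of `V` through `f u`
      (∀ u, IsIsotropicGenerator f u (L u) ∧
        ∀ L', IsIsotropicGenerator f u L' → L' = L u) ∧
      -- `U` is ruled by the isotropic straight lines `ℓ u`, the images of the lines `L u`
      (∀ u, IsRuling (darboux ∘ f) u (ℓ u) ∧ ∀ ℓ', IsRuling (darboux ∘ f) u ℓ' → ℓ' = ℓ u) ∧
      (∀ u, ∀ X ∈ ℓ u, polyForm n X X = 0) ∧
      (∀ u, darboux '' L u = {P | P.submodule ≤ ℓ u}) ∧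
      -- `U` is tangentially degenerate of rank `n - 2`
      (∀ u, grassmannRank (tangentPlane (darboux ∘ f)) u = n - 2) ∧
      (∀ u, ∀ u' ∈ connectedComponentIn {v | (darboux (f v)).submodule ≤ ℓ u} u,
        ℓ u' = ℓ u ∧ tangentPlane (darboux ∘ f) u' = tangentPlane (darboux ∘ f) u) ∧
      (∀ u P, P.submodule ≤ ℓ u → ¬ IsProjSingularPoint ℓ u P →
        projSweptTangent ℓ u P = tangentPlane (darboux ∘ f) u) ∧
      -- the singular points of the generators
      (∀ u, ∃ A₀ A₁ e Aₙ Aₙ₁, IsAdaptedFrame (darboux ∘ f) u A₀ A₁ e Aₙ Aₙ₁) ∧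
      (∀ u A₀ A₁ e Aₙ Aₙ₁, IsAdaptedFrame (darboux ∘ f) u A₀ A₁ e Aₙ Aₙ₁ →
        ℓ u = Submodule.span ℝ {A₀ u, A₁ u} ∧
        ∃ Λ : Matrix (Fin (n - 2)) (Fin (n - 2)) ℝ,
          IsAffinor u A₀ A₁ e Λ ∧ (∀ Λ', IsAffinor u A₀ A₁ e Λ' → Λ' = Λ) ∧
          (frameMetric e u).PosDef ∧ (frameMetric e u * Λ).IsSymm ∧
          (singularPolynomial Λ).roots.card = n - 2 ∧
          ∀ P, IsProjSingularPoint ℓ u P ↔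
            ∃ x : ℝ, (Λ + x • (1 : Matrix (Fin (n - 2)) (Fin (n - 2)) ℝ)).det = 0 ∧
              P.submodule = Submodule.span ℝ {A₁ u + x • A₀ u}) ∧
      -- they are the images of the singular points of `V`
      (∀ u, darboux '' {X | IsSingularPoint L u X} = {P | IsProjSingularPoint ℓ u P}) := by
  refine ⟨hf.isProjImmersion hn, fun h => isEmbedding_darboux.comp h,
    fun u => darboux_mem_quadric (f u), fun u => darbouxPreimage (rulingLine f u), rulingLine f,
    fun u => ⟨hf.isIsotropicGenerator_rulingLine hn u, fun _ => hf.eq_of_isIsotropicGenerator hn⟩,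
    fun u => ⟨hf.isRuling_rulingLine hn u, fun _ => hf.eq_of_isRuling hn⟩,
    fun u X hX => (hf.isIsotropicPlane_rulingLine hn u).isotropic X hX X hX,
    fun u => image_darbouxPreimage fun X hX =>
      (hf.isIsotropicPlane_rulingLine hn u).isotropic X hX X hX,
    hf.grassmannRank_eq hn, fun u u' hu' => ?_,
    fun u P hP hs => hf.projSweptTangent_eq_tangentPlane hn hP hs,
    hf.exists_isAdaptedFrame hn, fun u A₀ A₁ e Aₙ Aₙ₁ hA => hf.frame_properties hn hA,
    hf.image_isSingularPoint hn⟩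
  have h := hf.tangentPlane_eq_of_mem_component hn hu'
  exact ⟨congrArg perp h, h⟩
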